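/- **Setting.** Let $A,A_1\in\mathbb R^{n\times n}$, $B\in\mathbb R^{n\times1}$, $K\in\mathbb R^{1\times n}$, $a,a_2,c\in\mathbb R$, $\bar u>0$, $h\ge h_0>0$, and let $\tau\in C^1([0,\infty))$ satisfy $h_0\le\tau(t)\le h$. Write $|\cdot|$ for the Euclidean norm, $\|\cdot\|$ for the norm of $L^2(0,1)$, $\mathcal H_1=\mathbb R^n\times H^1(0,1)$ with $\|(X,u)\|_{\mathcal H_1}^2=|X|^2+\|u\|^2+\|u'\|^2$, and ${\rm sat}(U,\bar u)={\rm sign}(U)\min(|U|,\bar u)$. *Kernels.* Let $$\gamma(x)=[K\ \ 0]\,e^{\left[\begin{smallmatrix}0&A-aI\\ I&0\end{smallmatrix}\right]x}\begin{bmatrix}I\\0\end{bmatrix},\qquad \psi(x)=[K\ \ 0]\,e^{\left[\begin{smallmatrix}0&A+BK-aI\\ I&0\end{smallmatrix}\right]x}\begin{bmatrix}I\\0\end{bmatrix},$$ $$k(x,y)=\int_0^{x-y}\gamma(\sigma)B\,d\sigma,\qquad n(x,y)=\int_0^{x-y}\psi(\sigma)B\,d\sigma,$$ $$q(x,y)=-(a+c)\,x\,\frac{I_1(s)}{s},\qquad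 l(x,y)=-(a+c)\,x\,\frac{J_1(s)}{s},\qquad s=\sqrt{(a+c)(x^2-y^2)},$$ where $I_1,J_1$ are the (modified) Bessel functions of order one and $I_1(s)/s$, $J_1(s)/s$ are read as entire functions of $s^2$ (with value $\tfrac12$ at $s=0$). *Feedback.* For $(X,u)\in\mathcal H_1$ put $w(x)=u(x)-\int_0^xk(x,y)u(y)\,dy-\gamma(x)X$ and $$U(X,u)=\int_0^1k_x(1,y)u(y)\,dy+\gamma'(1)X+q(1,1)w(1)+\int_0^1q_x(1,y)w(y)\,dy .$$ *Closed-loop system.* For $t>0$ and $x\in(0,1)$, $$\dot X(t)=AX(t)+A_1X(t-\tau(t))+Bu(0,t),\qquad u_t(x,t)=u_{xx}(x,t)+a_2u(x,t-\tau(t))+au(x,t),$$ $$u_x(0,t)=0,\qquad u_x(1,t)={\rm sat}\big(U(X(t),u(\cdot,t)),\bar u\big),\qquad (X(\theta),u(\cdot,\theta))=(X_0(\theta),u_0(\theta)),\ -h\le\theta\le0. \tag{1}$$ A classical solution is a pair $(X,u)$ on $[-h,\infty)$ that takes the given initial functions on $[-h,0]$, is continuous from $[0,\infty)$ to $\mathcal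 H_1$ and $C^1$ from $(0,\infty)$ to $\mathbb R^n\times L^2(0,1)$, has $u(\cdot,t)\in H^2(0,1)$ for $t>0$, and satisfies (1), the time derivative of $u$ being taken in $L^2(0,1)$. *Initial functions.* Let $D(\mathcal A_u)=\{(X,u)\in\mathbb R^n\times H^2(0,1):u'(0)=0,\ u'(1)=U(X,u)\}$ with the norm of $\mathbb R^n\times H^2(0,1)$, and $W_1=C([-h,0],D(\mathcal A_u))\cap C^1([-h,0],\mathcal H_1)$. *Constants.* Below, $\max|f|$ for a kernel $f(x,y)$ is over $0\le y\le x\le1$; all other maxima are over $[0,1]$. Let $\zeta=(1+\max|q|)^2(\max|\gamma|)^2$, $$\xi=\max_y|n_x(1,y)|\,(1+\max|l|)+\max_y|l_x(1,y)|,\quad c_1=|\psi'(1)|,\quad c_2=\sqrt2\,|l(1,1)|+\xi,\quad c_3=|l(1,1)|,$$ $$Q=\max_x|q(x,x)|+\max|q_x|,\qquad M_1=\{8Q^2+2(1+\max|q|)^2\}(\max|\gamma|)^2+4\max|\gamma'|^2+1,$$ $$M_2=8Q^2(1+\max|k|)^2+4\max|k_x|^2+2(1+\max|k|)^2(1+\max|q|)^2,$$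 and for $\beta>0$ $$\mathcal X_u=\Big\{(X_0,u_0)\in W_1:\ M_1\max_{[-h,0]}|X_0|^2+M_2\max_{[-h,0]}\|u_0\|^2+4\max_{[-h,0]}\|u_0'\|^2\le\beta^{-1}\Big\}.$$ **Theorem.** Let $r>0$, $0<r_1<2$, $0<\delta_1=\delta_0$. Suppose that there are a symmetric matrix $P>0$ in $\mathbb R^{n\times n}$ and scalars $p_1>0$, $p_2>0$, $\lambda>0$, $\lambda_1\ge0$ such that $$\begin{bmatrix}P(A+BK)+(A+BK)^\top P+2\delta_0P&PA_1&PB\\ \ast&-2\delta_1P+(p_1r^{-1}+p_2r_1^{-1})\,\zeta\,(A_1-a_2I)^\top(A_1-a_2I)&0\\ \ast&\ast&-\lambda\end{bmatrix}<0,$$ $$\begin{bmatrix}(-2c+2\delta_0+r)p_1+2\lambda&a_2p_1&0\\ \ast&-2\delta_1p_1&-a_2p_2\\ \ast&\ast&-(2-r_1)p_2+\lambda_1\end{bmatrix}<0,$$ $$-2p_1-2p_2c+\lambda+2\delta_0p_2-\tfrac{\pi^2}{4}\lambda_1\le0,$$ $$P\le\beta I,\quad p_1\le\beta,\quad p_2\le\beta,\qquad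 \tfrac{\bar u^2}{3}P-c_1^2I\ge0,\quad \tfrac{\bar u^2}{3}p_1-c_2^2\ge0,\quad \tfrac{\bar u^2}{3}p_2-c_3^2\ge0 .$$ Then, for all $h_0,h$ and all delays $\tau$ as above, every classical solution of (1) with initial functions $(X_0,u_0)\in\mathcal X_u$ satisfies $$\lim_{t\to\infty}\|(X(t),u(\cdot,t))\|_{\mathcal H_1}=0 .$$ -/

import Mathlib

open MeasureTheory Set Filter Topology

noncomputable section

namespace HeatODE

/-! ### Functions on `[0,1]`, Sobolev spaces, norms

A profile `u(·,t)` is a function `ℝ → ℝ` of which only the values on `[0,1]` matter. Elements of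
`H¹(0,1)` and `H²(0,1)` are identified with their (absolutely) continuous representatives. -/

/-- Spatial derivative on `[0,1]` (one-sided at the end points). -/
def dx (f : ℝ → ℝ) : ℝ → ℝ := derivWithin f (Icc 0 1)

/-- The Hilbert space `L²(0,1)`. -/
abbrev L2 : Type := Lp ℝ 2 (volume.restrict (Ioo (0 : ℝ) 1))

open Classical in
/-- The class in `L²(0,1)` of a square integrable function (`0` for any other function). -/
def toL2 (f : ℝ → ℝ) : L2 :=
  if hf : MemLp f 2 (volume.restrict (Ioo (0 : ℝ) 1)) then hf.toLp f else 0

/-- `f ∈ H¹(0,1)`: absolutely continuous on `[0,1]` with square integrable derivative. -/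
def MemH1 (f : ℝ → ℝ) : Prop :=
  AbsolutelyContinuousOnInterval f 0 1 ∧ MemLp (dx f) 2 (volume.restrict (Ioo (0 : ℝ) 1))

/-- `f ∈ H²(0,1)`: differentiable on `[0,1]` with derivative in `H¹(0,1)`. -/
def MemH2 (f : ℝ → ℝ) : Prop :=
  DifferentiableOn ℝ f (Icc 0 1) ∧ MemH1 (dx f)

/-- The norm of `ℝⁿ × H¹(0,1)`. -/
def normH1 {n : ℕ} (X : EuclideanSpace ℝ (Fin n)) (f : ℝ → ℝ) : ℝ :=
  Real.sqrt (‖X‖ ^ 2 + ‖toL2 f‖ ^ 2 + ‖toL2 (dx f)‖ ^ 2)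

/-- `max_{0 ≤ x ≤ 1} f(x)`, for continuous `f`. -/
def segMax (f : ℝ → ℝ) : ℝ := sSup (f '' Icc 0 1)

/-- `max_{0 ≤ y ≤ x ≤ 1} |f(x,y)|`, for continuous `f`. -/
def triMax (f : ℝ → ℝ → ℝ) : ℝ :=
  sSup ((fun p : ℝ × ℝ => |f p.1 p.2|) '' {p | 0 ≤ p.2 ∧ p.2 ≤ p.1 ∧ p.1 ≤ 1})

/-- `max_{-h ≤ θ ≤ 0} F(θ)`, for continuous `F`. -/
def histMax (h : ℝ) (F : ℝ → ℝ) : ℝ := sSup (F '' Icc (-h) 0)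

/-- `sat(U, ū) = sign(U) min(|U|, ū)`. -/
def sat (U ubar : ℝ) : ℝ := Real.sign U * min |U| ubar

/-! ### Backstepping kernels -/

variable {n : ℕ}

/-- The row vector `[K 0] exp([[0, D], [I, 0]] x) [I; 0]`. -/
def rowKernel (D : Matrix (Fin n) (Fin n) ℝ) (K : Matrix (Fin 1) (Fin n) ℝ) (x : ℝ) :
    EuclideanSpace ℝ (Fin n) :=
  WithLp.toLp 2 fun j =>
    ((Matrix.fromCols K (0 : Matrix (Fin 1) (Fin n) ℝ)
      * (NormedSpace.exp (x • Matrix.fromBlocks (0 : Matrix (Fin n) (Fin n) ℝ) D 1 0) :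
          Matrix (Fin n ⊕ Fin n) (Fin n ⊕ Fin n) ℝ)
      * Matrix.fromRows (1 : Matrix (Fin n) (Fin n) ℝ) (0 : Matrix (Fin n) (Fin n) ℝ)) :
        Matrix (Fin 1) (Fin n) ℝ) 0 j

/-- A column matrix as a vector. -/
def colVec (B : Matrix (Fin n) (Fin 1) ℝ) : EuclideanSpace ℝ (Fin n) :=
  WithLp.toLp 2 fun i => B i 0

/-- The kernel `γ(x)`; the product `γ(x) X` is `inner ℝ (gam A K a x) X`. -/
def gam (A : Matrix (Fin n) (Fin n) ℝ) (K : Matrix (Fin 1) (Fin n) ℝ) (a : ℝ) :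
    ℝ → EuclideanSpace ℝ (Fin n) :=
  rowKernel (A - a • 1) K

/-- The kernel `ψ(x)` of the inverse transformation. -/
def psi (A : Matrix (Fin n) (Fin n) ℝ) (B : Matrix (Fin n) (Fin 1) ℝ)
    (K : Matrix (Fin 1) (Fin n) ℝ) (a : ℝ) : ℝ → EuclideanSpace ℝ (Fin n) :=
  rowKernel (A + B * K - a • 1) K

/-- `k(x,y) = ∫₀^{x-y} γ(σ) B dσ`. -/
def kKer (A : Matrix (Fin n) (Fin n) ℝ) (B : Matrix (Fin n) (Fin 1) ℝ)
    (K : Matrix (Fin 1) (Fin n) ℝ) (a : ℝ) (x y : ℝ) : ℝ :=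
  ∫ s in (0 : ℝ)..(x - y), inner ℝ (gam A K a s) (colVec B)

/-- `n(x,y) = ∫₀^{x-y} ψ(σ) B dσ`. -/
def nKer (A : Matrix (Fin n) (Fin n) ℝ) (B : Matrix (Fin n) (Fin 1) ℝ)
    (K : Matrix (Fin 1) (Fin n) ℝ) (a : ℝ) (x y : ℝ) : ℝ :=
  ∫ s in (0 : ℝ)..(x - y), inner ℝ (psi A B K a s) (colVec B)

/-- Modified Bessel function of the first kind and order one. -/
def besselI1 (x : ℝ) : ℝ :=
  ∑' m : ℕ, (x / 2) ^ (2 * m + 1) / ((m.factorial : ℝ) * ((m + 1).factorial : ℝ))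

/-- Bessel function of the first kind and order one. -/
def besselJ1 (x : ℝ) : ℝ :=
  ∑' m : ℕ, (-1) ^ m * (x / 2) ^ (2 * m + 1) / ((m.factorial : ℝ) * ((m + 1).factorial : ℝ))

/-- The entire function with `besselQuot (s ^ 2) = I₁(s)/s` and `besselQuot (-s ^ 2) = J₁(s)/s`
for `s ≠ 0`; its value at `0` is the limit `1/2`. -/
def besselQuot (z : ℝ) : ℝ :=
  ∑' m : ℕ, (z / 4) ^ m / (2 * ((m.factorial : ℝ) * ((m + 1).factorial : ℝ)))

theorem besselQuot_sq (s : ℝ) (hs : s ≠ 0) : besselQuot (s ^ 2) = besselI1 s / s := by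
  unfold besselQuot besselI1
  rw [← tsum_div_const]
  refine tsum_congr fun m => ?_
  have h : (s / 2) ^ (2 * m + 1) = (s ^ 2 / 4) ^ m * (s / 2) := by
    rw [pow_succ, pow_mul]; congr 2; ring
  rw [h]; field_simp

theorem besselQuot_neg_sq (s : ℝ) (hs : s ≠ 0) : besselQuot (-s ^ 2) = besselJ1 s / s := by
  unfold besselQuot besselJ1
  rw [← tsum_div_const]
  refine tsum_congr fun m => ?_
  have h : (-1 : ℝ) ^ m * (s / 2) ^ (2 * m + 1) = (-s ^ 2 / 4) ^ m * (s / 2) := by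
    rw [pow_succ, pow_mul, ← mul_assoc, ← mul_pow]; congr 2; ring
  rw [h]; field_simp

/-- `q(x,y) = -(a+c) x I₁(√((a+c)(x²-y²))) / √((a+c)(x²-y²))`. -/
def qKer (a c x y : ℝ) : ℝ := -(a + c) * x * besselQuot ((a + c) * (x ^ 2 - y ^ 2))

/-- `l(x,y) = -(a+c) x J₁(√((a+c)(x²-y²))) / √((a+c)(x²-y²))`. -/
def lKer (a c x y : ℝ) : ℝ := -(a + c) * x * besselQuot (-((a + c) * (x ^ 2 - y ^ 2)))

theorem qKer_eq (a c x y : ℝ) (h : 0 < (a + c) * (x ^ 2 - y ^ 2)) :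
    qKer a c x y = -(a + c) * x *
      (besselI1 (Real.sqrt ((a + c) * (x ^ 2 - y ^ 2))) / Real.sqrt ((a + c) * (x ^ 2 - y ^ 2))) := by
  rw [← besselQuot_sq _ (Real.sqrt_pos.2 h).ne', Real.sq_sqrt h.le, qKer]

theorem lKer_eq (a c x y : ℝ) (h : 0 < (a + c) * (x ^ 2 - y ^ 2)) :
    lKer a c x y = -(a + c) * x *
      (besselJ1 (Real.sqrt ((a + c) * (x ^ 2 - y ^ 2))) / Real.sqrt ((a + c) * (x ^ 2 - y ^ 2))) := by
  rw [← besselQuot_neg_sq _ (Real.sqrt_pos.2 h).ne', Real.sq_sqrt h.le, lKer]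

/-- The derivative of a kernel in its first variable. -/
def partialX (f : ℝ → ℝ → ℝ) (x y : ℝ) : ℝ := deriv (fun s => f s y) x

/-! ### Backstepping transformation and feedback -/

/-- `w(x) = u(x) - ∫₀ˣ k(x,y) u(y) dy - γ(x) X`. -/
def wTrans (A : Matrix (Fin n) (Fin n) ℝ) (B : Matrix (Fin n) (Fin 1) ℝ)
    (K : Matrix (Fin 1) (Fin n) ℝ) (a : ℝ) (X : EuclideanSpace ℝ (Fin n)) (u : ℝ → ℝ)
    (x : ℝ) : ℝ :=
  u x - (∫ y in (0 : ℝ)..x, kKer A B K a x y * u y) - inner ℝ (gam A K a x) X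

/-- The Neumann backstepping control
`U = ∫₀¹ kₓ(1,y) u(y) dy + γ'(1) X + q(1,1) w(1) + ∫₀¹ qₓ(1,y) w(y) dy`. -/
def feedback (A : Matrix (Fin n) (Fin n) ℝ) (B : Matrix (Fin n) (Fin 1) ℝ)
    (K : Matrix (Fin 1) (Fin n) ℝ) (a c : ℝ) (X : EuclideanSpace ℝ (Fin n)) (u : ℝ → ℝ) : ℝ :=
  (∫ y in (0 : ℝ)..1, partialX (kKer A B K a) 1 y * u y)
    + inner ℝ (deriv (gam A K a) 1) X
    + qKer a c 1 1 * wTrans A B K a X u 1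
    + ∫ y in (0 : ℝ)..1, partialX (qKer a c) 1 y * wTrans A B K a X u y

/-! ### Constants -/

/-- `ζ = (1 + max |q|)² (max |γ|)²`. -/
def zeta (A : Matrix (Fin n) (Fin n) ℝ) (K : Matrix (Fin 1) (Fin n) ℝ) (a c : ℝ) : ℝ :=
  (1 + triMax (qKer a c)) ^ 2 * segMax (fun x => ‖gam A K a x‖) ^ 2

/-- `c₁ = |ψ'(1)|`. -/
def cOne (A : Matrix (Fin n) (Fin n) ℝ) (B : Matrix (Fin n) (Fin 1) ℝ)
    (K : Matrix (Fin 1) (Fin n) ℝ) (a : ℝ) : ℝ :=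
  ‖deriv (psi A B K a) 1‖

/-- `ξ = max |nₓ(1,y)| (1 + max |l(x,y)|) + max |lₓ(1,y)|`. -/
def xiConst (A : Matrix (Fin n) (Fin n) ℝ) (B : Matrix (Fin n) (Fin 1) ℝ)
    (K : Matrix (Fin 1) (Fin n) ℝ) (a c : ℝ) : ℝ :=
  segMax (fun y => |partialX (nKer A B K a) 1 y|) * (1 + triMax (lKer a c))
    + segMax (fun y => |partialX (lKer a c) 1 y|)

/-- `c₂ = √2 |l(1,1)| + ξ`. -/
def cTwo (A : Matrix (Fin n) (Fin n) ℝ) (B : Matrix (Fin n) (Fin 1) ℝ)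
    (K : Matrix (Fin 1) (Fin n) ℝ) (a c : ℝ) : ℝ :=
  Real.sqrt 2 * |lKer a c 1 1| + xiConst A B K a c

/-- `c₃ = |l(1,1)|`. -/
def cThree (a c : ℝ) : ℝ := |lKer a c 1 1|

/-- `Q = max |q(x,x)| + max |qₓ(x,y)|`, an abbreviation used in `M₁` and `M₂`. -/
def Qconst (a c : ℝ) : ℝ :=
  segMax (fun x => |qKer a c x x|) + triMax (partialX (qKer a c))

/-- The weight `M₁`. -/
def MOne (A : Matrix (Fin n) (Fin n) ℝ) (K : Matrix (Fin 1) (Fin n) ℝ) (a c : ℝ) : ℝ :=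
  (8 * Qconst a c ^ 2 + 2 * (1 + triMax (qKer a c)) ^ 2) * segMax (fun x => ‖gam A K a x‖) ^ 2
    + 4 * segMax (fun x => ‖deriv (gam A K a) x‖ ^ 2) + 1

/-- The weight `M₂`. -/
def MTwo (A : Matrix (Fin n) (Fin n) ℝ) (B : Matrix (Fin n) (Fin 1) ℝ)
    (K : Matrix (Fin 1) (Fin n) ℝ) (a c : ℝ) : ℝ :=
  8 * Qconst a c ^ 2 * (1 + triMax (kKer A B K a)) ^ 2
    + 4 * triMax (partialX (kKer A B K a)) ^ 2
    + 2 * (1 + triMax (kKer A B K a)) ^ 2 * (1 + triMax (qKer a c)) ^ 2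

/-! ### Matrices of the linear matrix inequalities -/

/-- The symmetric block matrix
`Ξ = [[θ₁₁, P A₁, P B], [*, -2 δ₁ P, 0], [*, *, -λ]]`,
`θ₁₁ = P (A + B K) + (A + B K)ᵀ P + 2 δ₀ P`. -/
def Xi (A A₁ : Matrix (Fin n) (Fin n) ℝ) (B : Matrix (Fin n) (Fin 1) ℝ)
    (K : Matrix (Fin 1) (Fin n) ℝ) (P : Matrix (Fin n) (Fin n) ℝ) (δ₀ δ₁ lam : ℝ) :
    Matrix (Fin n ⊕ (Fin n ⊕ Fin 1)) (Fin n ⊕ (Fin n ⊕ Fin 1)) ℝ :=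
  Matrix.fromBlocks
    (P * (A + B * K) + (A + B * K).transpose * P + (2 * δ₀) • P)
    (Matrix.fromCols (P * A₁) (P * B))
    (Matrix.fromRows (P * A₁).transpose (P * B).transpose)
    (Matrix.fromBlocks (-(2 * δ₁) • P) 0 0 (-lam • (1 : Matrix (Fin 1) (Fin 1) ℝ)))

/-- `R = diag{0, ζ (A₁ - a₂ I)ᵀ (A₁ - a₂ I), 0}`. -/
def RMat (A A₁ : Matrix (Fin n) (Fin n) ℝ) (K : Matrix (Fin 1) (Fin n) ℝ) (a a₂ c : ℝ) :
    Matrix (Fin n ⊕ (Fin n ⊕ Fin 1)) (Fin n ⊕ (Fin n ⊕ Fin 1)) ℝ :=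
  Matrix.fromBlocks 0 0 0
    (Matrix.fromBlocks
      (zeta A K a c • ((A₁ - a₂ • (1 : Matrix (Fin n) (Fin n) ℝ)).transpose
        * (A₁ - a₂ • (1 : Matrix (Fin n) (Fin n) ℝ)))) 0 0 0)

/-- `Θ̄₁ = Ξ + (p₁ r⁻¹ + p₂ r₁⁻¹) R`. -/
def ThetaOne (A A₁ : Matrix (Fin n) (Fin n) ℝ) (B : Matrix (Fin n) (Fin 1) ℝ)
    (K : Matrix (Fin 1) (Fin n) ℝ) (a a₂ c : ℝ) (P : Matrix (Fin n) (Fin n) ℝ)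
    (δ₀ δ₁ r r₁ p₁ p₂ lam : ℝ) :
    Matrix (Fin n ⊕ (Fin n ⊕ Fin 1)) (Fin n ⊕ (Fin n ⊕ Fin 1)) ℝ :=
  Xi A A₁ B K P δ₀ δ₁ lam + (p₁ * r⁻¹ + p₂ * r₁⁻¹) • RMat A A₁ K a a₂ c

/-- The `3 × 3` matrix `Θ̄₂`, with `θ₃₃ = -(2 - r₁) p₂ + λ₁`. -/
def ThetaTwo (a₂ c δ₀ δ₁ r r₁ p₁ p₂ lam lam₁ : ℝ) : Matrix (Fin 3) (Fin 3) ℝ :=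
  !![(-2 * c + 2 * δ₀ + r) * p₁ + 2 * lam, a₂ * p₁, 0;
     a₂ * p₁, -2 * δ₁ * p₁, -a₂ * p₂;
     0, -a₂ * p₂, -(2 - r₁) * p₂ + lam₁]

/-! ### Initial functions and classical solutions -/

/-- `(X, u) ∈ D(A_u)`: `u ∈ H²(0,1)`, `u'(0) = 0` and `u'(1)` equals the (unsaturated) feedback. -/
def MemDom (A : Matrix (Fin n) (Fin n) ℝ) (B : Matrix (Fin n) (Fin 1) ℝ)
    (K : Matrix (Fin 1) (Fin n) ℝ) (a c : ℝ) (X : EuclideanSpace ℝ (Fin n)) (u : ℝ → ℝ) : Prop :=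
  MemH2 u ∧ dx u 0 = 0 ∧ dx u 1 = feedback A B K a c X u

/-- `(X₀, u₀) ∈ W₁ = C([-h,0], D(A_u)) ∩ C¹([-h,0], ℝⁿ × H¹(0,1))`, where `D(A_u)` carries the
norm of `ℝⁿ × H²(0,1)`, and `H¹`, `H²` are normed through the `L²` norms of the derivatives. -/
structure MemW1 (A : Matrix (Fin n) (Fin n) ℝ) (B : Matrix (Fin n) (Fin 1) ℝ)
    (K : Matrix (Fin 1) (Fin n) ℝ) (a c h : ℝ)
    (X₀ : ℝ → EuclideanSpace ℝ (Fin n)) (u₀ : ℝ → ℝ → ℝ) : Prop where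
  dom : ∀ θ ∈ Icc (-h) 0, MemDom A B K a c (X₀ θ) (u₀ θ)
  cont_dxx : ContinuousOn (fun θ => toL2 (dx (dx (u₀ θ)))) (Icc (-h) 0)
  diff_X : ContDiffOn ℝ 1 X₀ (Icc (-h) 0)
  diff_u : ContDiffOn ℝ 1 (fun θ => toL2 (u₀ θ)) (Icc (-h) 0)
  diff_ux : ContDiffOn ℝ 1 (fun θ => toL2 (dx (u₀ θ))) (Icc (-h) 0)

/-- The set `𝒳_u` of initial functions. -/
def MemXu (A : Matrix (Fin n) (Fin n) ℝ) (B : Matrix (Fin n) (Fin 1) ℝ)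
    (K : Matrix (Fin 1) (Fin n) ℝ) (a c h β : ℝ)
    (X₀ : ℝ → EuclideanSpace ℝ (Fin n)) (u₀ : ℝ → ℝ → ℝ) : Prop :=
  MemW1 A B K a c h X₀ u₀ ∧
    MOne A K a c * histMax h (fun θ => ‖X₀ θ‖ ^ 2)
      + MTwo A B K a c * histMax h (fun θ => ‖toL2 (u₀ θ)‖ ^ 2)
      + 4 * histMax h (fun θ => ‖toL2 (dx (u₀ θ))‖ ^ 2) ≤ β⁻¹

/-- `(X, u)` is a classical solution on `[-h, ∞)` of
`X'(t) = A X(t) + A₁ X(t - τ(t)) + B u(0,t)`,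
`u_t(x,t) = u_xx(x,t) + a₂ u(x,t - τ(t)) + a u(x,t)`, `u_x(0,t) = 0`,
`u_x(1,t) = sat(U(t), ū)` for `t > 0`, with initial functions `(X₀, u₀)` on `[-h, 0]`.
The time derivative of `u` is taken in `L²(0,1)`, and the state is continuous in `ℝⁿ × H¹(0,1)`
up to `t = 0`. -/
structure IsClassicalSolution (A A₁ : Matrix (Fin n) (Fin n) ℝ) (B : Matrix (Fin n) (Fin 1) ℝ)
    (K : Matrix (Fin 1) (Fin n) ℝ) (a a₂ c ubar h : ℝ) (τ : ℝ → ℝ)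
    (X₀ : ℝ → EuclideanSpace ℝ (Fin n)) (u₀ : ℝ → ℝ → ℝ)
    (X : ℝ → EuclideanSpace ℝ (Fin n)) (u : ℝ → ℝ → ℝ) : Prop where
  init_X : ∀ θ ∈ Icc (-h) 0, X θ = X₀ θ
  init_u : ∀ θ ∈ Icc (-h) 0, ∀ x ∈ Icc (0 : ℝ) 1, u θ x = u₀ θ x
  cont_X : ContinuousOn X (Ici 0)
  cont_u : ContinuousOn (fun t => toL2 (u t)) (Ici 0)
  cont_ux : ContinuousOn (fun t => toL2 (dx (u t))) (Ici 0)
  diff_X : ContDiffOn ℝ 1 X (Ioi 0)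
  diff_u : ContDiffOn ℝ 1 (fun t => toL2 (u t)) (Ioi 0)
  mem_H2 : ∀ t > 0, MemH2 (u t)
  ode : ∀ t > 0, HasDerivAt X
    (WithLp.toLp 2 (A.mulVec (X t).ofLp + A₁.mulVec (X (t - τ t)).ofLp) + u t 0 • colVec B) t
  pde : ∀ t > 0, HasDerivAt (fun s => toL2 (u s))
    (toL2 fun x => dx (dx (u t)) x + a₂ * u (t - τ t) x + a * u t x) t
  bc_zero : ∀ t > 0, dx (u t) 0 = 0
  bc_one : ∀ t > 0, dx (u t) 1 = sat (feedback A B K a c (X t) (u t)) ubar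

end HeatODE

end

open HeatODE

noncomputable section

namespace HeatODE

/-! Backstepping, followed by a Lyapunov–Halanay argument. The map (X, u) ↦ z (`zTrans`) composes
two Volterra transformations, w = u - ∫k u - γX and z = w - ∫q w. The kernels solve κ_xx - κ_yy = mκ
(`WaveKernel`), so two integrations by parts (`WaveKernel.h2_volt`) carry the plant to the target
system X' = (A+BK)X + A₁X_τ + B z(0), z_t = z_xx - c z + a₂ z_τ - G. Here the index τ marks values
at t - τ(t), and G = `zX` ((A₁ - a₂I)X_τ) is all that remains of the mismatch between the two delay
terms (`zU_generator`). The boundary data become z_x(0) = 0 and z_x(1) = sat(U) - U (`feedback_eq`),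
so z_x(1) = 0 as long as |U| ≤ ū.

Let V = XᵀPX + p₁‖z‖² + p₂‖z_x‖² (`lyap`). For an unsaturated state the matrix inequalities, Young's
inequality for G, a bound for z(0)² and Wirtinger's inequality for z_x give, formally, V' ≤
-(2δ₀+ε)V + 2δ₀V(t-τ) (`exists_lyapunov_bound`). On the history V ≤ 1 (`lyap_le`), and U² ≤ (7/9)ū²V
(`feedback_sq_le_lyap`), so the saturation is inactive while V ≤ 9/8. The gap between 1 and 9/8
avoids circularity: `halanay` compares V with (9/8)e^{-αt}. At a first contact the saturation is
inactive, so the differential inequality is available there and excludes the contact.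

A classical solution is C¹ in time only with values in ℝⁿ × L², so ‖z_x‖² need not be
differentiable. But V is a convex quadratic functional. After an integration by parts its tangent at
time t pairs z_xx(t) with z(s) and contains no z_x(s) (`lyap_sub_ge`). Thus V has a differentiable
minorant touching it at t, which is enough at a first contact.

Decay of V gives decay of the state because the transformation has a bounded inverse
(`exists_norm_le_zTrans`). For the q-part the inverse is the same transformation with a + c replaced
by -(a + c); this is checked on even polynomials by induction and extended by density
(`bTrans_bTrans`), without Bessel identities. For the w-part both directions are read off from one
second order linear equation (`wTrans_inverse`). -/

/-- Lebesgue measure on `(0,1)`. -/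
abbrev vol01 : Measure ℝ := volume.restrict (Ioo (0 : ℝ) 1)

/-! ### Null sets and integrals on the unit interval -/

theorem ae_vol01_iff {p : ℝ → Prop} :
    (∀ᵐ x ∂vol01, p x) ↔ ∀ᵐ x, x ∈ Ioo (0 : ℝ) 1 → p x :=
  ae_restrict_iff' measurableSet_Ioo

theorem ae_vol01_of_forall {p : ℝ → Prop} (h : ∀ x ∈ Ioo (0 : ℝ) 1, p x) : ∀ᵐ x ∂vol01, p x :=
  ae_vol01_iff.2 (Eventually.of_forall h)

theorem ae_uIoc_of_ae_vol01 {p : ℝ → Prop} (h : ∀ᵐ x ∂vol01, p x) {x : ℝ} (hx : x ∈ Icc (0 : ℝ) 1) :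
    ∀ᵐ y, y ∈ uIoc 0 x → p y := by
  -- For x = 1 the half-open interval contains the end point 1, about which the hypothesis on (0,1)
  -- says nothing.
  have h1 : ∀ᵐ y : ℝ, y ≠ 1 := by simp [ae_iff, measure_singleton]
  filter_upwards [ae_vol01_iff.1 h, h1] with y hy hy1 hyx
  rw [uIoc_of_le hx.1] at hyx
  exact hy ⟨hyx.1, lt_of_le_of_ne (hyx.2.trans hx.2) hy1⟩

theorem integral_vol01 (f : ℝ → ℝ) : ∫ x, f x ∂vol01 = ∫ x in (0 : ℝ)..1, f x := by
  rw [intervalIntegral.integral_of_le zero_le_one, integral_Ioc_eq_integral_Ioo]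

theorem intervalIntegrable_iff_vol01 {f : ℝ → ℝ} :
    IntervalIntegrable f volume 0 1 ↔ Integrable f vol01 := by
  rw [intervalIntegrable_iff_integrableOn_Ioo_of_le zero_le_one]; rfl

theorem intervalIntegrable_sub {f : ℝ → ℝ} (hf : IntervalIntegrable f volume 0 1) {x : ℝ}
    (hx : x ∈ Icc (0 : ℝ) 1) : IntervalIntegrable f volume 0 x :=
  hf.mono_set (by rw [uIcc_of_le hx.1, uIcc_of_le zero_le_one]; exact Icc_subset_Icc_right hx.2)

/-! ### Calculus of absolutely continuous functions -/

/-- `f` is absolutely continuous on `[0,1]` with almost everywhere derivative `f'`. -/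
structure Prim (f f' : ℝ → ℝ) : Prop where
  ac : AbsolutelyContinuousOnInterval f 0 1
  der : ∀ᵐ x ∂vol01, HasDerivAt f (f' x) x

theorem absolutelyContinuous_congr {f g : ℝ → ℝ} (h : EqOn f g (Icc 0 1))
    (hf : AbsolutelyContinuousOnInterval f 0 1) : AbsolutelyContinuousOnInterval g 0 1 := by
  rw [absolutelyContinuousOnInterval_iff] at hf ⊢
  intro ε hε
  obtain ⟨δ, hδ, H⟩ := hf ε hε
  refine ⟨δ, hδ, fun E hE hlt => ?_⟩
  have := H E hE hlt
  rwa [Finset.sum_congr rfl fun i hi => ?_]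
  have hi' := hE.1 i hi
  rw [uIcc_of_le zero_le_one] at hi'
  rw [h hi'.1, h hi'.2]

namespace Prim

variable {f f' g g' : ℝ → ℝ}

theorem congr (hf : Prim f f') (h : EqOn f g (Icc 0 1)) : Prim g f' where
  ac := absolutelyContinuous_congr h hf.ac
  der := by
    filter_upwards [hf.der, ae_restrict_mem measurableSet_Ioo] with x hx hx1
    refine hx.congr_of_eventuallyEq ?_
    filter_upwards [Ioo_mem_nhds hx1.1 hx1.2] with y hy using (h (Ioo_subset_Icc_self hy)).symm

theorem congr_der (hf : Prim f f') (h : f' =ᵐ[vol01] g') : Prim f g' where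
  ac := hf.ac
  der := by filter_upwards [hf.der, h] with x hx hx1 using hx1 ▸ hx

theorem congr_deriv (hf : Prim f f') (h : ∀ x ∈ Ioo (0 : ℝ) 1, f' x = g' x) : Prim f g' :=
  hf.congr_der (ae_vol01_of_forall h)

theorem add (hf : Prim f f') (hg : Prim g g') : Prim (fun x => f x + g x) (fun x => f' x + g' x) where
  ac := hf.ac.fun_add hg.ac
  der := by filter_upwards [hf.der, hg.der] with x hx hy using hx.fun_add hy

theorem sub (hf : Prim f f') (hg : Prim g g') : Prim (fun x => f x - g x) (fun x => f' x - g' x) where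
  ac := hf.ac.fun_sub hg.ac
  der := by filter_upwards [hf.der, hg.der] with x hx hy using hx.fun_sub hy

theorem mul (hf : Prim f f') (hg : Prim g g') :
    Prim (fun x => f x * g x) (fun x => f' x * g x + f x * g' x) where
  ac := hf.ac.fun_mul hg.ac
  der := by filter_upwards [hf.der, hg.der] with x hx hy using hx.fun_mul hy

theorem of_hasDerivAt (h : ∀ x, HasDerivAt f (f' x) x) (hc : Continuous f') : Prim f f' where
  ac := by
    refine ContDiffOn.absolutelyContinuousOnInterval (ContDiff.contDiffOn ?_)
    rw [contDiff_one_iff_deriv]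
    refine ⟨fun x => (h x).differentiableAt, ?_⟩
    rwa [show deriv f = f' from funext fun x => (h x).deriv]
  der := Eventually.of_forall h

/-- A bounded one-sided derivative makes f Lipschitz. This version serves functions that are
differentiable only within [0,1] at the end points. -/
theorem of_hasDerivWithinAt (h : ∀ x ∈ Icc (0 : ℝ) 1, HasDerivWithinAt f (f' x) (Icc 0 1) x)
    (hc : ContinuousOn f' (Icc 0 1)) : Prim f f' where
  ac := by
    obtain ⟨C, hC⟩ := isCompact_Icc.exists_bound_of_continuousOn hc
    refine LipschitzOnWith.absolutelyContinuousOnInterval (K := C.toNNReal) ?_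
    rw [uIcc_of_le zero_le_one]
    refine (convex_Icc 0 1).lipschitzOnWith_of_nnnorm_hasDerivWithin_le h fun x hx => ?_
    rw [← NNReal.coe_le_coe, coe_nnnorm]
    exact (hC x hx).trans (Real.le_coe_toNNReal C)
  der := ae_vol01_of_forall fun x hx =>
    (h x (Ioo_subset_Icc_self hx)).hasDerivAt (Icc_mem_nhds hx.1 hx.2)

theorem continuousOn (hf : Prim f f') : ContinuousOn f (Icc 0 1) := by
  simpa [uIcc_of_le (zero_le_one' ℝ)] using hf.ac.continuousOn

theorem intervalIntegrable (hf : Prim f f') : IntervalIntegrable f' volume 0 1 := by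
  refine hf.ac.intervalIntegrable_deriv.congr_ae ?_
  rw [uIoc_of_le zero_le_one, ← restrict_Ioo_eq_restrict_Ioc]
  filter_upwards [hf.der] with x hx using hx.deriv

theorem integral_eq (hf : Prim f f') {x : ℝ} (hx : x ∈ Icc (0 : ℝ) 1) :
    ∫ y in (0 : ℝ)..x, f' y = f x - f 0 := by
  have h1 : AbsolutelyContinuousOnInterval f 0 x := hf.ac.mono (by
    rw [uIcc_of_le hx.1, uIcc_of_le zero_le_one]; exact Icc_subset_Icc_right hx.2)
  rw [← h1.integral_deriv_eq_sub]
  refine intervalIntegral.integral_congr_ae ?_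
  filter_upwards [ae_uIoc_of_ae_vol01 hf.der hx] with y hy hyx using (hy hyx).deriv.symm

/-- Integration by parts. -/
theorem integral_mul (hf : Prim f f') (hg : Prim g g') {x : ℝ} (hx : x ∈ Icc (0 : ℝ) 1) :
    ∫ y in (0 : ℝ)..x, f' y * g y = f x * g x - f 0 * g 0 - ∫ y in (0 : ℝ)..x, f y * g' y := by
  rw [← (hf.mul hg).integral_eq hx, intervalIntegral.integral_add]
  · ring
  · exact (intervalIntegrable_sub hf.intervalIntegrable hx).mul_continuousOn
      (hg.continuousOn.mono (by rw [uIcc_of_le hx.1]; exact Icc_subset_Icc_right hx.2))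
  · exact (intervalIntegrable_sub hg.intervalIntegrable hx).continuousOn_mul
      (hf.continuousOn.mono (by rw [uIcc_of_le hx.1]; exact Icc_subset_Icc_right hx.2))

/-- The uniqueness principle behind the inversion formulas: both sides are shown to have the same
derivative and the same value at 0. -/
theorem eq_of_eq (hf : Prim f f') (hg : Prim g f') (h0 : f 0 = g 0) : EqOn f g (Icc 0 1) := by
  intro x hx
  have := hf.integral_eq hx
  rw [hg.integral_eq hx, h0] at this
  linarith

/-- Almost everywhere derivatives agree almost everywhere; continuity extends this to the end
points, so that derivative identities may be evaluated at x = 1. -/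
theorem eqOn_deriv (hf : Prim f f') (hg : Prim f g') (hf' : ContinuousOn f' (Icc 0 1))
    (hg' : ContinuousOn g' (Icc 0 1)) : EqOn f' g' (Icc 0 1) := by
  refine Measure.eqOn_Icc_of_ae_eq volume zero_ne_one ?_ hf' hg'
  rw [← restrict_Ioo_eq_restrict_Icc]
  filter_upwards [hf.der, hg.der] with x h1 h2 using h1.unique h2

end Prim

/-! ### Classes in `L²(0,1)` -/

/-- Square integrability on `(0,1)`. -/
abbrev Sq (f : ℝ → ℝ) : Prop := MemLp f 2 vol01

theorem toL2_of_sq {f : ℝ → ℝ} (hf : Sq f) : toL2 f = hf.toLp f := by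
  rw [toL2, dif_pos hf]

theorem coeFn_toL2 {f : ℝ → ℝ} (hf : Sq f) : toL2 f =ᵐ[vol01] f := by
  rw [toL2_of_sq hf]; exact hf.coeFn_toLp

theorem toL2_coeFn (f : L2) : toL2 f = f := by
  rw [toL2_of_sq (Lp.memLp f), Lp.toLp_coeFn]

theorem toL2_congr_ae {f g : ℝ → ℝ} (h : f =ᵐ[vol01] g) : toL2 f = toL2 g := by
  by_cases hf : Sq f
  · have hg : Sq g := hf.ae_eq h
    rw [toL2_of_sq hf, toL2_of_sq hg]
    exact (MemLp.toLp_eq_toLp_iff hf hg).2 h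
  · have hg : ¬ Sq g := fun hg => hf (hg.ae_eq h.symm)
    rw [toL2, toL2, dif_neg hf, dif_neg hg]

theorem toL2_congr {f g : ℝ → ℝ} (h : ∀ x ∈ Ioo (0 : ℝ) 1, f x = g x) : toL2 f = toL2 g :=
  toL2_congr_ae (ae_vol01_of_forall h)

theorem toL2_add {f g : ℝ → ℝ} (hf : Sq f) (hg : Sq g) :
    toL2 (fun x => f x + g x) = toL2 f + toL2 g := by
  have h : Sq fun x => f x + g x := hf.add hg
  rw [toL2_of_sq hf, toL2_of_sq hg, toL2_of_sq h, ← MemLp.toLp_add hf hg]; rfl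

theorem toL2_sub {f g : ℝ → ℝ} (hf : Sq f) (hg : Sq g) :
    toL2 (fun x => f x - g x) = toL2 f - toL2 g := by
  have h : Sq fun x => f x - g x := hf.sub hg
  rw [toL2_of_sq hf, toL2_of_sq hg, toL2_of_sq h, ← MemLp.toLp_sub hf hg]; rfl

theorem toL2_const_mul {f : ℝ → ℝ} (c : ℝ) (hf : Sq f) :
    toL2 (fun x => c * f x) = c • toL2 f := by
  have h : Sq fun x => c * f x := hf.const_mul c
  rw [toL2_of_sq hf, toL2_of_sq h, ← MemLp.toLp_const_smul c hf]; rfl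

theorem inner_toL2 {f g : ℝ → ℝ} (hf : Sq f) (hg : Sq g) :
    inner ℝ (toL2 f) (toL2 g) = ∫ x in (0 : ℝ)..1, f x * g x := by
  rw [← integral_vol01, L2.inner_def]
  refine integral_congr_ae ?_
  filter_upwards [coeFn_toL2 hf, coeFn_toL2 hg] with x h1 h2
  simp [h1, h2, mul_comm]

theorem norm_toL2_sq {f : ℝ → ℝ} (hf : Sq f) : ‖toL2 f‖ ^ 2 = ∫ x in (0 : ℝ)..1, f x ^ 2 := by
  rw [← real_inner_self_eq_norm_sq, inner_toL2 hf hf]; simp_rw [sq]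

theorem sq_of_continuousOn {f : ℝ → ℝ} (hf : ContinuousOn f (Icc 0 1)) : Sq f := by
  obtain ⟨C, hC⟩ := isCompact_Icc.exists_bound_of_continuousOn hf
  refine MemLp.of_bound (C := C) ?_ ?_
  · exact (hf.mono Ioo_subset_Icc_self).aestronglyMeasurable measurableSet_Ioo
  · exact ae_vol01_of_forall fun x hx => hC x (Ioo_subset_Icc_self hx)

theorem Sq.integrable {f : ℝ → ℝ} (hf : Sq f) : IntervalIntegrable f volume 0 1 :=
  intervalIntegrable_iff_vol01.2 (MemLp.integrable (by norm_num) hf)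

theorem norm_toL2_le {f : ℝ → ℝ} {C : ℝ} (hC : 0 ≤ C) (h : ∀ x ∈ Ioo (0 : ℝ) 1, |f x| ≤ C) :
    ‖toL2 f‖ ≤ C := by
  by_cases hf : Sq f
  · have h2 : ‖toL2 f‖ ^ 2 ≤ C ^ 2 := by
      rw [norm_toL2_sq hf, ← integral_vol01]
      calc ∫ x, f x ^ 2 ∂vol01 ≤ ∫ x, C ^ 2 ∂vol01 := by
            refine integral_mono_ae hf.integrable_sq (integrable_const _) ?_
            refine ae_vol01_of_forall fun x hx => ?_
            exact sq_le_sq' (abs_le.1 (h x hx)).1 (abs_le.1 (h x hx)).2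
        _ = C ^ 2 := by simp
    exact (sq_le_sq₀ (norm_nonneg _) hC).1 h2
  -- A function that is not square integrable has class 0 by convention, so no measurability is
  -- needed.
  · rw [toL2, dif_neg hf]; simpa using hC

theorem abs_integral_mul_le {f g : ℝ → ℝ} (hf : Sq f) (hg : Sq g) :
    |∫ x in (0 : ℝ)..1, f x * g x| ≤ ‖toL2 f‖ * ‖toL2 g‖ := by
  rw [← inner_toL2 hf hg]; exact abs_real_inner_le_norm _ _

/-- Cauchy–Schwarz against the constant 1. -/
theorem integral_abs_le {f : ℝ → ℝ} (hf : Sq f) : ∫ x in (0 : ℝ)..1, |f x| ≤ ‖toL2 f‖ := by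
  have h1 : Sq fun x => |f x| := hf.abs
  have h2 : Sq fun _ : ℝ => (1 : ℝ) := sq_of_continuousOn continuousOn_const
  have h := abs_integral_mul_le h1 h2
  have h3 : ‖toL2 fun _ : ℝ => (1 : ℝ)‖ ≤ 1 := norm_toL2_le zero_le_one (by simp)
  have h4 : ‖toL2 fun x => |f x|‖ = ‖toL2 f‖ := by
    rw [← sq_eq_sq₀ (norm_nonneg _) (norm_nonneg _), norm_toL2_sq h1, norm_toL2_sq hf]
    simp
  rw [h4] at h
  simp only [mul_one] at h
  calc _ ≤ _ := le_abs_self _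
    _ ≤ _ := h
    _ ≤ ‖toL2 f‖ * 1 := by gcongr
    _ = _ := mul_one _

/-! ### Volterra operators -/

/-- `∫₀ˣ κ(x,y) f(y) dy`. -/
def volt (κ : ℝ → ℝ → ℝ) (f : ℝ → ℝ) (x : ℝ) : ℝ := ∫ y in (0 : ℝ)..x, κ x y * f y

section volt

variable {κ κx : ℝ → ℝ → ℝ} {f g : ℝ → ℝ} {x : ℝ}

theorem volt_congr_ae (h : f =ᵐ[vol01] g) (hx : x ∈ Icc (0 : ℝ) 1) : volt κ f x = volt κ g x := by
  refine intervalIntegral.integral_congr_ae ?_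
  filter_upwards [ae_uIoc_of_ae_vol01 h hx] with y hy hyx
  rw [hy hyx]

theorem volt_congr (h : ∀ x ∈ Ioo (0 : ℝ) 1, f x = g x) (hx : x ∈ Icc (0 : ℝ) 1) :
    volt κ f x = volt κ g x :=
  volt_congr_ae (ae_vol01_of_forall h) hx

theorem volt_integrable (hκ : Continuous (Function.uncurry κ)) (hf : Sq f)
    (hx : x ∈ Icc (0 : ℝ) 1) : IntervalIntegrable (fun y => κ x y * f y) volume 0 x :=
  (intervalIntegrable_sub hf.integrable hx).continuousOn_mul
    (by fun_prop : Continuous fun y => κ x y).continuousOn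

theorem volt_add (hκ : Continuous (Function.uncurry κ)) (hf : Sq f) (hg : Sq g)
    (hx : x ∈ Icc (0 : ℝ) 1) : volt κ (fun y => f y + g y) x = volt κ f x + volt κ g x := by
  rw [volt, volt, volt, ← intervalIntegral.integral_add (volt_integrable hκ hf hx)
    (volt_integrable hκ hg hx)]
  simp_rw [mul_add]

theorem volt_sub (hκ : Continuous (Function.uncurry κ)) (hf : Sq f) (hg : Sq g)
    (hx : x ∈ Icc (0 : ℝ) 1) : volt κ (fun y => f y - g y) x = volt κ f x - volt κ g x := by
  rw [volt, volt, volt, ← intervalIntegral.integral_sub (volt_integrable hκ hf hx)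
    (volt_integrable hκ hg hx)]
  simp_rw [mul_sub]

theorem volt_const_mul (c : ℝ) : volt κ (fun y => c * f y) x = c * volt κ f x := by
  rw [volt, volt, ← intervalIntegral.integral_const_mul]
  congr 1; ext y; ring

theorem volt_zero_right : volt κ f 0 = 0 := by simp [volt]

theorem abs_volt_le {M : ℝ} (hf : Sq f) (hM : 0 ≤ M) (hx : x ∈ Icc (0 : ℝ) 1)
    (h : ∀ y ∈ Icc 0 x, |κ x y| ≤ M) : |volt κ f x| ≤ M * ‖toL2 f‖ := by
  calc |volt κ f x| ≤ ∫ y in (0 : ℝ)..x, M * |f y| := by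
        rw [← Real.norm_eq_abs]
        refine intervalIntegral.norm_integral_le_of_norm_le hx.1 ?_
          ((intervalIntegrable_sub hf.integrable hx).abs.const_mul M)
        refine Eventually.of_forall fun y hy => ?_
        rw [Real.norm_eq_abs, abs_mul]
        exact mul_le_mul_of_nonneg_right (h y (Ioc_subset_Icc_self hy)) (abs_nonneg _)
    _ = M * ∫ y in (0 : ℝ)..x, |f y| := by rw [intervalIntegral.integral_const_mul]
    _ ≤ M * ∫ y in (0 : ℝ)..1, |f y| := by
        refine mul_le_mul_of_nonneg_left ?_ hM
        refine intervalIntegral.integral_mono_interval le_rfl hx.1 hx.2 ?_ hf.integrable.abs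
        exact Eventually.of_forall fun y => abs_nonneg _
    _ ≤ M * ‖toL2 f‖ := mul_le_mul_of_nonneg_left (integral_abs_le hf) hM

theorem continuousOn_volt (hκ : Continuous (Function.uncurry κ)) (hf : Sq f) :
    ContinuousOn (volt κ f) (Icc 0 1) := by
  have hfi := hf.integrable
  -- The variable end point is moved into an indicator, so that dominated convergence applies on the
  -- fixed interval.
  have h1 : ∀ x ∈ Icc (0 : ℝ) 1, volt κ f x =
      ∫ y in (0 : ℝ)..1, (Iio x).indicator (fun y => κ x y * f y) y := by
    intro x hx
    rw [volt, intervalIntegral.integral_of_le hx.1, intervalIntegral.integral_of_le zero_le_one,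
      integral_Ioc_eq_integral_Ioo, integral_Ioc_eq_integral_Ioo,
      setIntegral_indicator measurableSet_Iio]
    congr 2
    ext y
    simp only [mem_Ioo, mem_inter_iff, mem_Iio]
    constructor
    · rintro ⟨h1, h2⟩; exact ⟨⟨h1, h2.trans_le hx.2⟩, h2⟩
    · rintro ⟨⟨h1, _⟩, h2⟩; exact ⟨h1, h2⟩
  refine ContinuousOn.congr ?_ h1
  obtain ⟨C, hC⟩ := (isCompact_Icc (a := (0 : ℝ)) (b := 1)).prod
    (isCompact_Icc (a := (0 : ℝ)) (b := 1)) |>.exists_bound_of_continuousOn hκ.continuousOn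
  intro x₀ hx₀
  refine intervalIntegral.continuousWithinAt_of_dominated_interval
    (bound := fun y => C * |f y|) ?_ ?_ (hfi.abs.const_mul C) ?_
  · refine Eventually.of_forall fun x => ?_
    refine AEStronglyMeasurable.indicator ?_ measurableSet_Iio
    refine ((by fun_prop : Continuous fun y => κ x y).aestronglyMeasurable).mul ?_
    rw [uIoc_of_le zero_le_one]
    exact hfi.1.aestronglyMeasurable
  · filter_upwards [self_mem_nhdsWithin] with x hx
    refine Eventually.of_forall fun y hy => ?_
    rw [uIoc_of_le zero_le_one] at hy
    have hb := hC (x, y) ⟨hx, Ioc_subset_Icc_self hy⟩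
    refine (norm_indicator_le_norm_self _ _).trans ?_
    rw [norm_mul]
    exact mul_le_mul_of_nonneg_right hb (abs_nonneg _)
  -- The indicator jumps only at y = x₀, a null set.
  · have hne : ∀ᵐ y : ℝ, y ≠ x₀ := by simp [ae_iff, measure_singleton]
    filter_upwards [hne] with y hy _
    refine ContinuousAt.continuousWithinAt ?_
    rcases lt_or_gt_of_ne hy with h | h
    · have : ContinuousAt (fun x => κ x y * f y) x₀ :=
        ((by fun_prop : Continuous fun x => κ x y).mul continuous_const).continuousAt
      refine this.congr ?_
      filter_upwards [Ioi_mem_nhds h] with x hx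
      rw [indicator_of_mem (by exact hx)]
    · refine continuousAt_const (y := (0 : ℝ)) |>.congr ?_
      filter_upwards [Iio_mem_nhds h] with x hx
      rw [indicator_of_notMem]
      exact not_lt.2 (le_of_lt (mem_Iio.1 hx))

theorem sq_volt (hκ : Continuous (Function.uncurry κ)) (hf : Sq f) : Sq (volt κ f) :=
  sq_of_continuousOn (continuousOn_volt hκ hf)

/-- Leibniz rule for a Volterra operator with continuous argument. -/
theorem hasDerivAt_volt (hκ : Continuous (Function.uncurry κ))
    (hκx : Continuous (Function.uncurry κx))
    (hd : ∀ x y, HasDerivAt (fun s => κ s y) (κx x y) x) (hf : Continuous f) (x : ℝ) :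
    HasDerivAt (volt κ f) (κ x x * f x + volt κx f x) x := by
  -- The parameter x and the upper limit b are separated. Both partial derivatives are continuous,
  -- so the uncurried function is strictly differentiable and can be composed with the diagonal x ↦
  -- (x, x).
  let F : ℝ → ℝ → ℝ := fun x b => ∫ y in (0 : ℝ)..b, κ x y * f y
  let F1 : ℝ → ℝ → ℝ →L[ℝ] ℝ := fun x b =>
    ContinuousLinearMap.toSpanSingleton ℝ (∫ y in (0 : ℝ)..b, κx x y * f y)
  let F2 : ℝ → ℝ → ℝ →L[ℝ] ℝ := fun x b => ContinuousLinearMap.toSpanSingleton ℝ (κ x b * f b)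
  have hg : Continuous (Function.uncurry fun x y => κ x y * f y) := by
    simp only [Function.uncurry_def] at hκ ⊢; fun_prop
  have hgx : Continuous (Function.uncurry fun x y => κx x y * f y) := by
    simp only [Function.uncurry_def] at hκx ⊢; fun_prop
  have h1 : ∀ x b, HasFDerivAt (fun s => F s b) (F1 x b) x := by
    intro x b
    obtain ⟨C, hC⟩ := ((isCompact_Icc (a := x - 1) (b := x + 1)).prod
      (isCompact_uIcc (a := (0 : ℝ)) (b := b))).exists_bound_of_continuousOn hgx.continuousOn
    refine HasDerivAt.hasFDerivAt (intervalIntegral.hasDerivAt_integral_of_dominated_loc_of_deriv_le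
      (F := fun x y => κ x y * f y) (F' := fun x y => κx x y * f y) (s := Icc (x - 1) (x + 1))
      (bound := fun _ => C) (Icc_mem_nhds (by linarith) (by linarith)) ?_ ?_ ?_ ?_ ?_ ?_).2
    · exact Eventually.of_forall fun s =>
        (by fun_prop : Continuous fun y => κ s y * f y).aestronglyMeasurable
    · exact (by fun_prop : Continuous fun y => κ x y * f y).intervalIntegrable _ _
    · exact (by fun_prop : Continuous fun y => κx x y * f y).aestronglyMeasurable
    · exact Eventually.of_forall fun y hy s hs => hC (s, y) ⟨hs, uIoc_subset_uIcc hy⟩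
    · exact intervalIntegrable_const
    · exact Eventually.of_forall fun y _ s _ => (hd s y).mul_const _
  have h2 : ∀ x b, HasFDerivAt (fun s => F x s) (F2 x b) b := fun x b =>
    HasDerivAt.hasFDerivAt (intervalIntegral.integral_hasDerivAt_right
      ((by fun_prop : Continuous fun y => κ x y * f y).intervalIntegrable _ _)
      ((by fun_prop : Continuous fun y => κ x y * f y).stronglyMeasurableAtFilter _ _)
      (by fun_prop : Continuous fun y => κ x y * f y).continuousAt)
  have c1 : Continuous (Function.uncurry F1) := by
    have : Continuous fun p : ℝ × ℝ => ∫ y in (0 : ℝ)..p.2, κx p.1 y * f y :=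
      intervalIntegral.continuous_parametric_primitive_of_continuous hgx
    exact (ContinuousLinearMap.toSpanSingletonCLE (𝕜 := ℝ) (E := ℝ)).continuous.comp this
  have c2 : Continuous (Function.uncurry F2) :=
    (ContinuousLinearMap.toSpanSingletonCLE (𝕜 := ℝ) (E := ℝ)).continuous.comp hg
  have H := (hasStrictFDerivAt_uncurry_coprod (u := (x, x)) (f := F) (f₁ := F1) (f₂ := F2)
    (Eventually.of_forall fun v => h1 v.1 v.2) (Eventually.of_forall fun v => h2 v.1 v.2)
    c1.continuousAt c2.continuousAt).hasFDerivAt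
  have H2 := HasFDerivAt.comp_hasDerivAt (f := fun x : ℝ => (x, x)) x H
    ((hasDerivAt_id x).prodMk (hasDerivAt_id x))
  refine H2.congr_deriv ?_
  simp [F1, F2, volt, Function.HasUncurry.uncurry]
  ring

/-- Extension to the line, where the Leibniz rule and the second order equation are available
without end point conditions. -/
theorem continuousOn_iccExtend (hf : ContinuousOn f (Icc 0 1)) :
    ∃ g : ℝ → ℝ, Continuous g ∧ EqOn f g (Icc 0 1) :=
  ⟨IccExtend (zero_le_one' ℝ) ((Icc 0 1).domRestrict f),
    (continuousOn_iff_continuous_domRestrict.1 hf).Icc_extend',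
    fun x hx => by rw [IccExtend_of_mem _ _ hx, domRestrict_apply]⟩

theorem Prim.volt (hκ : Continuous (Function.uncurry κ))
    (hκx : Continuous (Function.uncurry κx))
    (hd : ∀ x y, HasDerivAt (fun s => κ s y) (κx x y) x) (hf : ContinuousOn f (Icc 0 1)) :
    Prim (volt κ f) (fun x => κ x x * f x + HeatODE.volt κx f x) := by
  obtain ⟨g, hg, hfg⟩ := continuousOn_iccExtend hf
  have hc : Continuous fun x => κ x x * g x + HeatODE.volt κx g x := by
    have h2 : Continuous (HeatODE.volt κx g) :=
      intervalIntegral.continuous_parametric_intervalIntegral_of_continuous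
        (by simp only [Function.uncurry_def] at hκx ⊢; fun_prop) continuous_id
    fun_prop
  refine ((Prim.of_hasDerivAt (hasDerivAt_volt hκ hκx hd hg) hc).congr fun x hx => ?_).congr_deriv
    fun x hx => ?_
  · exact volt_congr (fun y hy => (hfg (Ioo_subset_Icc_self hy)).symm) hx
  · rw [hfg (Ioo_subset_Icc_self hx), volt_congr (fun y hy => (hfg (Ioo_subset_Icc_self hy)))
      (Ioo_subset_Icc_self hx)]

end volt

/-! ### Volterra operators with wave kernels on H² -/

/-- `f ∈ H²(0,1)` with first and second derivatives `f₁`, `f₂`. -/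
structure H2 (f f₁ f₂ : ℝ → ℝ) : Prop where
  prim : Prim f f₁
  prim₁ : Prim f₁ f₂
  sq : Sq f₂

/-- Kernels on the plane with `κ_xx - κ_yy = m κ`; `D` is the derivative of `x ↦ κ(x,x)`. -/
structure WaveKernel (κ κx κy κxx κyy : ℝ → ℝ → ℝ) (D : ℝ → ℝ) (m : ℝ) : Prop where
  cont : Continuous (Function.uncurry κ)
  cont_x : Continuous (Function.uncurry κx)
  cont_y : Continuous (Function.uncurry κy)
  cont_xx : Continuous (Function.uncurry κxx)
  cont_yy : Continuous (Function.uncurry κyy)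
  cont_D : Continuous D
  der_x : ∀ x y, HasDerivAt (fun s => κ s y) (κx x y) x
  der_y : ∀ x y, HasDerivAt (fun s => κ x s) (κy x y) y
  der_xx : ∀ x y, HasDerivAt (fun s => κx s y) (κxx x y) x
  der_yy : ∀ x y, HasDerivAt (fun s => κy x s) (κyy x y) y
  der_diag : ∀ x, HasDerivAt (fun s => κ s s) (D x) x
  diag : ∀ x, D x = κx x x + κy x x
  wave : ∀ x y, κxx x y - κyy x y = m * κ x y

namespace WaveKernel

variable {κ κx κy κxx κyy : ℝ → ℝ → ℝ} {D : ℝ → ℝ} {m : ℝ} {f f₁ f₂ : ℝ → ℝ}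

/-- Two integrations by parts in y. The boundary term κ(x,0) f₁(0) disappears by the Neumann
condition at 0, while κ_y(x,0) f(0) survives; the kernel k uses it to absorb B u(0). -/
theorem volt_second (hk : WaveKernel κ κx κy κxx κyy D m) (hf : H2 f f₁ f₂) {x : ℝ}
    (hx : x ∈ Icc (0 : ℝ) 1) (h0 : f₁ 0 = 0) :
    volt κ f₂ x = κ x x * f₁ x - κy x x * f x + κy x 0 * f 0 + volt κyy f x := by
  have c1 := hk.cont_y
  have c2 := hk.cont_yy
  have p1 : Prim (fun y => κ x y) (fun y => κy x y) :=
    Prim.of_hasDerivAt (fun y => hk.der_y x y) (by fun_prop)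
  have p2 : Prim (fun y => κy x y) (fun y => κyy x y) :=
    Prim.of_hasDerivAt (fun y => hk.der_yy x y) (by fun_prop)
  have e1 := hf.prim₁.integral_mul p1 hx
  have e2 := hf.prim.integral_mul p2 hx
  have e3 : volt κ f₂ x = ∫ y in (0 : ℝ)..x, f₂ y * κ x y := by
    simp only [volt, mul_comm]
  have e4 : volt κyy f x = ∫ y in (0 : ℝ)..x, f y * κyy x y := by
    simp only [volt, mul_comm]
  rw [e3, e1, e2, h0, e4]; ring

/-- A Volterra operator with such a kernel commutes with `∂ₓ²` up to lower order terms. -/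
theorem h2_volt (hk : WaveKernel κ κx κy κxx κyy D m) (hf : H2 f f₁ f₂) (h0 : f₁ 0 = 0) :
    H2 (volt κ f) (fun x => κ x x * f x + volt κx f x)
      (fun x => volt κ f₂ x + 2 * D x * f x - κy x 0 * f 0 + m * volt κ f x) := by
  have hc := hf.prim.continuousOn
  have c1 := hk.cont_y
  have cD := hk.cont_D
  have p1 := Prim.volt hk.cont hk.cont_x hk.der_x hc
  have p2 := Prim.volt hk.cont_x hk.cont_xx hk.der_xx hc
  have p3 : Prim (fun x => κ x x) D := Prim.of_hasDerivAt hk.der_diag hk.cont_D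
  refine ⟨p1, ((p3.mul hf.prim).add p2).congr_deriv fun x hx => ?_, ?_⟩
  · have hx' := Ioo_subset_Icc_self hx
    rw [hk.volt_second hf hx' h0]
    -- The wave equation trades κ_xx for κ_yy, whose operator is supplied by `volt_second`.
    have e : volt κxx f x = volt κyy f x + m * volt κ f x := by
      rw [← volt_const_mul]
      simp only [volt]
      rw [← intervalIntegral.integral_add]
      · refine intervalIntegral.integral_congr fun y _ => ?_
        have := hk.wave x y
        have h : κxx x y = κyy x y + m * κ x y := by linarith
        simp only [h]; ring
      · exact volt_integrable hk.cont_yy (sq_of_continuousOn hc) hx'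
      · exact volt_integrable hk.cont ((sq_of_continuousOn hc).const_mul m) hx'
    rw [e, hk.diag x]; ring
  · refine sq_of_continuousOn ?_
    have a1 := continuousOn_volt hk.cont hf.sq
    have a2 := continuousOn_volt hk.cont (sq_of_continuousOn hc)
    have a3 : ContinuousOn (fun x => κy x 0) (Icc 0 1) :=
      (by fun_prop : Continuous fun x => κy x 0).continuousOn
    have a4 := cD.continuousOn (s := Icc (0 : ℝ) 1)
    fun_prop

end WaveKernel

namespace H2

variable {f f₁ f₂ g g₁ g₂ : ℝ → ℝ}

theorem sub (hf : H2 f f₁ f₂) (hg : H2 g g₁ g₂) :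
    H2 (fun x => f x - g x) (fun x => f₁ x - g₁ x) (fun x => f₂ x - g₂ x) :=
  ⟨hf.prim.sub hg.prim, hf.prim₁.sub hg.prim₁, hf.sq.sub hg.sq⟩

theorem sq_zero (hf : H2 f f₁ f₂) : Sq f := sq_of_continuousOn hf.prim.continuousOn

theorem sq_one (hf : H2 f f₁ f₂) : Sq f₁ := sq_of_continuousOn hf.prim₁.continuousOn

/-- The Neumann conditions on f kill both boundary terms, so g needs no boundary condition. This is
what lets the tangent of ‖z_x‖² be paired with z at other times, when the feedback may saturate. -/
theorem inner_second (hf : H2 f f₁ f₂) (hg : Prim g g₁) (hg₁ : Sq g₁) (h0 : f₁ 0 = 0) (h1 : f₁ 1 = 0) :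
    inner ℝ (toL2 f₂) (toL2 g) = - inner ℝ (toL2 f₁) (toL2 g₁) := by
  rw [inner_toL2 hf.sq (sq_of_continuousOn hg.continuousOn), inner_toL2 hf.sq_one hg₁,
    hf.prim₁.integral_mul hg (right_mem_Icc.2 zero_le_one), h0, h1]
  ring

end H2

/-! ### Inequalities on the unit interval -/

/-- Integrating ((x-1) f)' writes f(0) as ∫ (x-1) f' + ∫ f, and ‖x-1‖² = 1/3. -/
theorem Prim.zero_sq_le {f f' : ℝ → ℝ} (hf : Prim f f') (hs : Sq f') :
    f 0 ^ 2 ≤ 2 * ‖toL2 f‖ ^ 2 + ‖toL2 f'‖ ^ 2 := by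
  have p : Prim (fun x : ℝ => x - 1) (fun _ => 1) :=
    Prim.of_hasDerivAt (fun x => by simpa using (hasDerivAt_id x).sub_const 1) continuous_const
  have h := hf.integral_mul p (right_mem_Icc.2 zero_le_one)
  have e : f 0 = (∫ y in (0 : ℝ)..1, f' y * (y - 1)) + ∫ y in (0 : ℝ)..1, f y * 1 := by
    rw [h]; ring
  have s1 : Sq fun x : ℝ => x - 1 := sq_of_continuousOn (by fun_prop)
  have s2 : Sq fun _ : ℝ => (1 : ℝ) := sq_of_continuousOn (by fun_prop)
  have n1 : ‖toL2 fun x : ℝ => x - 1‖ ^ 2 = 1 / 3 := by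
    rw [norm_toL2_sq s1, intervalIntegral.integral_comp_sub_right (fun x => x ^ 2) 1, integral_pow]
    norm_num
  have n2 : ‖toL2 fun _ : ℝ => (1 : ℝ)‖ ≤ 1 := norm_toL2_le zero_le_one (by simp)
  have b1 := abs_integral_mul_le hs s1
  have b2 := (abs_integral_mul_le (sq_of_continuousOn hf.continuousOn) s2).trans
    (mul_le_of_le_one_right (norm_nonneg _) n2)
  have b1' := sq_le_sq' (abs_le.1 b1).1 (abs_le.1 b1).2
  have b2' := sq_le_sq' (abs_le.1 b2).1 (abs_le.1 b2).2
  rw [mul_pow, n1] at b1'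
  rw [e]
  -- (α+β)² = 3α² + (3/2)β² - (1/2)(2α-β)²; the weight 3 cancels the 1/3.
  nlinarith [sq_nonneg (2 * (∫ y in (0 : ℝ)..1, f' y * (y - 1)) - ∫ y in (0 : ℝ)..1, f y * 1)]

/-- Integrating (x f)' writes f(1) as ∫ x f' + ∫ f, and ‖x‖ = 1/√3. This factor provides the strict
margin in the bound for the feedback. -/
theorem Prim.abs_one_le {f f' : ℝ → ℝ} (hf : Prim f f') (hs : Sq f') :
    |f 1| ≤ ‖toL2 f‖ + ‖toL2 f'‖ / Real.sqrt 3 := by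
  have p : Prim (fun x : ℝ => x) (fun _ => 1) :=
    Prim.of_hasDerivAt (fun x => hasDerivAt_id x) continuous_const
  have h := hf.integral_mul p (right_mem_Icc.2 zero_le_one)
  have e : f 1 = (∫ y in (0 : ℝ)..1, f' y * y) + ∫ y in (0 : ℝ)..1, f y * 1 := by
    rw [h]; ring
  have s1 : Sq fun x : ℝ => x := sq_of_continuousOn (by fun_prop)
  have s2 : Sq fun _ : ℝ => (1 : ℝ) := sq_of_continuousOn (by fun_prop)
  have n1 : ‖toL2 fun x : ℝ => x‖ = 1 / Real.sqrt 3 := by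
    have : ‖toL2 fun x : ℝ => x‖ ^ 2 = 1 / 3 := by
      rw [norm_toL2_sq s1, integral_pow]; norm_num
    rw [← sq_eq_sq₀ (norm_nonneg _) (by positivity), this, div_pow, Real.sq_sqrt (by norm_num)]
    norm_num
  have n2 : ‖toL2 fun _ : ℝ => (1 : ℝ)‖ ≤ 1 := norm_toL2_le zero_le_one (by simp)
  have b1 := abs_integral_mul_le hs s1
  have b2 := abs_integral_mul_le (sq_of_continuousOn hf.continuousOn) s2
  rw [e]
  refine (abs_add_le _ _).trans ?_
  rw [n1, mul_one_div] at b1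
  nlinarith [norm_nonneg (toL2 f)]

/-- Wirtinger's inequality, with the constant for functions vanishing at one end point. -/
theorem Prim.wirtinger {g g' : ℝ → ℝ} (hg : Prim g g') (hs : Sq g') (h0 : g 0 = 0) (h1 : g 1 = 0) :
    Real.pi ^ 2 / 4 * ‖toL2 g‖ ^ 2 ≤ ‖toL2 g'‖ ^ 2 := by
  -- The function φ = ω tan(ω(x - 1/2)) solves the Riccati equation φ' = ω² + φ². With ω = π/2 its
  -- argument stays in [-π/4, π/4], so φ is smooth on [0,1]; ω = π would be singular at the ends.
  set ω : ℝ := Real.pi / 2 with hω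
  set φ : ℝ → ℝ := fun x => ω * Real.tan (ω * (x - 1 / 2)) with hφ
  have hcos : ∀ x ∈ Icc (0 : ℝ) 1, Real.cos (ω * (x - 1 / 2)) ≠ 0 := by
    intro x hx
    have hpi := Real.pi_pos
    refine (Real.cos_pos_of_mem_Ioo ⟨?_, ?_⟩).ne' <;> rw [hω] <;> nlinarith [hx.1, hx.2]
  have hd : ∀ x ∈ Icc (0 : ℝ) 1, HasDerivAt φ (ω ^ 2 + φ x ^ 2) x := by
    intro x hx
    have h1 : HasDerivAt (fun x : ℝ => ω * (x - 1 / 2)) ω x := by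
      simpa only [mul_one] using ((hasDerivAt_id' x).sub_const (1 / 2)).const_mul ω
    refine (((Real.hasDerivAt_tan (hcos x hx)).comp x h1).const_mul ω).congr_deriv ?_
    have hc := hcos x hx
    have hsc := Real.sin_sq_add_cos_sq (ω * (x - 1 / 2))
    simp only [hφ, Real.tan_eq_sin_div_cos]
    generalize Real.cos (ω * (x - 1 / 2)) = C at hc hsc
    generalize Real.sin (ω * (x - 1 / 2)) = S at hsc
    field_simp
    rw [add_comm, hsc, mul_one]
  have hφc : ContinuousOn φ (Icc 0 1) := fun x hx => (hd x hx).continuousAt.continuousWithinAt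
  have hp : Prim φ (fun x => ω ^ 2 + φ x ^ 2) :=
    Prim.of_hasDerivWithinAt (fun x hx => (hd x hx).hasDerivWithinAt) (by fun_prop)
  have hgc := hg.continuousOn
  have hm : Prim (fun x => g x * g x * φ x) _ := (hg.mul hg).mul hp
  have hz := hm.integral_eq (right_mem_Icc.2 zero_le_one)
  rw [h0, h1] at hz
  have s1 : Sq fun x => g' x + φ x * g x :=
    hs.add (sq_of_continuousOn (hφc.mul hgc))
  have hi := hm.intervalIntegrable
  have i1 : IntervalIntegrable (fun x => g' x ^ 2) volume 0 1 :=
    intervalIntegrable_iff_vol01.2 hs.integrable_sq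
  have i2 : IntervalIntegrable (fun x => ω ^ 2 * g x ^ 2) volume 0 1 :=
    intervalIntegrable_iff_vol01.2 ((sq_of_continuousOn hgc).integrable_sq.const_mul _)
  -- Completing the square: the cross term 2φgg' is (g²φ)' - g²φ', whose exact part integrates to 0
  -- because g vanishes at both ends.
  have key : ‖toL2 fun x => g' x + φ x * g x‖ ^ 2 = ‖toL2 g'‖ ^ 2 - ω ^ 2 * ‖toL2 g‖ ^ 2 := by
    rw [norm_toL2_sq s1, norm_toL2_sq hs, norm_toL2_sq (sq_of_continuousOn hgc),
      ← intervalIntegral.integral_const_mul, ← intervalIntegral.integral_sub i1 i2]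
    have h2 := intervalIntegral.integral_add (i1.sub i2) hi
    rw [hz] at h2
    refine Eq.trans ?_ (h2.trans (by ring))
    congr 1; ext x; ring
  have hpi : Real.pi ^ 2 / 4 = ω ^ 2 := by rw [hω]; ring
  rw [hpi]
  nlinarith [sq_nonneg ‖toL2 fun x => g' x + φ x * g x‖]

/-! ### The entire function `besselQuot` -/

/-- Termwise differentiation on a ball of radius |z| + 1 with the majorant of the exponential
series. The hypothesis |a m| ≤ 1/m! is inherited by the differentiated Bessel coefficients, so the
lemma can be iterated. -/
theorem hasDerivAt_powerSeries {a : ℕ → ℝ} (ha : ∀ m, |a m| ≤ 1 / (m.factorial : ℝ)) (z : ℝ) :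
    HasDerivAt (fun z => ∑' m, a m * z ^ m) (∑' m, ((m + 1 : ℕ) : ℝ) * a (m + 1) * z ^ m) z := by
  set R : ℝ := |z| + 1 with hR
  have hR0 : 0 ≤ R := by positivity
  have hsum : Summable fun m : ℕ => (m : ℝ) * (1 / (m.factorial : ℝ)) * R ^ (m - 1) := by
    rw [← summable_nat_add_iff 1]
    refine (Real.summable_pow_div_factorial R).congr fun m => ?_
    rw [Nat.factorial_succ, Nat.add_sub_cancel]
    push_cast
    have h1 : (m.factorial : ℝ) ≠ 0 := by positivity
    have h2 : (m : ℝ) + 1 ≠ 0 := by positivity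
    field_simp
  have H := hasDerivAt_tsum_of_isPreconnected (𝕜 := ℝ) (F := ℝ)
    (g := fun m z => a m * z ^ m) (g' := fun m z => a m * (m * z ^ (m - 1)))
    (t := Metric.ball 0 R) (y₀ := 0) (y := z) hsum Metric.isOpen_ball
    (convex_ball _ _).isPreconnected
    (fun m y _ => (hasDerivAt_pow m y).const_mul _) ?_ (Metric.mem_ball_self (by positivity)) ?_ ?_
  · refine H.congr_deriv ?_
    have hs : Summable fun m : ℕ => a m * (m * z ^ (m - 1)) := by
      refine Summable.of_norm_bounded hsum fun m => ?_
      rw [norm_mul, norm_mul, norm_pow, Real.norm_natCast, mul_left_comm, ← mul_assoc]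
      have : ‖z‖ ^ (m - 1) ≤ R ^ (m - 1) := pow_le_pow_left₀ (norm_nonneg _) (by simp [hR]) _
      have := ha m
      gcongr
      exact this
    rw [hs.tsum_eq_zero_add]
    simp only [Nat.cast_zero, zero_mul, mul_zero, zero_add, Nat.add_sub_cancel]
    refine tsum_congr fun m => by ring
  · intro m y hy
    rw [Metric.mem_ball, dist_zero_right] at hy
    rw [norm_mul, norm_mul, norm_pow, Real.norm_natCast, mul_left_comm, ← mul_assoc]
    have : ‖y‖ ^ (m - 1) ≤ R ^ (m - 1) := pow_le_pow_left₀ (norm_nonneg _) hy.le _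
    have := ha m
    gcongr
    exact this
  · refine summable_of_ne_finset_zero (s := {0}) fun m hm => ?_
    simp only [Finset.mem_singleton] at hm
    simp [hm]
  · simp [hR]

theorem summable_powerSeries {a : ℕ → ℝ} (ha : ∀ m, |a m| ≤ 1 / (m.factorial : ℝ)) (z : ℝ) :
    Summable fun m => a m * z ^ m := by
  refine Summable.of_norm_bounded (Real.summable_pow_div_factorial |z|) fun m => ?_
  rw [norm_mul, norm_pow, Real.norm_eq_abs, Real.norm_eq_abs, div_eq_mul_one_div, mul_comm]
  exact mul_le_mul_of_nonneg_left (ha m) (by positivity)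

/-- The Taylor coefficients of `besselQuot`. -/
def besselCoef (m : ℕ) : ℝ := (1 / 4) ^ m / (2 * ((m.factorial : ℝ) * ((m + 1).factorial : ℝ)))

/-- This recurrence is Bessel's equation, read on Taylor coefficients. -/
theorem besselCoef_succ (m : ℕ) :
    ((m + 1 : ℕ) : ℝ) * ((m + 2 : ℕ) : ℝ) * besselCoef (m + 1) = besselCoef m / 4 := by
  unfold besselCoef
  rw [Nat.factorial_succ (m + 1), Nat.factorial_succ m, pow_succ]
  push_cast
  have h1 : (m.factorial : ℝ) ≠ 0 := by positivity
  have h2 : (m : ℝ) + 1 ≠ 0 := by positivity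
  have h3 : (m : ℝ) + 1 + 1 ≠ 0 := by positivity
  field_simp
  ring

theorem besselCoef_nonneg (m : ℕ) : 0 ≤ besselCoef m := by unfold besselCoef; positivity

theorem abs_besselCoef_le (m : ℕ) : |besselCoef m| ≤ 1 / (m.factorial : ℝ) := by
  rw [abs_of_nonneg (besselCoef_nonneg m)]
  unfold besselCoef
  have h1 : (1 : ℝ) ≤ ((m + 1).factorial : ℝ) := by exact_mod_cast Nat.factorial_pos _
  have h2 : (0 : ℝ) < (m.factorial : ℝ) := by positivity
  have h3 : (1 / 4 : ℝ) ^ m ≤ 1 := pow_le_one₀ (by norm_num) (by norm_num)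
  refine div_le_div₀ zero_le_one h3 h2 ?_
  nlinarith

/-- The derivative of `besselQuot`. -/
def besselQuot₁ (z : ℝ) : ℝ := ∑' m : ℕ, ((m + 1 : ℕ) : ℝ) * besselCoef (m + 1) * z ^ m

/-- The second derivative of `besselQuot`. -/
def besselQuot₂ (z : ℝ) : ℝ :=
  ∑' m : ℕ, ((m + 1 : ℕ) : ℝ) * (((m + 1 + 1 : ℕ) : ℝ) * besselCoef (m + 1 + 1)) * z ^ m

theorem abs_besselCoef₁_le (m : ℕ) :
    |((m + 1 : ℕ) : ℝ) * besselCoef (m + 1)| ≤ 1 / (m.factorial : ℝ) := by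
  have h := abs_besselCoef_le m
  have h0 := besselCoef_nonneg m
  have h1 := besselCoef_nonneg (m + 1)
  rw [abs_of_nonneg h0] at h
  rw [abs_of_nonneg (by positivity)]
  have h2 := besselCoef_succ m
  push_cast at h2 ⊢
  nlinarith [mul_nonneg (mul_nonneg (by positivity : (0 : ℝ) ≤ (m : ℝ) + 1) (by positivity : (0 : ℝ) ≤ (m : ℝ) + 1)) h1]

theorem abs_besselCoef₂_le (m : ℕ) :
    |((m + 1 : ℕ) : ℝ) * (((m + 1 + 1 : ℕ) : ℝ) * besselCoef (m + 1 + 1))| ≤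
      1 / (m.factorial : ℝ) := by
  have h := abs_besselCoef₁_le m
  have h0 := besselCoef_nonneg (m + 1)
  have h1 := besselCoef_nonneg (m + 1 + 1)
  rw [abs_of_nonneg (by positivity)] at h ⊢
  have h2 := besselCoef_succ (m + 1)
  refine le_trans ?_ h
  refine mul_le_mul_of_nonneg_left ?_ (by positivity)
  push_cast at h2 ⊢
  nlinarith [mul_nonneg (mul_nonneg (by positivity : (0 : ℝ) ≤ (m : ℝ) + 1 + 1) (by positivity : (0 : ℝ) ≤ (m : ℝ) + 1)) h1]

theorem besselQuot_eq (z : ℝ) : besselQuot z = ∑' m, besselCoef m * z ^ m := by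
  unfold besselQuot besselCoef
  refine tsum_congr fun m => ?_
  rw [div_pow, one_div_pow]; ring

theorem hasDerivAt_besselQuot (z : ℝ) : HasDerivAt besselQuot (besselQuot₁ z) z := by
  rw [show besselQuot = fun z => ∑' m, besselCoef m * z ^ m from funext besselQuot_eq]
  exact hasDerivAt_powerSeries abs_besselCoef_le z

theorem hasDerivAt_besselQuot₁ (z : ℝ) : HasDerivAt besselQuot₁ (besselQuot₂ z) z :=
  hasDerivAt_powerSeries abs_besselCoef₁_le z

theorem continuous_besselQuot : Continuous besselQuot :=
  continuous_iff_continuousAt.2 fun z => (hasDerivAt_besselQuot z).continuousAt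

theorem continuous_besselQuot₁ : Continuous besselQuot₁ :=
  continuous_iff_continuousAt.2 fun z => (hasDerivAt_besselQuot₁ z).continuousAt

theorem continuous_besselQuot₂ : Continuous besselQuot₂ :=
  continuous_iff_continuousAt.2 fun z =>
    (hasDerivAt_powerSeries abs_besselCoef₂_le z).continuousAt

theorem besselQuot_zero : besselQuot 0 = 1 / 2 := by
  rw [besselQuot_eq, tsum_eq_single 0 fun m hm => by simp [hm]]
  simp [besselCoef]

/-- Comparison of coefficients through `besselCoef_succ`. This is Bessel's equation in the variable
s², and it makes `bKer` a wave kernel. -/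
theorem besselQuot_ode (z : ℝ) : z * besselQuot₂ z + 2 * besselQuot₁ z = besselQuot z / 4 := by
  have s0 := summable_powerSeries abs_besselCoef_le z
  have s1 := summable_powerSeries abs_besselCoef₁_le z
  have s2 := summable_powerSeries abs_besselCoef₂_le z
  have e1 := s1.tsum_eq_zero_add
  have e0 := s0.tsum_eq_zero_add
  have t1 := (summable_nat_add_iff 1).2 s1
  rw [besselQuot_eq, e0, besselQuot₁, e1, besselQuot₂, ← tsum_mul_left, mul_add, ← tsum_mul_left,
    add_left_comm, ← (s2.mul_left z).tsum_add (t1.mul_left 2), add_div, ← tsum_div_const]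
  have h0 := besselCoef_succ 0
  congr 1
  · push_cast at h0 ⊢; norm_num at h0 ⊢; linarith
  · refine tsum_congr fun m => ?_
    have h := besselCoef_succ (m + 1)
    push_cast at h ⊢
    rw [mul_div_right_comm, ← h]
    ring

/-! ### The kernels `q` and `l` -/

/-- The kernel `-μ x b(μ (x² - y²))` with `b = besselQuot`. -/
def bKer (μ x y : ℝ) : ℝ := -μ * x * besselQuot (μ * (x ^ 2 - y ^ 2))

/-- The derivative of `bKer` in `x`. -/
def bKer₁ (μ x y : ℝ) : ℝ :=
  -μ * besselQuot (μ * (x ^ 2 - y ^ 2)) - 2 * μ ^ 2 * x ^ 2 * besselQuot₁ (μ * (x ^ 2 - y ^ 2))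

theorem qKer_eq_bKer (a c : ℝ) : qKer a c = bKer (a + c) := rfl

/-- Passing from I₁ to J₁ is the change of sign of μ = a + c. Hence w = z + ∫l z is the
transformation `bTrans` with parameter -μ. -/
theorem lKer_eq_bKer (a c : ℝ) : lKer a c = fun x y => -bKer (-(a + c)) x y := by
  ext x y
  rw [lKer, bKer, neg_mul (a + c) (x ^ 2 - y ^ 2)]; ring

theorem hasDerivAt_quad_x (μ x y : ℝ) :
    HasDerivAt (fun s => μ * (s ^ 2 - y ^ 2)) (μ * (2 * x)) x := by
  simpa using ((hasDerivAt_pow 2 x).sub_const (y ^ 2)).const_mul μ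

theorem hasDerivAt_quad_y (μ x y : ℝ) :
    HasDerivAt (fun s => μ * (x ^ 2 - s ^ 2)) (-(μ * (2 * y))) y := by
  simpa using ((hasDerivAt_pow 2 y).const_sub (x ^ 2)).const_mul μ

theorem hasDerivAt_bKer (μ x y : ℝ) : HasDerivAt (fun s => bKer μ s y) (bKer₁ μ x y) x := by
  have h1 := (hasDerivAt_besselQuot (μ * (x ^ 2 - y ^ 2))).comp x (hasDerivAt_quad_x μ x y)
  refine (((hasDerivAt_id' x).const_mul (-μ)).mul h1).congr_deriv ?_
  simp only [Function.comp, bKer₁]; ring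

theorem bKer_diag (μ x : ℝ) : bKer μ x x = -μ * x / 2 := by
  rw [bKer, sub_self, mul_zero, besselQuot_zero]; ring

theorem waveKernel_bKer (μ : ℝ) :
    WaveKernel (bKer μ) (bKer₁ μ)
      (fun x y => 2 * μ ^ 2 * x * y * besselQuot₁ (μ * (x ^ 2 - y ^ 2)))
      (fun x y => -6 * μ ^ 2 * x * besselQuot₁ (μ * (x ^ 2 - y ^ 2))
        - 4 * μ ^ 3 * x ^ 3 * besselQuot₂ (μ * (x ^ 2 - y ^ 2)))
      (fun x y => 2 * μ ^ 2 * x * besselQuot₁ (μ * (x ^ 2 - y ^ 2))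
        - 4 * μ ^ 3 * x * y ^ 2 * besselQuot₂ (μ * (x ^ 2 - y ^ 2)))
      (fun _ => -μ / 2) μ where
  cont := by
    have := continuous_besselQuot
    simp only [Function.uncurry_def, bKer]; fun_prop
  cont_x := by
    have := continuous_besselQuot
    have := continuous_besselQuot₁
    simp only [Function.uncurry_def, bKer₁]; fun_prop
  cont_y := by
    have := continuous_besselQuot₁
    simp only [Function.uncurry_def]; fun_prop
  cont_xx := by
    have := continuous_besselQuot₂
    have := continuous_besselQuot₁
    simp only [Function.uncurry_def]; fun_prop
  cont_yy := by
    have := continuous_besselQuot₂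
    have := continuous_besselQuot₁
    simp only [Function.uncurry_def]; fun_prop
  cont_D := continuous_const
  der_x := hasDerivAt_bKer μ
  der_y x y := by
    have h1 := (hasDerivAt_besselQuot (μ * (x ^ 2 - y ^ 2))).comp y (hasDerivAt_quad_y μ x y)
    refine (h1.const_mul (-μ * x)).congr_deriv ?_
    ring
  der_xx x y := by
    have h1 := (hasDerivAt_besselQuot (μ * (x ^ 2 - y ^ 2))).comp x (hasDerivAt_quad_x μ x y)
    have h2 := (hasDerivAt_besselQuot₁ (μ * (x ^ 2 - y ^ 2))).comp x (hasDerivAt_quad_x μ x y)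
    refine ((h1.const_mul (-μ)).sub (((hasDerivAt_pow 2 x).const_mul (2 * μ ^ 2)).mul h2)).congr_deriv ?_
    simp only [Function.comp]; push_cast; ring
  der_yy x y := by
    have h2 := (hasDerivAt_besselQuot₁ (μ * (x ^ 2 - y ^ 2))).comp y (hasDerivAt_quad_y μ x y)
    refine (((hasDerivAt_id' y).const_mul (2 * μ ^ 2 * x)).mul h2).congr_deriv ?_
    simp only [Function.comp]; ring
  der_diag x := by
    simp only [bKer_diag]
    exact (((hasDerivAt_id' x).const_mul (-μ)).div_const 2).congr_deriv (by ring)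
  diag x := by
    simp only [bKer₁, sub_self, mul_zero, besselQuot_zero]; ring
  wave x y := by
    -- With ζ = μ(x² - y²), κ_xx - κ_yy collapses to -4μ²x(ζ b''(ζ) + 2b'(ζ)).
    have h := besselQuot_ode (μ * (x ^ 2 - y ^ 2))
    simp only [bKer]
    linear_combination (-4 * μ ^ 2 * x) * h

/-- `f ↦ f - ∫₀ˣ κ_μ(x,y) f(y) dy` intertwines `∂ₓ² + μ` and `∂ₓ²`. -/
theorem H2.sub_volt_bKer {f f₁ f₂ : ℝ → ℝ} (hf : H2 f f₁ f₂) (h0 : f₁ 0 = 0) (μ : ℝ) :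
    H2 (fun x => f x - volt (bKer μ) f x)
      (fun x => f₁ x - (bKer μ x x * f x + volt (bKer₁ μ) f x))
      (fun x => (f₂ x - volt (bKer μ) f₂ x) + μ * (f x - volt (bKer μ) f x)) := by
  have h := hf.sub ((waveKernel_bKer μ).h2_volt hf h0)
  have e : (fun x => (f₂ x - volt (bKer μ) f₂ x) + μ * (f x - volt (bKer μ) f x)) =
      fun x => f₂ x - (volt (bKer μ) f₂ x + 2 * (-μ / 2) * f x
        - 2 * μ ^ 2 * x * 0 * besselQuot₁ (μ * (x ^ 2 - 0 ^ 2)) * f 0 + μ * volt (bKer μ) f x) := by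
    ext x; ring
  rw [e]; exact h

/-! ### The inverse of the transformation with kernel `q` -/

/-- `f ↦ f - ∫₀ˣ κ_μ(x,y) f(y) dy`. -/
def bTrans (μ : ℝ) (f : ℝ → ℝ) (x : ℝ) : ℝ := f x - volt (bKer μ) f x

section bTrans

variable {μ : ℝ} {f g : ℝ → ℝ} {x : ℝ}

theorem continuous_bKer (μ : ℝ) : Continuous (Function.uncurry (bKer μ)) := (waveKernel_bKer μ).cont

theorem continuous_bKer₁ (μ : ℝ) : Continuous (Function.uncurry (bKer₁ μ)) :=
  (waveKernel_bKer μ).cont_x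

theorem continuousOn_bTrans (hf : ContinuousOn f (Icc 0 1)) : ContinuousOn (bTrans μ f) (Icc 0 1) :=
  hf.sub (continuousOn_volt (continuous_bKer μ) (sq_of_continuousOn hf))

theorem bTrans_congr (h : EqOn f g (Icc 0 1)) (hx : x ∈ Icc (0 : ℝ) 1) :
    bTrans μ f x = bTrans μ g x := by
  rw [bTrans, bTrans, h hx, volt_congr (fun y hy => h (Ioo_subset_Icc_self hy)) hx]

theorem bTrans_add (hf : Sq f) (hg : Sq g) (hx : x ∈ Icc (0 : ℝ) 1) :
    bTrans μ (fun y => f y + g y) x = bTrans μ f x + bTrans μ g x := by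
  rw [bTrans, bTrans, bTrans, volt_add (continuous_bKer μ) hf hg hx]; ring

theorem bTrans_sub (hf : Sq f) (hg : Sq g) (hx : x ∈ Icc (0 : ℝ) 1) :
    bTrans μ (fun y => f y - g y) x = bTrans μ f x - bTrans μ g x := by
  rw [bTrans, bTrans, bTrans, volt_sub (continuous_bKer μ) hf hg hx]; ring

theorem bTrans_const_mul (c : ℝ) : bTrans μ (fun y => c * f y) x = c * bTrans μ f x := by
  rw [bTrans, bTrans, volt_const_mul]; ring

theorem sq_bTrans (hf : Sq f) : Sq (bTrans μ f) := hf.sub (sq_volt (continuous_bKer μ) hf)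

theorem exists_abs_le_of_continuous {κ : ℝ → ℝ → ℝ} (hκ : Continuous (Function.uncurry κ)) :
    ∃ M, 0 ≤ M ∧ ∀ x ∈ Icc (0 : ℝ) 1, ∀ y ∈ Icc (0 : ℝ) 1, |κ x y| ≤ M := by
  obtain ⟨C, hC⟩ := (isCompact_Icc (a := (0 : ℝ)) (b := 1)).prod
    (isCompact_Icc (a := (0 : ℝ)) (b := 1)) |>.exists_bound_of_continuousOn hκ.continuousOn
  refine ⟨max C 0, le_max_right _ _, fun x hx y hy => (hC (x, y) ⟨hx, hy⟩).trans (le_max_left _ _)⟩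

theorem exists_abs_bTrans_le (μ : ℝ) : ∃ M, 0 ≤ M ∧ ∀ f : ℝ → ℝ, ContinuousOn f (Icc 0 1) →
    ∀ ε, 0 ≤ ε → (∀ x ∈ Icc (0 : ℝ) 1, |f x| ≤ ε) → ∀ x ∈ Icc (0 : ℝ) 1, |bTrans μ f x| ≤ M * ε := by
  obtain ⟨M, hM, h⟩ := exists_abs_le_of_continuous (continuous_bKer μ)
  refine ⟨1 + M, by positivity, fun f hf ε hε hfε x hx => ?_⟩
  have h1 := abs_volt_le (κ := bKer μ) (sq_of_continuousOn hf) hM hx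
    fun y hy => h x hx y ⟨hy.1, hy.2.trans hx.2⟩
  have h2 : ‖toL2 f‖ ≤ ε := norm_toL2_le hε fun x hx => hfε x (Ioo_subset_Icc_self hx)
  have h3 := hfε x hx
  calc |bTrans μ f x| ≤ |f x| + |volt (bKer μ) f x| := abs_sub _ _
    _ ≤ ε + M * ε := add_le_add h3 (h1.trans (by gcongr))
    _ = _ := by ring

/-- The transformation with parameter μ turns ∂² + μ into ∂², and that with -μ turns ∂² - μ into ∂².
The shifts cancel, so the composite R satisfies (Rf)'' = R(f''). Since Rf and f have the same value
and the zero slope at 0, R f'' = f'' forces Rf = f. -/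
theorem bTrans_bTrans_of_second {f₁ f₂ : ℝ → ℝ} (hf : H2 f f₁ f₂) (h0 : f₁ 0 = 0)
    (h : EqOn (bTrans (-μ) (bTrans μ f₂)) f₂ (Icc 0 1)) :
    EqOn (bTrans (-μ) (bTrans μ f)) f (Icc 0 1) := by
  have hg := hf.sub_volt_bKer h0 μ
  have hz : ∀ μ, bKer μ 0 0 = 0 := fun μ => by rw [bKer_diag]; ring
  have hr := hg.sub_volt_bKer (by simp only [h0, hz, volt_zero_right]; ring) (-μ)
  have hr2 := hr.prim₁.congr_deriv (g' := f₂) fun x hx => by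
    have hx' := Ioo_subset_Icc_self hx
    refine Eq.trans ?_ (h hx')
    have e := volt_add (continuous_bKer (-μ)) (sq_bTrans (μ := μ) hf.sq)
      ((sq_bTrans (μ := μ) hf.sq_zero).const_mul μ) hx'
    simp only [volt_const_mul] at e
    have u : ∀ ν g, bTrans ν g = fun x => g x - volt (bKer ν) g x := fun _ _ => rfl
    simp only [u] at e ⊢
    rw [e]; ring
  have e1 := hr2.eq_of_eq hf.prim₁ (by simp only [h0, hz, volt_zero_right]; ring)
  exact (hr.prim.congr_deriv fun x hx => e1 (Ioo_subset_Icc_self hx)).eq_of_eq hf.prim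
    (by simp only [volt_zero_right]; ring)

/-- Induction on k: an even power has zero slope at 0, and the second derivative of x^{2k+2} is a
multiple of x^{2k}. The base case is the constant, with second derivative 0. -/
theorem bTrans_bTrans_monomial (μ : ℝ) (k : ℕ) :
    EqOn (bTrans (-μ) (bTrans μ fun x => x ^ (2 * k))) (fun x => x ^ (2 * k)) (Icc 0 1) := by
  have hzero : ∀ x, bTrans (-μ) (bTrans μ fun _ => 0) x = 0 := by
    intro x; simp [bTrans, volt]
  induction k with
  | zero =>
    have hp : H2 (fun x : ℝ => x ^ (2 * 0)) (fun _ => 0) (fun _ => 0) :=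
      ⟨Prim.of_hasDerivAt (fun x => by simpa using hasDerivAt_const x (1 : ℝ)) continuous_const,
        Prim.of_hasDerivAt (fun x => hasDerivAt_const x (0 : ℝ)) continuous_const,
        sq_of_continuousOn continuousOn_const⟩
    exact bTrans_bTrans_of_second hp rfl fun x _ => hzero x
  | succ k ih =>
    have hp : H2 (fun x : ℝ => x ^ (2 * (k + 1))) (fun x => (2 * k + 2) * x ^ (2 * k + 1))
        (fun x => (2 * k + 2) * (2 * k + 1) * x ^ (2 * k)) := by
      refine ⟨Prim.of_hasDerivAt (fun x => ?_) (by fun_prop),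
        Prim.of_hasDerivAt (fun x => ?_) (by fun_prop), sq_of_continuousOn (by fun_prop)⟩
      · exact (hasDerivAt_pow (2 * (k + 1)) x).congr_deriv (by push_cast; congr 1; ring)
      · refine ((hasDerivAt_pow (2 * k + 1) x).const_mul _).congr_deriv ?_
        push_cast; ring
    refine bTrans_bTrans_of_second hp (by simp) fun x hx => ?_
    have e : bTrans μ (fun x => (2 * k + 2) * (2 * k + 1) * x ^ (2 * k)) =
        fun x => (2 * k + 2) * (2 * k + 1) * bTrans μ (fun x => x ^ (2 * k)) x :=
      funext fun x => bTrans_const_mul _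
    rw [e, bTrans_const_mul, ih hx]

theorem bTrans_bTrans_polynomial (μ : ℝ) (p : Polynomial ℝ) :
    EqOn (bTrans (-μ) (bTrans μ fun x => p.eval (x ^ 2))) (fun x => p.eval (x ^ 2)) (Icc 0 1) := by
  induction p using Polynomial.induction_on' with
  | add p q hp hq =>
    intro x hx
    have cp : ContinuousOn (fun x : ℝ => p.eval (x ^ 2)) (Icc 0 1) := by fun_prop
    have cq : ContinuousOn (fun x : ℝ => q.eval (x ^ 2)) (Icc 0 1) := by fun_prop
    simp only [Polynomial.eval_add]
    rw [bTrans_congr (fun y hy => bTrans_add (sq_of_continuousOn cp) (sq_of_continuousOn cq) hy) hx,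
      bTrans_add (sq_bTrans (sq_of_continuousOn cp)) (sq_bTrans (sq_of_continuousOn cq)) hx,
      hp hx, hq hx]
  | monomial k c =>
    intro x hx
    simp only [Polynomial.eval_monomial, ← pow_mul]
    have e : bTrans μ (fun x => c * x ^ (2 * k)) = fun x => c * bTrans μ (fun x => x ^ (2 * k)) x :=
      funext fun x => bTrans_const_mul _
    rw [e, bTrans_const_mul, bTrans_bTrans_monomial μ k hx]

/-- The transformations with parameters `μ` and `-μ` are inverse to each other. -/
theorem bTrans_bTrans (hf : ContinuousOn f (Icc 0 1)) :
    EqOn (bTrans (-μ) (bTrans μ f)) f (Icc 0 1) := by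
  intro x hx
  obtain ⟨M₁, hM₁, h₁⟩ := exists_abs_bTrans_le μ
  obtain ⟨M₂, hM₂, h₂⟩ := exists_abs_bTrans_le (-μ)
  -- Weierstrass approximation of s ↦ f(√s) by p(s) yields approximation of f by the even polynomial
  -- p(x²). The Neumann condition at 0 is thus no obstacle to density.
  have hfs : ContinuousOn (fun s => f (Real.sqrt s)) (Icc 0 1) := by
    refine hf.comp Real.continuous_sqrt.continuousOn fun s hs => ⟨Real.sqrt_nonneg s, ?_⟩
    exact Real.sqrt_le_one.2 hs.2
  refine eq_of_forall_dist_le fun ε hε => ?_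
  set δ := ε / (M₂ * M₁ + 1) with hδ
  have hδ0 : 0 < δ := by positivity
  obtain ⟨p, hp⟩ := exists_polynomial_near_of_continuousOn 0 1 _ hfs δ hδ0
  have cp : ContinuousOn (fun x : ℝ => p.eval (x ^ 2)) (Icc 0 1) := by fun_prop
  have hb : ∀ y ∈ Icc (0 : ℝ) 1, |f y - p.eval (y ^ 2)| ≤ δ := by
    intro y hy
    have := hp (y ^ 2) ⟨by positivity, pow_le_one₀ hy.1 hy.2⟩
    rw [Real.sqrt_sq hy.1] at this
    rw [abs_sub_comm]; exact this.le
  have sf := sq_of_continuousOn hf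
  have sp := sq_of_continuousOn cp
  have e1 : bTrans (-μ) (bTrans μ f) x - p.eval (x ^ 2) =
      bTrans (-μ) (bTrans μ fun y => f y - p.eval (y ^ 2)) x := by
    rw [bTrans_congr (fun y hy => bTrans_sub sf sp hy) hx,
      bTrans_sub (sq_bTrans sf) (sq_bTrans sp) hx]
    congr 1
    exact (bTrans_bTrans_polynomial μ p hx).symm
  have e2 := h₂ _ (continuousOn_bTrans (hf.sub cp)) _ (by positivity) (h₁ _ (hf.sub cp) δ hδ0.le hb) x hx
  have e3 := hb x hx
  have e4 : M₂ * (M₁ * δ) + δ = ε := by rw [hδ]; field_simp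
  rw [Real.dist_eq]
  calc |bTrans (-μ) (bTrans μ f) x - f x|
      = |(bTrans (-μ) (bTrans μ fun y => f y - p.eval (y ^ 2)) x) - (f x - p.eval (x ^ 2))| := by
        rw [← e1]; congr 1; ring
    _ ≤ _ := abs_sub _ _
    _ ≤ M₂ * (M₁ * δ) + δ := add_le_add e2 e3
    _ = ε := e4

end bTrans

/-! ### Row kernels -/

section rowKernel

variable {n : ℕ}

/-- A square matrix acting on Euclidean space. -/
abbrev mv (D : Matrix (Fin n) (Fin n) ℝ) : EuclideanSpace ℝ (Fin n) →L[ℝ] EuclideanSpace ℝ (Fin n) :=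
  Matrix.toEuclideanCLM (n := Fin n) (𝕜 := ℝ) D

theorem inner_eq_dotProduct (v w : EuclideanSpace ℝ (Fin n)) :
    inner ℝ v w = v.ofLp ⬝ᵥ w.ofLp := by
  simp [PiLp.inner_apply, dotProduct, mul_comm]

theorem ofLp_mv (D : Matrix (Fin n) (Fin n) ℝ) (v : EuclideanSpace ℝ (Fin n)) :
    (mv D v).ofLp = D.mulVec v.ofLp := by
  exact Matrix.ofLp_toEuclideanCLM D v

theorem inner_mv_transpose (D : Matrix (Fin n) (Fin n) ℝ) (v w : EuclideanSpace ℝ (Fin n)) :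
    inner ℝ (mv D.transpose v) w = inner ℝ v (mv D w) := by
  rw [inner_eq_dotProduct, inner_eq_dotProduct, ofLp_mv, ofLp_mv, Matrix.mulVec_transpose,
    Matrix.dotProduct_mulVec]

/-- The row of a `1 × n` matrix as a vector. -/
def rowVec (K : Matrix (Fin 1) (Fin n) ℝ) : EuclideanSpace ℝ (Fin n) := WithLp.toLp 2 fun j => K 0 j

/-- The block matrix `[[0, D], [I, 0]]`. -/
def blockN (D : Matrix (Fin n) (Fin n) ℝ) : Matrix (Fin n ⊕ Fin n) (Fin n ⊕ Fin n) ℝ :=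
  Matrix.fromBlocks 0 D 1 0

/-- `M ↦ [K 0] M [I; 0]`. -/
def sandwich (K : Matrix (Fin 1) (Fin n) ℝ) :
    Matrix (Fin n ⊕ Fin n) (Fin n ⊕ Fin n) ℝ →ₗ[ℝ] EuclideanSpace ℝ (Fin n) where
  toFun M := WithLp.toLp 2 fun j => ((Matrix.fromCols K (0 : Matrix (Fin 1) (Fin n) ℝ) * M
    * Matrix.fromRows (1 : Matrix (Fin n) (Fin n) ℝ) (0 : Matrix (Fin n) (Fin n) ℝ)) :
        Matrix (Fin 1) (Fin n) ℝ) 0 j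
  map_add' M N := by
    ext j; simp [Matrix.mul_add, Matrix.add_mul]
  map_smul' c M := by
    ext j; simp

theorem rowKernel_eq (D : Matrix (Fin n) (Fin n) ℝ) (K : Matrix (Fin 1) (Fin n) ℝ) (x : ℝ) :
    rowKernel D K x = sandwich K (NormedSpace.exp (x • blockN D)) := rfl

/-- The derivative of `rowKernel`. -/
def rowKernel₁ (D : Matrix (Fin n) (Fin n) ℝ) (K : Matrix (Fin 1) (Fin n) ℝ) (x : ℝ) :
    EuclideanSpace ℝ (Fin n) :=
  sandwich K (NormedSpace.exp (x • blockN D) * blockN D)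

/-- For N = [[0, D], [I, 0]] one has N²[I; 0] = [I; 0]D, so row kernels satisfy γ'' = γD. The
transpose appears because rows are stored as vectors. -/
theorem sandwich_mul_block_sq (D : Matrix (Fin n) (Fin n) ℝ) (K : Matrix (Fin 1) (Fin n) ℝ)
    (M : Matrix (Fin n ⊕ Fin n) (Fin n ⊕ Fin n) ℝ) :
    sandwich K (M * blockN D * blockN D) = mv D.transpose (sandwich K M) := by
  have h : blockN D * blockN D *
      Matrix.fromRows (1 : Matrix (Fin n) (Fin n) ℝ) (0 : Matrix (Fin n) (Fin n) ℝ) =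
      Matrix.fromRows (1 : Matrix (Fin n) (Fin n) ℝ) (0 : Matrix (Fin n) (Fin n) ℝ) * D := by
    simp [blockN, Matrix.fromBlocks_multiply, Matrix.fromBlocks_mul_fromRows, Matrix.fromRows_mul]
  apply WithLp.ofLp_injective
  rw [ofLp_mv, Matrix.mulVec_transpose]
  ext j
  simp only [sandwich, LinearMap.coe_mk, AddHom.coe_mk]
  rw [Matrix.mul_assoc M, ← Matrix.mul_assoc, Matrix.mul_assoc _ (blockN D * blockN D), h,
    ← Matrix.mul_assoc]
  rw [Matrix.mul_apply]
  rfl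

theorem rowKernel_zero (D : Matrix (Fin n) (Fin n) ℝ) (K : Matrix (Fin 1) (Fin n) ℝ) :
    rowKernel D K 0 = rowVec K := by
  rw [rowKernel_eq, zero_smul, NormedSpace.exp_zero]
  simp [sandwich, rowVec, Matrix.fromCols_mul_fromRows]

theorem rowKernel₁_zero (D : Matrix (Fin n) (Fin n) ℝ) (K : Matrix (Fin 1) (Fin n) ℝ) :
    rowKernel₁ D K 0 = 0 := by
  rw [rowKernel₁, zero_smul, NormedSpace.exp_zero, one_mul]
  ext j
  simp [sandwich, blockN, Matrix.mul_assoc, Matrix.fromBlocks_mul_fromRows, Matrix.fromCols_mul_fromRows]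

open scoped Matrix.Norms.Operator in
theorem hasDerivAt_sandwich_exp (D : Matrix (Fin n) (Fin n) ℝ) (K : Matrix (Fin 1) (Fin n) ℝ)
    (M : Matrix (Fin n ⊕ Fin n) (Fin n ⊕ Fin n) ℝ) (x : ℝ) :
    HasDerivAt (fun x : ℝ => sandwich K (NormedSpace.exp (x • blockN D) * M))
      (sandwich K (NormedSpace.exp (x • blockN D) * blockN D * M)) x := by
  have h := (hasDerivAt_exp_smul_const (𝕂 := ℝ) (blockN D) x).mul_const M
  exact (LinearMap.toContinuousLinearMap (sandwich K)).hasFDerivAt.comp_hasDerivAt x h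

theorem hasDerivAt_rowKernel (D : Matrix (Fin n) (Fin n) ℝ) (K : Matrix (Fin 1) (Fin n) ℝ) (x : ℝ) :
    HasDerivAt (rowKernel D K) (rowKernel₁ D K x) x := by
  have h := hasDerivAt_sandwich_exp D K 1 x
  simp only [mul_one] at h
  exact h

theorem hasDerivAt_rowKernel₁ (D : Matrix (Fin n) (Fin n) ℝ) (K : Matrix (Fin 1) (Fin n) ℝ) (x : ℝ) :
    HasDerivAt (rowKernel₁ D K) (mv D.transpose (rowKernel D K x)) x := by
  have h := hasDerivAt_sandwich_exp D K (blockN D) x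
  rw [sandwich_mul_block_sq] at h
  exact h

theorem continuous_rowKernel (D : Matrix (Fin n) (Fin n) ℝ) (K : Matrix (Fin 1) (Fin n) ℝ) :
    Continuous (rowKernel D K) :=
  continuous_iff_continuousAt.2 fun z => (hasDerivAt_rowKernel D K z).continuousAt

theorem continuous_rowKernel₁ (D : Matrix (Fin n) (Fin n) ℝ) (K : Matrix (Fin 1) (Fin n) ℝ) :
    Continuous (rowKernel₁ D K) :=
  continuous_iff_continuousAt.2 fun z => (hasDerivAt_rowKernel₁ D K z).continuousAt

end rowKernel

/-! ### Convolution kernels -/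

/-- `∫₀^{x-y} g(σ) dσ`. -/
def convKer (g : ℝ → ℝ) (x y : ℝ) : ℝ := ∫ s in (0 : ℝ)..(x - y), g s

theorem waveKernel_convKer {g g' : ℝ → ℝ} (hg : ∀ x, HasDerivAt g (g' x) x) (hg' : Continuous g') :
    WaveKernel (convKer g) (fun x y => g (x - y)) (fun x y => -g (x - y))
      (fun x y => g' (x - y)) (fun x y => g' (x - y)) (fun _ => 0) 0 := by
  have hc : Continuous g := continuous_iff_continuousAt.2 fun z => (hg z).continuousAt
  have hF : ∀ x, HasDerivAt (fun x => ∫ s in (0 : ℝ)..x, g s) (g x) x := fun x =>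
    intervalIntegral.integral_hasDerivAt_right (hc.intervalIntegrable _ _)
      (hc.stronglyMeasurableAtFilter _ _) hc.continuousAt
  have hx : ∀ x y : ℝ, HasDerivAt (fun s => s - y) 1 x := fun x y => (hasDerivAt_id' x).sub_const y
  have hy : ∀ x y : ℝ, HasDerivAt (fun s => x - s) (-1) y := fun x y => (hasDerivAt_id' y).const_sub x
  refine
    { cont := ?_
      cont_x := by simp only [Function.uncurry_def]; fun_prop
      cont_y := by simp only [Function.uncurry_def]; fun_prop
      cont_xx := by simp only [Function.uncurry_def]; fun_prop
      cont_yy := by simp only [Function.uncurry_def]; fun_prop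
      cont_D := continuous_const
      der_x := fun x y => (HasDerivAt.comp (h₂ := fun x => ∫ s in (0 : ℝ)..x, g s) x
        (hF (x - y)) (hx x y)).congr_deriv (mul_one _)
      der_y := fun x y => (HasDerivAt.comp (h₂ := fun x => ∫ s in (0 : ℝ)..x, g s) y
        (hF (x - y)) (hy x y)).congr_deriv (by ring)
      der_xx := fun x y => ((hg (x - y)).comp x (hx x y)).congr_deriv (mul_one _)
      der_yy := fun x y => (((hg (x - y)).comp y (hy x y)).fun_neg).congr_deriv (by ring)
      der_diag := fun x => by simpa [convKer] using hasDerivAt_const x (0 : ℝ)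
      diag := fun x => by ring
      wave := fun x y => by ring }
  have h1 : Continuous fun x => ∫ s in (0 : ℝ)..x, g s :=
    continuous_iff_continuousAt.2 fun z => (hF z).continuousAt
  exact h1.comp (by fun_prop : Continuous fun p : ℝ × ℝ => p.1 - p.2)

theorem convKer_diag (g : ℝ → ℝ) (x : ℝ) : convKer g x x = 0 := by simp [convKer]

/-- The second order linear equation `Y'' = T Y + f b` is solvable. -/
theorem exists_second_order {E : Type*} [NormedAddCommGroup E] [NormedSpace ℝ E] [CompleteSpace E]
    (T : E →L[ℝ] E) (b : E) {f : ℝ → ℝ} (hf : Continuous f) (X : E) :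
    ∃ Y Y₁ : ℝ → E, Y 0 = X ∧ Y₁ 0 = 0 ∧
      (∀ x, HasDerivAt Y (Y₁ x) x) ∧ ∀ x, HasDerivAt Y₁ (T (Y x) + f x • b) x := by
  let L : (E × E) →L[ℝ] (E × E) :=
    (ContinuousLinearMap.snd ℝ E E).prod (T.comp (ContinuousLinearMap.fst ℝ E E))
  let M : ℝ → (E × E) →L[ℝ] (E × E) := fun x => NormedSpace.exp (x • L)
  have hM : ∀ x, HasDerivAt M (L * M x) x := fun x => hasDerivAt_exp_smul_const' (𝕂 := ℝ) L x
  have hMc : Continuous M := continuous_iff_continuousAt.2 fun z => (hM z).continuousAt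
  have hinv : ∀ x, M x * M (-x) = 1 := by
    intro x
    simp only [M]
    let : NormedAlgebra ℚ ((E × E) →L[ℝ] (E × E)) := NormedAlgebra.restrictScalars ℚ ℝ _
    rw [← NormedSpace.exp_add_of_commute, ← add_smul, add_neg_cancel, zero_smul,
      NormedSpace.exp_zero]
    exact (Commute.refl L).smul_left _ |>.smul_right _
  let G : ℝ → E × E := fun y => f y • M (-y) (0, b)
  have hG : Continuous G := by
    have : Continuous fun y => M (-y) := hMc.comp continuous_neg
    exact hf.smul (this.clm_apply continuous_const)
  -- Variation of constants for the first order system in (Y, Y').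
  let Z : ℝ → E × E := fun x => M x ((X, 0) + ∫ y in (0 : ℝ)..x, G y)
  have hI : ∀ x, HasDerivAt (fun x => (X, (0 : E)) + ∫ y in (0 : ℝ)..x, G y) (G x) x := fun x =>
    (intervalIntegral.integral_hasDerivAt_right (hG.intervalIntegrable _ _)
      (hG.stronglyMeasurableAtFilter _ _) hG.continuousAt).const_add _
  have hZ : ∀ x, HasDerivAt Z (L (Z x) + f x • (0, b)) x := by
    intro x
    refine ((hM x).clm_apply (hI x)).congr_deriv ?_
    congr 1
    have := congrArg (fun T : (E × E) →L[ℝ] (E × E) => T (0, b)) (hinv x)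
    simp only [G, map_smul]
    congr 1
  refine ⟨fun x => (Z x).1, fun x => (Z x).2, ?_, ?_, fun x => ?_, fun x => ?_⟩
  · simp [Z, M]
  · simp [Z, M]
  · have := (ContinuousLinearMap.fst ℝ E E).hasFDerivAt.comp_hasDerivAt x (hZ x)
    refine this.congr_deriv ?_
    simp [L]
  · have := (ContinuousLinearMap.snd ℝ E E).hasFDerivAt.comp_hasDerivAt x (hZ x)
    refine this.congr_deriv ?_
    simp [L]

section

variable {n : ℕ} (D : Matrix (Fin n) (Fin n) ℝ) (K : Matrix (Fin 1) (Fin n) ℝ)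
  (b : EuclideanSpace ℝ (Fin n))

theorem hasDerivAt_inner_rowKernel (x : ℝ) :
    HasDerivAt (fun s => inner ℝ (rowKernel D K s) b) (inner ℝ (rowKernel₁ D K x) b) x := by
  simpa using (hasDerivAt_rowKernel D K x).inner ℝ (hasDerivAt_const x b)

theorem hasDerivAt_inner_rowKernel₁ (x : ℝ) :
    HasDerivAt (fun s => inner ℝ (rowKernel₁ D K s) b) (inner ℝ (rowKernel D K x) (mv D b)) x := by
  rw [← inner_mv_transpose]
  simpa using (hasDerivAt_rowKernel₁ D K x).inner ℝ (hasDerivAt_const x b)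

theorem continuous_inner_rowKernel : Continuous fun s => inner ℝ (rowKernel D K s) b :=
  (continuous_rowKernel D K).inner continuous_const

theorem continuous_inner_rowKernel₁ : Continuous fun s => inner ℝ (rowKernel₁ D K s) b :=
  (continuous_rowKernel₁ D K).inner continuous_const

theorem waveKernel_rowKernel :
    WaveKernel (convKer fun s => inner ℝ (rowKernel D K s) b)
      (fun x y => inner ℝ (rowKernel D K (x - y)) b) (fun x y => -inner ℝ (rowKernel D K (x - y)) b)
      (fun x y => inner ℝ (rowKernel₁ D K (x - y)) b)
      (fun x y => inner ℝ (rowKernel₁ D K (x - y)) b) (fun _ => 0) 0 :=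
  waveKernel_convKer (hasDerivAt_inner_rowKernel D K b) (continuous_inner_rowKernel₁ D K b)

variable {D b}

/-- Duality between the row kernel and the second order equation. -/
theorem rowKernel_duality {f : ℝ → ℝ} (hf : Continuous f) {Y Y₁ : ℝ → EuclideanSpace ℝ (Fin n)}
    (h0 : Y₁ 0 = 0) (hY : ∀ x, HasDerivAt Y (Y₁ x) x)
    (hY₁ : ∀ x, HasDerivAt Y₁ (mv D (Y x) + f x • b) x) (x : ℝ) :
    volt (fun x y => inner ℝ (rowKernel D K (x - y)) b) f x + inner ℝ (rowKernel₁ D K x) (Y 0) =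
      inner ℝ (rowVec K) (Y₁ x) := by
  -- In the y-derivative of γ(x-y)Y'(y) + γ'(x-y)Y(y) everything cancels by γ'' = γD, except for the
  -- forcing term γ(x-y) b f(y).
  have hd : ∀ y, HasDerivAt (fun y => inner ℝ (rowKernel D K (x - y)) (Y₁ y)
      + inner ℝ (rowKernel₁ D K (x - y)) (Y y)) (inner ℝ (rowKernel D K (x - y)) b * f y) y := by
    intro y
    have hy : HasDerivAt (fun s => x - s) (-1) y := (hasDerivAt_id' y).const_sub x
    have h1 := (hasDerivAt_rowKernel D K (x - y)).scomp y hy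
    have h2 := (hasDerivAt_rowKernel₁ D K (x - y)).scomp y hy
    refine ((h1.inner ℝ (hY₁ y)).add (h2.inner ℝ (hY y))).congr_deriv ?_
    simp only [Function.comp, inner_add_right, inner_smul_right, neg_smul, one_smul, inner_neg_left,
      inner_mv_transpose]
    ring
  have hc : Continuous fun y => inner ℝ (rowKernel D K (x - y)) b * f y :=
    ((continuous_inner_rowKernel D K b).comp (by fun_prop : Continuous fun y => x - y)).mul hf
  have h := intervalIntegral.integral_eq_sub_of_hasDerivAt (a := 0) (b := x) (fun y _ => hd y)
    (hc.intervalIntegrable _ _)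
  rw [volt, h]
  simp [h0, rowKernel_zero, rowKernel₁_zero]

end

/-! ### The transformation `(X, u) ↦ w` and its inverse -/

section wTrans

variable {n : ℕ} (A : Matrix (Fin n) (Fin n) ℝ) (B : Matrix (Fin n) (Fin 1) ℝ)
  (K : Matrix (Fin 1) (Fin n) ℝ) (a c : ℝ)

/-- `γ'`. -/
def gam₁ : ℝ → EuclideanSpace ℝ (Fin n) := rowKernel₁ (A - a • 1) K

/-- `ψ'`. -/
def psi₁ : ℝ → EuclideanSpace ℝ (Fin n) := rowKernel₁ (A + B * K - a • 1) K

/-- `k_x`. -/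
def kKer₁ (x y : ℝ) : ℝ := inner ℝ (gam A K a (x - y)) (colVec B)

/-- `n_x`. -/
def nKer₁ (x y : ℝ) : ℝ := inner ℝ (psi A B K a (x - y)) (colVec B)

theorem deriv_gam : deriv (gam A K a) = gam₁ A K a :=
  funext fun x => (hasDerivAt_rowKernel _ K x).deriv

theorem deriv_psi : deriv (psi A B K a) = psi₁ A B K a :=
  funext fun x => (hasDerivAt_rowKernel _ K x).deriv

theorem waveKernel_kKer : WaveKernel (kKer A B K a) (kKer₁ A B K a)
    (fun x y => -kKer₁ A B K a x y) (fun x y => inner ℝ (gam₁ A K a (x - y)) (colVec B))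
    (fun x y => inner ℝ (gam₁ A K a (x - y)) (colVec B)) (fun _ => 0) 0 :=
  waveKernel_rowKernel (A - a • 1) K (colVec B)

theorem waveKernel_nKer : WaveKernel (nKer A B K a) (nKer₁ A B K a)
    (fun x y => -nKer₁ A B K a x y) (fun x y => inner ℝ (psi₁ A B K a (x - y)) (colVec B))
    (fun x y => inner ℝ (psi₁ A B K a (x - y)) (colVec B)) (fun _ => 0) 0 :=
  waveKernel_rowKernel (A + B * K - a • 1) K (colVec B)

theorem kKer_diag (x : ℝ) : kKer A B K a x x = 0 := convKer_diag _ x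

theorem nKer_diag (x : ℝ) : nKer A B K a x x = 0 := convKer_diag _ x

theorem partialX_kKer : partialX (kKer A B K a) = kKer₁ A B K a :=
  funext₂ fun x y => ((waveKernel_kKer A B K a).der_x x y).deriv

theorem partialX_nKer : partialX (nKer A B K a) = nKer₁ A B K a :=
  funext₂ fun x y => ((waveKernel_nKer A B K a).der_x x y).deriv

theorem partialX_qKer : partialX (qKer a c) = bKer₁ (a + c) :=
  funext₂ fun x y => (hasDerivAt_bKer (a + c) x y).deriv

theorem partialX_lKer : partialX (lKer a c) = fun x y => -bKer₁ (-(a + c)) x y := by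
  rw [lKer_eq_bKer]
  exact funext₂ fun x y => (hasDerivAt_bKer (-(a + c)) x y).fun_neg.deriv

variable {A B K a c} {f f₁ f₂ : ℝ → ℝ} (X : EuclideanSpace ℝ (Fin n))

theorem wTrans_eq (x : ℝ) :
    wTrans A B K a X f x = f x - volt (kKer A B K a) f x - inner ℝ (gam A K a x) X := rfl

theorem continuousOn_wTrans (hf : ContinuousOn f (Icc 0 1)) :
    ContinuousOn (wTrans A B K a X f) (Icc 0 1) :=
  (hf.sub (continuousOn_volt (waveKernel_kKer A B K a).cont (sq_of_continuousOn hf))).sub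
    (continuous_inner_rowKernel _ K X).continuousOn

theorem sq_wTrans (hf : Sq f) : Sq (wTrans A B K a X f) :=
  (hf.sub (sq_volt (waveKernel_kKer A B K a).cont hf)).sub
    (sq_of_continuousOn (continuous_inner_rowKernel _ K X).continuousOn)

/-- The derivative of `w`. -/
def wTrans₁ (A : Matrix (Fin n) (Fin n) ℝ) (B : Matrix (Fin n) (Fin 1) ℝ)
    (K : Matrix (Fin 1) (Fin n) ℝ) (a : ℝ) (X : EuclideanSpace ℝ (Fin n)) (f f₁ : ℝ → ℝ)
    (x : ℝ) : ℝ :=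
  f₁ x - volt (kKer₁ A B K a) f x - inner ℝ (gam₁ A K a x) X

theorem prim_wTrans (hf : Prim f f₁) : Prim (wTrans A B K a X f) (wTrans₁ A B K a X f f₁) := by
  have h := (hf.sub (Prim.volt (waveKernel_kKer A B K a).cont (waveKernel_kKer A B K a).cont_x
    (waveKernel_kKer A B K a).der_x hf.continuousOn)).sub
    (Prim.of_hasDerivAt (hasDerivAt_inner_rowKernel (A - a • 1) K X)
      (continuous_inner_rowKernel₁ _ K X))
  refine h.congr_deriv fun x _ => ?_
  rw [kKer_diag, zero_mul, zero_add]; rfl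

theorem wTrans₁_zero (h0 : f₁ 0 = 0) : wTrans₁ A B K a X f f₁ 0 = 0 := by
  rw [wTrans₁, h0, volt_zero_right, gam₁, rowKernel₁_zero, inner_zero_left]; ring

/-- Since k_y(x,0) = -γ(x)B and γ'' = γ(A - aI), w_xx is again the transformation, applied to the
pair ((A - aI)X + u(0)B, u''). Up to the multiple a of the state, this pair is the undelayed part of
the plant's right-hand side. -/
theorem h2_wTrans (hf : H2 f f₁ f₂) (h0 : f₁ 0 = 0) :
    H2 (wTrans A B K a X f) (wTrans₁ A B K a X f f₁)
      (wTrans A B K a (mv (A - a • 1) X + f 0 • colVec B) f₂) := by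
  have hd : H2 (fun x => inner ℝ (gam A K a x) X) (fun x => inner ℝ (gam₁ A K a x) X)
      (fun x => inner ℝ (gam A K a x) (mv (A - a • 1) X)) :=
    ⟨Prim.of_hasDerivAt (hasDerivAt_inner_rowKernel (A - a • 1) K X)
      (continuous_inner_rowKernel₁ _ K X),
     Prim.of_hasDerivAt (hasDerivAt_inner_rowKernel₁ (A - a • 1) K X)
      (continuous_inner_rowKernel _ K _),
     sq_of_continuousOn (continuous_inner_rowKernel _ K _).continuousOn⟩
  have h := (hf.sub ((waveKernel_kKer A B K a).h2_volt hf h0)).sub hd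
  have e1 : wTrans₁ A B K a X f f₁ = fun x => f₁ x
      - (kKer A B K a x x * f x + volt (kKer₁ A B K a) f x) - inner ℝ (gam₁ A K a x) X := by
    ext x; rw [kKer_diag, zero_mul, zero_add]; rfl
  have e2 : wTrans A B K a (mv (A - a • 1) X + f 0 • colVec B) f₂ = fun x => f₂ x
      - (volt (kKer A B K a) f₂ x + 2 * 0 * f x - -kKer₁ A B K a x 0 * f 0
        + 0 * volt (kKer A B K a) f x) - inner ℝ (gam A K a x) (mv (A - a • 1) X) := by
    ext x
    rw [wTrans_eq, inner_add_right, inner_smul_right, kKer₁, sub_zero]; ring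
  rw [e1, e2]; exact h

theorem mulVec_colVec_row (v : EuclideanSpace ℝ (Fin n)) :
    mv (B * K) v = inner ℝ (rowVec K) v • colVec B := by
  apply WithLp.ofLp_injective
  rw [ofLp_mv, inner_eq_dotProduct, ← Matrix.mulVec_mulVec]
  ext i
  simp [Matrix.mulVec, dotProduct, rowVec, colVec, mul_comm]

/-- The inverse transformation `u = w + ∫₀ˣ n(x,y) w(y) dy + ψ(x) X`, and its derivative. -/
theorem wTrans_inverse (hf : ContinuousOn f (Icc 0 1)) {x : ℝ} (hx : x ∈ Icc (0 : ℝ) 1) :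
    f x = wTrans A B K a X f x + volt (nKer A B K a) (wTrans A B K a X f) x
        + inner ℝ (psi A B K a x) X ∧
      volt (kKer₁ A B K a) f x + inner ℝ (gam₁ A K a x) X =
        volt (nKer₁ A B K a) (wTrans A B K a X f) x + inner ℝ (psi₁ A B K a x) X := by
  obtain ⟨g, hg, hfg⟩ := continuousOn_iccExtend hf
  -- Let Y'' = (A - aI)Y + f B, Y(0) = X, Y'(0) = 0. Duality gives ∫k f + γX = KY, hence w = f - KY.
  -- Substituting f = w + KY closes the loop: the same Y solves Y'' = (A + BK - aI)Y + w B, and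
  -- duality for ψ gives f - w = KY = ∫n w + ψX.
  obtain ⟨Y, Y₁, hX, h0, hY, hY₁⟩ := exists_second_order (mv (A - a • 1)) (colVec B) hg X
  set w : ℝ → ℝ := fun x => g x - inner ℝ (rowVec K) (Y x) with hw
  have hYc : Continuous Y := continuous_iff_continuousAt.2 fun z => (hY z).continuousAt
  have hY1c : Continuous Y₁ := continuous_iff_continuousAt.2 fun z => (hY₁ z).continuousAt
  have hwc : Continuous w := hg.sub (continuous_const.inner hYc)
  have hY₁' : ∀ x, HasDerivAt Y₁ (mv (A + B * K - a • 1) (Y x) + w x • colVec B) x := by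
    intro x
    refine (hY₁ x).congr_deriv ?_
    have e : mv (A + B * K - a • 1) = mv (A - a • 1) + mv (B * K) := by
      simp only [mv, ← map_add]; congr 1; abel
    rw [e, _root_.add_apply, mulVec_colVec_row, hw, sub_smul]; abel
  have d1 : ∀ x, volt (kKer₁ A B K a) g x + inner ℝ (gam₁ A K a x) X = inner ℝ (rowVec K) (Y₁ x) :=
    fun x => by rw [← hX]; exact rowKernel_duality K hg h0 hY hY₁ x
  have d2 : ∀ x, volt (nKer₁ A B K a) w x + inner ℝ (psi₁ A B K a x) X = inner ℝ (rowVec K) (Y₁ x) :=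
    fun x => by rw [← hX]; exact rowKernel_duality K hwc h0 hY hY₁' x
  have pY : Prim (fun x => inner ℝ (rowVec K) (Y x)) (fun x => inner ℝ (rowVec K) (Y₁ x)) :=
    Prim.of_hasDerivAt (fun x => by simpa using (hasDerivAt_const x (rowVec K)).inner ℝ (hY x))
      (continuous_const.inner hY1c)
  have p1 := (Prim.volt (waveKernel_kKer A B K a).cont (waveKernel_kKer A B K a).cont_x
    (waveKernel_kKer A B K a).der_x hg.continuousOn).add
    (Prim.of_hasDerivAt (hasDerivAt_inner_rowKernel (A - a • 1) K X)
      (continuous_inner_rowKernel₁ _ K X))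
  have p2 := (Prim.volt (waveKernel_nKer A B K a).cont (waveKernel_nKer A B K a).cont_x
    (waveKernel_nKer A B K a).der_x hwc.continuousOn).add
    (Prim.of_hasDerivAt (hasDerivAt_inner_rowKernel (A + B * K - a • 1) K X)
      (continuous_inner_rowKernel₁ _ K X))
  have q1 := (p1.congr_deriv (g' := fun x => inner ℝ (rowVec K) (Y₁ x)) fun x _ => by
    rw [kKer_diag, zero_mul, zero_add]; exact d1 x).eq_of_eq pY (by
      simp [volt_zero_right, rowKernel_zero, hX])
  have q2 := (p2.congr_deriv (g' := fun x => inner ℝ (rowVec K) (Y₁ x)) fun x _ => by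
    rw [nKer_diag, zero_mul, zero_add]; exact d2 x).eq_of_eq pY (by
      simp [volt_zero_right, rowKernel_zero, hX])
  have ew : EqOn (wTrans A B K a X f) w (Icc 0 1) := by
    intro y hy
    have := q1 hy
    simp only at this
    rw [wTrans_eq, hfg hy, volt_congr (fun y hy => hfg (Ioo_subset_Icc_self hy)) hy]
    simp only [hw, ← this, gam]; ring
  have ev : ∀ κ, volt κ (wTrans A B K a X f) x = volt κ w x := fun κ =>
    volt_congr (fun y hy => ew (Ioo_subset_Icc_self hy)) hx
  have ef : ∀ κ, volt κ f x = volt κ g x := fun κ =>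
    volt_congr (fun y hy => hfg (Ioo_subset_Icc_self hy)) hx
  constructor
  · have := q2 hx
    simp only at this
    rw [ev, ew hx, hfg hx, add_assoc, psi, this, hw]; ring
  · rw [ev, ef, d1, d2]

end wTrans

/-! ### The transformation `(X, u) ↦ z` -/

section zTrans

variable {n : ℕ} {A : Matrix (Fin n) (Fin n) ℝ} {B : Matrix (Fin n) (Fin 1) ℝ}
  {K : Matrix (Fin 1) (Fin n) ℝ} {a c : ℝ} {f f₁ f₂ : ℝ → ℝ} (X : EuclideanSpace ℝ (Fin n))

/-- `z(x) = w(x) - ∫₀ˣ q(x,y) w(y) dy`. -/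
def zTrans (A : Matrix (Fin n) (Fin n) ℝ) (B : Matrix (Fin n) (Fin 1) ℝ)
    (K : Matrix (Fin 1) (Fin n) ℝ) (a c : ℝ) (X : EuclideanSpace ℝ (Fin n)) (f : ℝ → ℝ) : ℝ → ℝ :=
  bTrans (a + c) (wTrans A B K a X f)

/-- The derivative of `z`. -/
def zTrans₁ (A : Matrix (Fin n) (Fin n) ℝ) (B : Matrix (Fin n) (Fin 1) ℝ)
    (K : Matrix (Fin 1) (Fin n) ℝ) (a c : ℝ) (X : EuclideanSpace ℝ (Fin n)) (f f₁ : ℝ → ℝ)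
    (x : ℝ) : ℝ :=
  wTrans₁ A B K a X f f₁ x - (qKer a c x x * wTrans A B K a X f x
    + volt (bKer₁ (a + c)) (wTrans A B K a X f) x)

theorem zTrans₁_zero (h0 : f₁ 0 = 0) : zTrans₁ A B K a c X f f₁ 0 = 0 := by
  rw [zTrans₁, wTrans₁_zero X h0, volt_zero_right, qKer_eq_bKer, bKer_diag]; ring

theorem prim_zTrans (hf : Prim f f₁) : Prim (zTrans A B K a c X f) (zTrans₁ A B K a c X f f₁) := by
  have h := prim_wTrans (A := A) (B := B) (K := K) (a := a) X hf
  exact h.sub (Prim.volt (continuous_bKer _) (continuous_bKer₁ _) (hasDerivAt_bKer (a + c))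
    h.continuousOn)

theorem h2_zTrans (hf : H2 f f₁ f₂) (h0 : f₁ 0 = 0) :
    H2 (zTrans A B K a c X f) (zTrans₁ A B K a c X f f₁)
      (fun x => zTrans A B K a c (mv (A - a • 1) X + f 0 • colVec B) f₂ x
        + (a + c) * zTrans A B K a c X f x) :=
  (h2_wTrans X hf h0).sub_volt_bKer (wTrans₁_zero X h0) (a + c)

/-- `w = z + ∫₀ˣ l z`. -/
theorem wTrans_eq_zTrans (hf : ContinuousOn f (Icc 0 1)) {x : ℝ} (hx : x ∈ Icc (0 : ℝ) 1) :
    wTrans A B K a X f x =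
      zTrans A B K a c X f x + volt (lKer a c) (zTrans A B K a c X f) x := by
  have h := bTrans_bTrans (μ := a + c) (continuousOn_wTrans (A := A) (B := B) (K := K) (a := a) X hf) hx
  rw [← h, bTrans, zTrans, lKer_eq_bKer]
  simp only [volt, neg_mul, intervalIntegral.integral_neg]
  ring

/-- The inversion formula w = z + ∫l z, differentiated. Both expressions for w_x are continuous, so
the identity also holds at the end point x = 1, where the feedback needs it. -/
theorem wTrans₁_eq_zTrans₁ (hf : H2 f f₁ f₂) (h0 : f₁ 0 = 0) {x : ℝ} (hx : x ∈ Icc (0 : ℝ) 1) :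
    wTrans₁ A B K a X f f₁ x = zTrans₁ A B K a c X f f₁ x
      + lKer a c x x * zTrans A B K a c X f x
      + volt (partialX (lKer a c)) (zTrans A B K a c X f) x := by
  have hz := prim_zTrans (A := A) (B := B) (K := K) (a := a) (c := c) X hf.prim
  have hz₁ := (h2_zTrans (A := A) (B := B) (K := K) (a := a) (c := c) X hf h0).prim₁.continuousOn
  have hr := (hz.sub (Prim.volt (continuous_bKer _) (continuous_bKer₁ _)
    (hasDerivAt_bKer (-(a + c))) hz.continuousOn)).congr (bTrans_bTrans (continuousOn_wTrans X hf.prim.continuousOn))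
  have hd : Continuous fun x => bKer (-(a + c)) x x := by
    have := continuous_bKer (-(a + c)); fun_prop
  have hv := continuousOn_volt (continuous_bKer₁ (-(a + c))) (sq_of_continuousOn hz.continuousOn)
  have e := (prim_wTrans X hf.prim).eqOn_deriv hr (h2_wTrans X hf h0).prim₁.continuousOn
    (hz₁.sub ((hd.continuousOn.mul hz.continuousOn).add hv)) hx
  rw [e, partialX_lKer, lKer_eq_bKer]
  simp only [volt, neg_mul, intervalIntegral.integral_neg]
  ring

/-- U consists of exactly the lower order terms of z_x(1), so z_x(1) = u_x(1) - U. The identity is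
algebraic and the value f₁ 1 cancels, so f₁ is arbitrary. -/
theorem feedback_eq :
    feedback A B K a c X f = f₁ 1 - zTrans₁ A B K a c X f f₁ 1 := by
  rw [feedback, zTrans₁, wTrans₁, deriv_gam, partialX_kKer, partialX_qKer]
  simp only [volt]; ring

end zTrans

/-! ### Maxima -/

theorem triMax_nonneg (κ : ℝ → ℝ → ℝ) : 0 ≤ triMax κ := by
  refine Real.sSup_nonneg ?_
  rintro _ ⟨p, _, rfl⟩
  exact abs_nonneg _

theorem abs_le_triMax {κ : ℝ → ℝ → ℝ} (hκ : Continuous (Function.uncurry κ)) {x y : ℝ}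
    (hx : x ∈ Icc (0 : ℝ) 1) (hy : y ∈ Icc 0 x) : |κ x y| ≤ triMax κ := by
  refine le_csSup ?_ ⟨(x, y), ⟨hy.1, hy.2, hx.2⟩, rfl⟩
  obtain ⟨M, hM, h⟩ := exists_abs_le_of_continuous hκ
  refine ⟨M, ?_⟩
  rintro _ ⟨p, ⟨h1, h2, h3⟩, rfl⟩
  exact h p.1 ⟨h1.trans h2, h3⟩ p.2 ⟨h1, h2.trans h3⟩

theorem le_segMax {f : ℝ → ℝ} (hf : ContinuousOn f (Icc 0 1)) {x : ℝ} (hx : x ∈ Icc (0 : ℝ) 1) :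
    f x ≤ segMax f :=
  le_csSup (isCompact_Icc.bddAbove_image hf) ⟨x, hx, rfl⟩

theorem le_histMax {f : ℝ → ℝ} {h : ℝ} (hf : ContinuousOn f (Icc (-h) 0)) {x : ℝ}
    (hx : x ∈ Icc (-h) 0) : f x ≤ histMax h f :=
  le_csSup (isCompact_Icc.bddAbove_image hf) ⟨x, hx, rfl⟩

theorem norm_toL2_volt_le {κ : ℝ → ℝ → ℝ} {f : ℝ → ℝ} {M : ℝ} (hf : Sq f) (hM : 0 ≤ M)
    (h : ∀ x ∈ Icc (0 : ℝ) 1, ∀ y ∈ Icc 0 x, |κ x y| ≤ M) :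
    ‖toL2 (volt κ f)‖ ≤ M * ‖toL2 f‖ :=
  norm_toL2_le (by positivity) fun x hx =>
    abs_volt_le hf hM (Ioo_subset_Icc_self hx) (h x (Ioo_subset_Icc_self hx))

theorem norm_toL2_volt_le_triMax {κ : ℝ → ℝ → ℝ} {f : ℝ → ℝ} (hκ : Continuous (Function.uncurry κ))
    (hf : Sq f) : ‖toL2 (volt κ f)‖ ≤ triMax κ * ‖toL2 f‖ :=
  norm_toL2_volt_le hf (triMax_nonneg κ) fun _ hx _ hy => abs_le_triMax hκ hx hy

theorem norm_toL2_mul_le {φ f : ℝ → ℝ} {M : ℝ} (hφ : ContinuousOn φ (Icc 0 1)) (hf : ContinuousOn f (Icc 0 1))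
    (hM : 0 ≤ M) (h : ∀ x ∈ Icc (0 : ℝ) 1, |φ x| ≤ M) :
    ‖toL2 (fun x => φ x * f x)‖ ≤ M * ‖toL2 f‖ := by
  have s1 : Sq f := sq_of_continuousOn hf
  have s2 : Sq fun x => φ x * f x := sq_of_continuousOn (hφ.mul hf)
  have h1 : ‖toL2 (fun x => φ x * f x)‖ ^ 2 ≤ (M * ‖toL2 f‖) ^ 2 := by
    rw [mul_pow, norm_toL2_sq s1, norm_toL2_sq s2, ← intervalIntegral.integral_const_mul]
    refine intervalIntegral.integral_mono_on zero_le_one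
      (intervalIntegrable_iff_vol01.2 s2.integrable_sq)
      ((intervalIntegrable_iff_vol01.2 s1.integrable_sq).const_mul _) fun x hx => ?_
    rw [mul_pow]
    refine mul_le_mul_of_nonneg_right ?_ (sq_nonneg _)
    exact sq_le_sq' (abs_le.1 (h x hx)).1 (abs_le.1 (h x hx)).2
  exact (sq_le_sq₀ (norm_nonneg _) (by positivity)).1 h1

section

variable {n : ℕ}

theorem norm_toL2_inner_le {g : ℝ → EuclideanSpace ℝ (Fin n)} {M : ℝ}
    (X : EuclideanSpace ℝ (Fin n)) (hM : 0 ≤ M) (h : ∀ x ∈ Icc (0 : ℝ) 1, ‖g x‖ ≤ M) :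
    ‖toL2 (fun x => inner ℝ (g x) X)‖ ≤ M * ‖X‖ :=
  norm_toL2_le (by positivity) fun x hx =>
    (abs_real_inner_le_norm _ _).trans
      (mul_le_mul_of_nonneg_right (h x (Ioo_subset_Icc_self hx)) (norm_nonneg _))

/-! ### The transformation as an operator on `ℝⁿ × L²(0,1)` -/

/-- The Volterra operator with continuous kernel `κ` on `L²(0,1)`. -/
def voltL (κ : ℝ → ℝ → ℝ) (hκ : Continuous (Function.uncurry κ)) : L2 →L[ℝ] L2 :=
  LinearMap.mkContinuous
    { toFun := fun f => toL2 (volt κ f)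
      map_add' := fun f g => by
        rw [← toL2_add (sq_volt hκ (Lp.memLp f)) (sq_volt hκ (Lp.memLp g))]
        refine toL2_congr fun x hx => ?_
        rw [← volt_add hκ (Lp.memLp f) (Lp.memLp g) (Ioo_subset_Icc_self hx)]
        exact volt_congr_ae (Lp.coeFn_add f g) (Ioo_subset_Icc_self hx)
      map_smul' := fun r f => by
        rw [RingHom.id_apply, ← toL2_const_mul r (sq_volt hκ (Lp.memLp f))]
        refine toL2_congr fun x hx => ?_
        rw [← volt_const_mul]
        exact volt_congr_ae (Lp.coeFn_smul r f) (Ioo_subset_Icc_self hx) }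
    (triMax κ) fun f => by
      have h := norm_toL2_volt_le_triMax hκ (Lp.memLp f)
      rwa [toL2_coeFn] at h

theorem voltL_toL2 {κ : ℝ → ℝ → ℝ} (hκ : Continuous (Function.uncurry κ)) {f : ℝ → ℝ} (hf : Sq f) :
    voltL κ hκ (toL2 f) = toL2 (volt κ f) := by
  change toL2 (volt κ (toL2 f)) = _
  exact toL2_congr fun x hx => volt_congr_ae (coeFn_toL2 hf) (Ioo_subset_Icc_self hx)

/-- `X ↦ ⟨g(·), X⟩`. -/
def rowL (g : ℝ → EuclideanSpace ℝ (Fin n)) (hg : Continuous g) :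
    EuclideanSpace ℝ (Fin n) →L[ℝ] L2 :=
  LinearMap.toContinuousLinearMap
    { toFun := fun X => toL2 fun x => inner ℝ (g x) X
      map_add' := fun X Y => by
        rw [← toL2_add (sq_of_continuousOn (hg.inner continuous_const).continuousOn)
          (sq_of_continuousOn (hg.inner continuous_const).continuousOn)]
        simp only [inner_add_right]
      map_smul' := fun r X => by
        rw [RingHom.id_apply,
          ← toL2_const_mul r (sq_of_continuousOn (hg.inner continuous_const).continuousOn)]
        simp only [inner_smul_right] }

variable {A : Matrix (Fin n) (Fin n) ℝ} {B : Matrix (Fin n) (Fin 1) ℝ}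
  {K : Matrix (Fin 1) (Fin n) ℝ} {a c : ℝ} {f f₁ f₂ : ℝ → ℝ} (X : EuclideanSpace ℝ (Fin n))

theorem continuous_kKer (A : Matrix (Fin n) (Fin n) ℝ) (B : Matrix (Fin n) (Fin 1) ℝ)
    (K : Matrix (Fin 1) (Fin n) ℝ) (a : ℝ) : Continuous (Function.uncurry (kKer A B K a)) :=
  (waveKernel_kKer A B K a).cont

theorem continuous_kKer₁ (A : Matrix (Fin n) (Fin n) ℝ) (B : Matrix (Fin n) (Fin 1) ℝ)
    (K : Matrix (Fin 1) (Fin n) ℝ) (a : ℝ) : Continuous (Function.uncurry (kKer₁ A B K a)) :=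
  (waveKernel_kKer A B K a).cont_x

theorem continuous_nKer (A : Matrix (Fin n) (Fin n) ℝ) (B : Matrix (Fin n) (Fin 1) ℝ)
    (K : Matrix (Fin 1) (Fin n) ℝ) (a : ℝ) : Continuous (Function.uncurry (nKer A B K a)) :=
  (waveKernel_nKer A B K a).cont

theorem continuous_nKer₁ (A : Matrix (Fin n) (Fin n) ℝ) (B : Matrix (Fin n) (Fin 1) ℝ)
    (K : Matrix (Fin 1) (Fin n) ℝ) (a : ℝ) : Continuous (Function.uncurry (nKer₁ A B K a)) :=
  (waveKernel_nKer A B K a).cont_x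

theorem continuous_gam (A : Matrix (Fin n) (Fin n) ℝ) (K : Matrix (Fin 1) (Fin n) ℝ) (a : ℝ) :
    Continuous (gam A K a) := continuous_rowKernel _ K

theorem continuous_gam₁ (A : Matrix (Fin n) (Fin n) ℝ) (K : Matrix (Fin 1) (Fin n) ℝ) (a : ℝ) :
    Continuous (gam₁ A K a) := continuous_rowKernel₁ _ K

/-- `f ↦ f - ∫₀ˣ q(x,y) f(y) dy` on `L²(0,1)`. -/
def bTransL (μ : ℝ) : L2 →L[ℝ] L2 := ContinuousLinearMap.id ℝ L2 - voltL (bKer μ) (continuous_bKer μ)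

theorem bTransL_toL2 {μ : ℝ} (hf : Sq f) : bTransL μ (toL2 f) = toL2 (bTrans μ f) := by
  rw [bTransL, _root_.sub_apply, ContinuousLinearMap.id_apply, voltL_toL2 _ hf,
    ← toL2_sub hf (sq_volt (continuous_bKer μ) hf)]
  rfl

/-- The part of `(X, u) ↦ z` that depends on `u`. -/
def zU (A : Matrix (Fin n) (Fin n) ℝ) (B : Matrix (Fin n) (Fin 1) ℝ)
    (K : Matrix (Fin 1) (Fin n) ℝ) (a c : ℝ) : L2 →L[ℝ] L2 :=
  (bTransL (a + c)).comp (ContinuousLinearMap.id ℝ L2 - voltL (kKer A B K a) (continuous_kKer A B K a))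

/-- The part of `(X, u) ↦ z` that depends on `X`, up to the sign. -/
def zX (A : Matrix (Fin n) (Fin n) ℝ) (K : Matrix (Fin 1) (Fin n) ℝ) (a c : ℝ) :
    EuclideanSpace ℝ (Fin n) →L[ℝ] L2 :=
  (bTransL (a + c)).comp (rowL (gam A K a) (continuous_gam A K a))

/-- Expressing z through bounded operators on ℝⁿ × L² transfers time continuity and the L² time
derivative from (X, u) to z. -/
theorem toL2_zTrans (hf : Sq f) :
    toL2 (zTrans A B K a c X f) = zU A B K a c (toL2 f) - zX A K a c X := by
  have s1 := sq_volt (continuous_kKer A B K a) hf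
  have s2 : Sq fun x => inner ℝ (gam A K a x) X :=
    sq_of_continuousOn ((continuous_gam A K a).inner continuous_const).continuousOn
  have e : toL2 (wTrans A B K a X f) =
      (toL2 f - voltL (kKer A B K a) (continuous_kKer A B K a) (toL2 f))
        - rowL (gam A K a) (continuous_gam A K a) X := by
    rw [voltL_toL2 _ hf, ← toL2_sub hf s1]
    exact toL2_sub (hf.sub s1) s2
  rw [zTrans, ← bTransL_toL2 (sq_wTrans X hf), e, map_sub]
  rfl

theorem norm_toL2_bTrans_le (a c : ℝ) (hf : Sq f) :
    ‖toL2 (bTrans (a + c) f)‖ ≤ (1 + triMax (qKer a c)) * ‖toL2 f‖ := by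
  have h1 := toL2_sub hf (sq_volt (continuous_bKer (a + c)) hf)
  have h2 := norm_toL2_volt_le_triMax (continuous_bKer (a + c)) hf
  change toL2 (bTrans (a + c) f) = _ at h1
  rw [h1, qKer_eq_bKer]
  refine (norm_sub_le _ _).trans ?_
  linarith

theorem norm_gam_le {x : ℝ} (hx : x ∈ Icc (0 : ℝ) 1) :
    ‖gam A K a x‖ ≤ segMax fun x => ‖gam A K a x‖ :=
  le_segMax (f := fun x => ‖gam A K a x‖) (continuous_gam A K a).norm.continuousOn hx

theorem segMax_gam_nonneg : 0 ≤ segMax fun x => ‖gam A K a x‖ :=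
  (norm_nonneg _).trans (norm_gam_le (left_mem_Icc.2 zero_le_one))

/-- The constant ζ bounds the squared operator norm of the map through which (A₁ - a₂I)X(t-τ) enters
the target equation. -/
theorem norm_zX_sq_le : ‖zX A K a c X‖ ^ 2 ≤ zeta A K a c * ‖X‖ ^ 2 := by
  have s2 : Sq fun x => inner ℝ (gam A K a x) X :=
    sq_of_continuousOn ((continuous_gam A K a).inner continuous_const).continuousOn
  have e : zX A K a c X = toL2 (bTrans (a + c) fun x => inner ℝ (gam A K a x) X) :=
    bTransL_toL2 s2
  have hq := triMax_nonneg (qKer a c)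
  have h1 := norm_toL2_bTrans_le a c s2
  have h2 := norm_toL2_inner_le (g := gam A K a) X segMax_gam_nonneg fun x hx => norm_gam_le hx
  rw [zeta, ← mul_pow, ← mul_pow, e]
  refine pow_le_pow_left₀ (norm_nonneg _) (h1.trans ?_) 2
  rw [mul_assoc]
  exact mul_le_mul_of_nonneg_left h2 (by positivity)

/-! ### Bounds for the transformation -/

theorem norm_toL2_wTrans_le (hf : Sq f) :
    ‖toL2 (wTrans A B K a X f)‖ ≤
      (1 + triMax (kKer A B K a)) * ‖toL2 f‖ + (segMax fun x => ‖gam A K a x‖) * ‖X‖ := by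
  have s1 := sq_volt (continuous_kKer A B K a) hf
  have s2 : Sq fun x => inner ℝ (gam A K a x) X :=
    sq_of_continuousOn ((continuous_gam A K a).inner continuous_const).continuousOn
  have h1 := toL2_sub (hf.sub s1) s2
  have h2 := toL2_sub hf s1
  change toL2 (wTrans A B K a X f) = toL2 (fun x => f x - volt (kKer A B K a) f x) - _ at h1
  rw [h1, h2]
  have b1 := norm_toL2_volt_le_triMax (continuous_kKer A B K a) hf
  have b2 := norm_toL2_inner_le (g := gam A K a) X segMax_gam_nonneg fun x hx => norm_gam_le hx
  refine (norm_sub_le _ _).trans ?_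
  have := norm_sub_le (toL2 f) (toL2 (volt (kKer A B K a) f))
  linarith

/-- Triangle inequality, term by term. The square root is there because M₁ contains the maximum of
|γ'|² rather than the square of a maximum. -/
theorem norm_toL2_zTrans₁_le (hf : Prim f f₁) (hf₁ : Sq f₁) :
    ‖toL2 (zTrans₁ A B K a c X f f₁)‖ ≤ ‖toL2 f₁‖
      + triMax (partialX (kKer A B K a)) * ‖toL2 f‖
      + Real.sqrt (segMax fun x => ‖deriv (gam A K a) x‖ ^ 2) * ‖X‖
      + Qconst a c * ‖toL2 (wTrans A B K a X f)‖ := by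
  have sf := sq_of_continuousOn hf.continuousOn
  have cw := continuousOn_wTrans (A := A) (B := B) (K := K) (a := a) X hf.continuousOn
  have sw := sq_of_continuousOn cw
  have s1 := sq_volt (continuous_kKer₁ A B K a) sf
  have s2 : Sq fun x => inner ℝ (gam₁ A K a x) X :=
    sq_of_continuousOn ((continuous_gam₁ A K a).inner continuous_const).continuousOn
  have cd : ContinuousOn (fun x => qKer a c x x) (Icc 0 1) := by
    have := continuous_bKer (a + c)
    rw [qKer_eq_bKer]
    exact (by fun_prop : Continuous fun x => bKer (a + c) x x).continuousOn
  have s3 : Sq fun x => qKer a c x x * wTrans A B K a X f x := sq_of_continuousOn (cd.mul cw)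
  have s4 := sq_volt (continuous_bKer₁ (a + c)) sw
  have b1 : ‖toL2 (volt (kKer₁ A B K a) f)‖ ≤ triMax (partialX (kKer A B K a)) * ‖toL2 f‖ := by
    rw [partialX_kKer]; exact norm_toL2_volt_le_triMax (continuous_kKer₁ A B K a) sf
  have b2 : ‖toL2 fun x => inner ℝ (gam₁ A K a x) X‖ ≤
      Real.sqrt (segMax fun x => ‖deriv (gam A K a) x‖ ^ 2) * ‖X‖ := by
    refine norm_toL2_inner_le X (Real.sqrt_nonneg _) fun x hx => Real.le_sqrt_of_sq_le ?_
    rw [deriv_gam]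
    exact le_segMax (f := fun x => ‖gam₁ A K a x‖ ^ 2)
      ((continuous_gam₁ A K a).norm.pow 2).continuousOn hx
  have b3 : ‖toL2 fun x => qKer a c x x * wTrans A B K a X f x‖ ≤
      (segMax fun x => |qKer a c x x|) * ‖toL2 (wTrans A B K a X f)‖ := by
    have hb : ∀ x ∈ Icc (0 : ℝ) 1, |qKer a c x x| ≤ segMax fun x => |qKer a c x x| := fun x hx =>
      le_segMax (f := fun x => |qKer a c x x|) cd.abs hx
    exact norm_toL2_mul_le cd cw ((abs_nonneg _).trans (hb 0 (left_mem_Icc.2 zero_le_one))) hb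
  have b4 : ‖toL2 (volt (bKer₁ (a + c)) (wTrans A B K a X f))‖ ≤
      triMax (partialX (qKer a c)) * ‖toL2 (wTrans A B K a X f)‖ := by
    rw [partialX_qKer]; exact norm_toL2_volt_le_triMax (continuous_bKer₁ _) sw
  have e : toL2 (zTrans₁ A B K a c X f f₁) =
      toL2 f₁ - toL2 (volt (kKer₁ A B K a) f) - toL2 (fun x => inner ℝ (gam₁ A K a x) X)
        - (toL2 (fun x => qKer a c x x * wTrans A B K a X f x)
          + toL2 (volt (bKer₁ (a + c)) (wTrans A B K a X f))) := by
    have s5 : Sq fun x => f₁ x - volt (kKer₁ A B K a) f x := hf₁.sub s1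
    have s6 : Sq fun x => f₁ x - volt (kKer₁ A B K a) f x - inner ℝ (gam₁ A K a x) X := s5.sub s2
    have s7 : Sq fun x => qKer a c x x * wTrans A B K a X f x
      + volt (bKer₁ (a + c)) (wTrans A B K a X f) x := s3.add s4
    rw [← toL2_sub hf₁ s1, ← toL2_sub s5 s2, ← toL2_add s3 s4, ← toL2_sub s6 s7]
    rfl
  rw [e, Qconst, add_mul]
  refine (norm_sub_le _ _).trans (le_trans (add_le_add ((norm_sub_le _ _).trans
    (add_le_add ((norm_sub_le _ _).trans (add_le_add le_rfl b1)) b2))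
    ((norm_add_le _ _).trans (add_le_add b3 b4))) le_rfl)

/-- The `ℝⁿ × H¹` norm of `(X, z)` is bounded by the weighted norm of `(X, u)`. -/
theorem norm_zTrans_sq_le (hf : Prim f f₁) (hf₁ : Sq f₁) :
    ‖X‖ ^ 2 + ‖toL2 (zTrans A B K a c X f)‖ ^ 2 + ‖toL2 (zTrans₁ A B K a c X f f₁)‖ ^ 2 ≤
      MOne A K a c * ‖X‖ ^ 2 + MTwo A B K a c * ‖toL2 f‖ ^ 2 + 4 * ‖toL2 f₁‖ ^ 2 := by
  have sf := sq_of_continuousOn hf.continuousOn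
  have hw := norm_toL2_wTrans_le (A := A) (B := B) (K := K) (a := a) X sf
  have hz := norm_toL2_bTrans_le a c (sq_wTrans (A := A) (B := B) (K := K) (a := a) X sf)
  have hz₁ := norm_toL2_zTrans₁_le (A := A) (B := B) (K := K) (a := a) (c := c) X hf hf₁
  change ‖toL2 (zTrans A B K a c X f)‖ ≤ _ at hz
  have hq := triMax_nonneg (qKer a c)
  have hk := triMax_nonneg (kKer A B K a)
  have hg := segMax_gam_nonneg (A := A) (K := K) (a := a)
  have hg₁ : 0 ≤ segMax fun x => ‖deriv (gam A K a) x‖ ^ 2 := by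
    rw [deriv_gam]
    exact (sq_nonneg _).trans (le_segMax (f := fun x => ‖gam₁ A K a x‖ ^ 2)
      ((continuous_gam₁ A K a).norm.pow 2).continuousOn (left_mem_Icc.2 zero_le_one))
  have hsq := Real.sq_sqrt hg₁
  rw [MOne, MTwo, ← hsq]
  have n0 := norm_nonneg (toL2 (wTrans A B K a X f))
  have n1 := norm_nonneg (toL2 (zTrans A B K a c X f))
  have n2 := norm_nonneg (toL2 (zTrans₁ A B K a c X f f₁))
  generalize ‖toL2 (wTrans A B K a X f)‖ = W at *
  generalize ‖toL2 (zTrans A B K a c X f)‖ = Z at *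
  generalize ‖toL2 (zTrans₁ A B K a c X f f₁)‖ = Z₁ at *
  generalize triMax (qKer a c) = q at *
  generalize triMax (kKer A B K a) = k at *
  generalize (segMax fun x => ‖gam A K a x‖) = g at *
  generalize Real.sqrt (segMax fun x => ‖deriv (gam A K a) x‖ ^ 2) = g₁ at *
  generalize triMax (partialX (kKer A B K a)) = k₁ at *
  generalize Qconst a c = Q at *
  generalize ‖toL2 f‖ = F at *
  generalize ‖toL2 f₁‖ = F₁ at *
  generalize ‖X‖ = x at *
  -- The factor 2 for the two-term square and the factor 4 for the four-term square below produce
  -- the coefficients 2, 4 and 8 = 4·2 of M₁ and M₂.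
  have e1 : W ^ 2 ≤ 2 * ((1 + k) ^ 2 * F ^ 2 + g ^ 2 * x ^ 2) := by
    have := pow_le_pow_left₀ n0 hw 2
    nlinarith [sq_nonneg ((1 + k) * F - g * x)]
  have e2 : Z ^ 2 ≤ (1 + q) ^ 2 * W ^ 2 := by
    rw [← mul_pow]; exact pow_le_pow_left₀ n1 hz 2
  have e3 : Z₁ ^ 2 ≤ 4 * (F₁ ^ 2 + k₁ ^ 2 * F ^ 2 + g₁ ^ 2 * x ^ 2 + Q ^ 2 * W ^ 2) := by
    have := pow_le_pow_left₀ n2 hz₁ 2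
    have h4 : ∀ p q r s : ℝ, (p + q + r + s) ^ 2 ≤ 4 * (p ^ 2 + q ^ 2 + r ^ 2 + s ^ 2) := by
      intro p q r s
      nlinarith [sq_nonneg (p - q), sq_nonneg (p - r), sq_nonneg (p - s), sq_nonneg (q - r),
        sq_nonneg (q - s), sq_nonneg (r - s)]
    have h5 := h4 F₁ (k₁ * F) (g₁ * x) (Q * W)
    simp only [mul_pow] at h5
    linarith
  have e4 := mul_le_mul_of_nonneg_left e1 (sq_nonneg (1 + q))
  have e5 := mul_le_mul_of_nonneg_left e1 (sq_nonneg Q)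
  linarith

end

/-! ### The feedback and the bounded inverse -/

section

variable {n : ℕ} {A : Matrix (Fin n) (Fin n) ℝ} {B : Matrix (Fin n) (Fin 1) ℝ}
  {K : Matrix (Fin 1) (Fin n) ℝ} {a c : ℝ} {f f₁ f₂ : ℝ → ℝ} (X : EuclideanSpace ℝ (Fin n))

theorem continuous_lKer (a c : ℝ) : Continuous (Function.uncurry (lKer a c)) := by
  rw [lKer_eq_bKer]
  exact (continuous_bKer (-(a + c))).neg

theorem continuous_partialX_lKer (a c : ℝ) : Continuous (Function.uncurry (partialX (lKer a c))) := by
  rw [partialX_lKer]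
  exact (continuous_bKer₁ (-(a + c))).neg

theorem norm_toL2_wTrans_le_zTrans (hf : ContinuousOn f (Icc 0 1)) :
    ‖toL2 (wTrans A B K a X f)‖ ≤ (1 + triMax (lKer a c)) * ‖toL2 (zTrans A B K a c X f)‖ := by
  have sz : Sq (zTrans A B K a c X f) := sq_bTrans (sq_wTrans X (sq_of_continuousOn hf))
  have e : toL2 (wTrans A B K a X f) =
      toL2 (zTrans A B K a c X f) + toL2 (volt (lKer a c) (zTrans A B K a c X f)) := by
    rw [← toL2_add sz (sq_volt (continuous_lKer a c) sz)]
    exact toL2_congr fun x hx => wTrans_eq_zTrans X hf (Ioo_subset_Icc_self hx)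
  rw [e]
  refine (norm_add_le _ _).trans ?_
  have := norm_toL2_volt_le_triMax (continuous_lKer a c) sz
  linarith

/-- The feedback in terms of `(X, z)`. -/
theorem feedback_eq_zTrans (hf : H2 f f₁ f₂) (h0 : f₁ 0 = 0) :
    feedback A B K a c X f = lKer a c 1 1 * zTrans A B K a c X f 1
      + volt (partialX (lKer a c)) (zTrans A B K a c X f) 1
      + volt (partialX (nKer A B K a)) (wTrans A B K a X f) 1
      + inner ℝ (deriv (psi A B K a) 1) X := by
  have h1 : (1 : ℝ) ∈ Icc (0 : ℝ) 1 := right_mem_Icc.2 zero_le_one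
  have e1 := wTrans₁_eq_zTrans₁ (A := A) (B := B) (K := K) (a := a) (c := c) X hf h0 h1
  have e2 := (wTrans_inverse (A := A) (B := B) (K := K) (a := a) X hf.prim.continuousOn h1).2
  rw [feedback_eq (f₁ := f₁), partialX_nKer, deriv_psi]
  rw [wTrans₁] at e1
  linarith

/-- Only the point value z(1) involves z_x, and it does so with the factor 1/√3. Of the √2 in c₂
only 1 ≤ √2 is needed. -/
theorem abs_feedback_le (hf : H2 f f₁ f₂) (h0 : f₁ 0 = 0) :
    |feedback A B K a c X f| ≤ cOne A B K a * ‖X‖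
      + cTwo A B K a c * ‖toL2 (zTrans A B K a c X f)‖
      + cThree a c * ‖toL2 (zTrans₁ A B K a c X f f₁)‖ / Real.sqrt 3 := by
  have h1 : (1 : ℝ) ∈ Icc (0 : ℝ) 1 := right_mem_Icc.2 zero_le_one
  have hz := h2_zTrans (A := A) (B := B) (K := K) (a := a) (c := c) X hf h0
  have sw := sq_wTrans (A := A) (B := B) (K := K) (a := a) X hf.sq_zero
  have b1 := hz.prim.abs_one_le hz.sq_one
  have hw := norm_toL2_wTrans_le_zTrans (A := A) (B := B) (K := K) (a := a) (c := c) X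
    hf.prim.continuousOn
  have cl : Continuous fun y => |partialX (lKer a c) 1 y| := by
    have := continuous_partialX_lKer a c; fun_prop
  have cn : Continuous fun y => |partialX (nKer A B K a) 1 y| := by
    rw [partialX_nKer]
    have := continuous_nKer₁ A B K a; fun_prop
  have ml : ∀ y ∈ Icc (0 : ℝ) 1, |partialX (lKer a c) 1 y| ≤
      segMax fun y => |partialX (lKer a c) 1 y| := fun y hy =>
    le_segMax (f := fun y => |partialX (lKer a c) 1 y|) cl.continuousOn hy
  have mn : ∀ y ∈ Icc (0 : ℝ) 1, |partialX (nKer A B K a) 1 y| ≤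
      segMax fun y => |partialX (nKer A B K a) 1 y| := fun y hy =>
    le_segMax (f := fun y => |partialX (nKer A B K a) 1 y|) cn.continuousOn hy
  have b2 := abs_volt_le hz.sq_zero ((abs_nonneg _).trans (ml 0 (left_mem_Icc.2 zero_le_one))) h1 ml
  have b3 := abs_volt_le sw ((abs_nonneg _).trans (mn 0 (left_mem_Icc.2 zero_le_one))) h1 mn
  have b4 := abs_real_inner_le_norm (deriv (psi A B K a) 1) X
  have mn0 := (abs_nonneg _).trans (mn 0 (left_mem_Icc.2 zero_le_one))
  rw [feedback_eq_zTrans X hf h0, cTwo, xiConst, cThree, cOne]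
  have t1 := abs_add_le (lKer a c 1 1 * zTrans A B K a c X f 1
      + volt (partialX (lKer a c)) (zTrans A B K a c X f) 1
      + volt (partialX (nKer A B K a)) (wTrans A B K a X f) 1) (inner ℝ (deriv (psi A B K a) 1) X)
  have t2 := abs_add_le (lKer a c 1 1 * zTrans A B K a c X f 1
      + volt (partialX (lKer a c)) (zTrans A B K a c X f) 1)
      (volt (partialX (nKer A B K a)) (wTrans A B K a X f) 1)
  have t3 := abs_add_le (lKer a c 1 1 * zTrans A B K a c X f 1)
    (volt (partialX (lKer a c)) (zTrans A B K a c X f) 1)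
  rw [abs_mul] at t3
  have t4 := mul_le_mul_of_nonneg_left b1 (abs_nonneg (lKer a c 1 1))
  have t5 := mul_le_mul_of_nonneg_left hw mn0
  have t6 : |lKer a c 1 1| * ‖toL2 (zTrans A B K a c X f)‖ ≤
      Real.sqrt 2 * |lKer a c 1 1| * ‖toL2 (zTrans A B K a c X f)‖ := by
    have : (1 : ℝ) ≤ Real.sqrt 2 := Real.one_le_sqrt.2 (by norm_num)
    nlinarith [mul_nonneg (abs_nonneg (lKer a c 1 1)) (norm_nonneg (toL2 (zTrans A B K a c X f)))]
  rw [mul_add, mul_div_assoc'] at t4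
  linarith

/-- The feedback is controlled with a constant smaller than `3`. -/
theorem feedback_sq_le (hf : H2 f f₁ f₂) (h0 : f₁ 0 = 0) :
    feedback A B K a c X f ^ 2 ≤ 7 / 3 * (cOne A B K a ^ 2 * ‖X‖ ^ 2
      + cTwo A B K a c ^ 2 * ‖toL2 (zTrans A B K a c X f)‖ ^ 2
      + cThree a c ^ 2 * ‖toL2 (zTrans₁ A B K a c X f f₁)‖ ^ 2) := by
  have h := abs_feedback_le (A := A) (B := B) (K := K) (a := a) (c := c) X hf h0
  rw [← sq_abs]
  refine (pow_le_pow_left₀ (abs_nonneg _) h 2).trans ?_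
  have hs : (1 / Real.sqrt 3) ^ 2 = 1 / 3 := by
    rw [div_pow, Real.sq_sqrt (by norm_num)]; norm_num
  rw [div_eq_mul_one_div]
  simp only [← mul_pow]
  generalize 1 / Real.sqrt 3 = s at hs
  generalize cOne A B K a * ‖X‖ = x
  generalize cTwo A B K a c * ‖toL2 (zTrans A B K a c X f)‖ = y
  generalize cThree a c * ‖toL2 (zTrans₁ A B K a c X f f₁)‖ = z
  -- Lagrange's identity for Cauchy–Schwarz against (1, 1, 1/√3), whose squared length is 7/3.
  have e : 7 / 3 * (x ^ 2 + y ^ 2 + z ^ 2) - (x + y + z * s) ^ 2 =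
      (x - y) ^ 2 + (z - x * s) ^ 2 + (z - y * s) ^ 2 + (1 / 3 - s ^ 2) * (x ^ 2 + y ^ 2 + z ^ 2) := by
    ring
  rw [hs, sub_self, zero_mul, add_zero] at e
  nlinarith [sq_nonneg (x - y), sq_nonneg (z - x * s), sq_nonneg (z - y * s)]

/-- The inverse transformation is bounded. -/
theorem exists_norm_le_zTrans (A : Matrix (Fin n) (Fin n) ℝ) (B : Matrix (Fin n) (Fin 1) ℝ)
    (K : Matrix (Fin 1) (Fin n) ℝ) (a c : ℝ) :
    ∃ C, 0 ≤ C ∧ ∀ (X : EuclideanSpace ℝ (Fin n)) (f f₁ f₂ : ℝ → ℝ), H2 f f₁ f₂ → f₁ 0 = 0 →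
      ‖toL2 f‖ ≤ C * (‖X‖ + ‖toL2 (zTrans A B K a c X f)‖ + ‖toL2 (zTrans₁ A B K a c X f f₁)‖) ∧
      ‖toL2 f₁‖ ≤ C * (‖X‖ + ‖toL2 (zTrans A B K a c X f)‖ + ‖toL2 (zTrans₁ A B K a c X f f₁)‖) := by
  have cpsi : Continuous (psi A B K a) := continuous_rowKernel _ K
  have cpsi₁ : Continuous (psi₁ A B K a) := continuous_rowKernel₁ _ K
  have cd : Continuous fun x => lKer a c x x := by
    have := continuous_lKer a c; fun_prop
  obtain ⟨L, hL⟩ := isCompact_Icc.exists_bound_of_continuousOn (s := Icc (0 : ℝ) 1) cd.continuousOn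
  obtain ⟨P, hP⟩ := isCompact_Icc.exists_bound_of_continuousOn (s := Icc (0 : ℝ) 1) cpsi.continuousOn
  obtain ⟨P₁, hP₁⟩ := isCompact_Icc.exists_bound_of_continuousOn (s := Icc (0 : ℝ) 1) cpsi₁.continuousOn
  have h0 : (0 : ℝ) ∈ Icc (0 : ℝ) 1 := left_mem_Icc.2 zero_le_one
  have hL0 := (norm_nonneg _).trans (hL 0 h0)
  have hP0 := (norm_nonneg _).trans (hP 0 h0)
  have hP₁0 := (norm_nonneg _).trans (hP₁ 0 h0)
  set l := triMax (lKer a c)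
  set l₁ := triMax (partialX (lKer a c))
  set ν := triMax (nKer A B K a)
  set ν₁ := triMax (nKer₁ A B K a)
  have hl : 0 ≤ l := triMax_nonneg _
  have hl₁ : 0 ≤ l₁ := triMax_nonneg _
  have hν : 0 ≤ ν := triMax_nonneg _
  have hν₁ : 0 ≤ ν₁ := triMax_nonneg _
  refine ⟨(1 + ν) * (1 + l) + P + (1 + L + l₁ + ν₁ * (1 + l) + P₁), by positivity,
    fun X f f₁ f₂ hf hf0 => ?_⟩
  have hz := h2_zTrans (A := A) (B := B) (K := K) (a := a) (c := c) X hf hf0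
  have hw := h2_wTrans (A := A) (B := B) (K := K) (a := a) X hf hf0
  have nw := norm_toL2_wTrans_le_zTrans (A := A) (B := B) (K := K) (a := a) (c := c) X
    hf.prim.continuousOn
  have sp : Sq fun x => inner ℝ (psi A B K a x) X :=
    sq_of_continuousOn (cpsi.inner continuous_const).continuousOn
  have sp₁ : Sq fun x => inner ℝ (psi₁ A B K a x) X :=
    sq_of_continuousOn (cpsi₁.inner continuous_const).continuousOn
  have sn := sq_volt (continuous_nKer A B K a) hw.sq_zero
  have sn₁ := sq_volt (continuous_nKer₁ A B K a) hw.sq_zero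
  have sl : Sq fun x => lKer a c x x * zTrans A B K a c X f x :=
    sq_of_continuousOn (cd.continuousOn.mul hz.prim.continuousOn)
  have sl₁ := sq_volt (continuous_partialX_lKer a c) hz.sq_zero
  have e : toL2 f = toL2 (wTrans A B K a X f) + toL2 (volt (nKer A B K a) (wTrans A B K a X f))
      + toL2 fun x => inner ℝ (psi A B K a x) X := by
    have s : Sq fun x => wTrans A B K a X f x + volt (nKer A B K a) (wTrans A B K a X f) x :=
      hw.sq_zero.add sn
    rw [← toL2_add hw.sq_zero sn, ← toL2_add s sp]
    exact toL2_congr fun x hx =>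
      (wTrans_inverse X hf.prim.continuousOn (Ioo_subset_Icc_self hx)).1
  have e₁ : toL2 f₁ = toL2 (zTrans₁ A B K a c X f f₁)
      + toL2 (fun x => lKer a c x x * zTrans A B K a c X f x)
      + toL2 (volt (partialX (lKer a c)) (zTrans A B K a c X f))
      + toL2 (volt (nKer₁ A B K a) (wTrans A B K a X f))
      + toL2 fun x => inner ℝ (psi₁ A B K a x) X := by
    have s1 : Sq fun x => zTrans₁ A B K a c X f f₁ x + lKer a c x x * zTrans A B K a c X f x :=
      hz.sq_one.add sl
    have s2 : Sq fun x => zTrans₁ A B K a c X f f₁ x + lKer a c x x * zTrans A B K a c X f x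
        + volt (partialX (lKer a c)) (zTrans A B K a c X f) x := s1.add sl₁
    have s3 : Sq fun x => zTrans₁ A B K a c X f f₁ x + lKer a c x x * zTrans A B K a c X f x
        + volt (partialX (lKer a c)) (zTrans A B K a c X f) x
        + volt (nKer₁ A B K a) (wTrans A B K a X f) x := s2.add sn₁
    rw [← toL2_add hz.sq_one sl, ← toL2_add s1 sl₁, ← toL2_add s2 sn₁, ← toL2_add s3 sp₁]
    refine toL2_congr fun x hx => ?_
    have q1 := wTrans₁_eq_zTrans₁ (A := A) (B := B) (K := K) (a := a) (c := c) X hf hf0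
      (Ioo_subset_Icc_self hx)
    have q2 := (wTrans_inverse (A := A) (B := B) (K := K) (a := a) X hf.prim.continuousOn
      (Ioo_subset_Icc_self hx)).2
    rw [wTrans₁] at q1
    linarith
  have b1 := norm_toL2_volt_le_triMax (continuous_nKer A B K a) hw.sq_zero
  have b2 := norm_toL2_inner_le (g := psi A B K a) X hP0 hP
  have b3 := norm_toL2_mul_le cd.continuousOn hz.prim.continuousOn hL0 hL
  have b4 := norm_toL2_volt_le_triMax (continuous_partialX_lKer a c) hz.sq_zero
  have b5 := norm_toL2_volt_le_triMax (continuous_nKer₁ A B K a) hw.sq_zero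
  have b6 := norm_toL2_inner_le (g := psi₁ A B K a) X hP₁0 hP₁
  have nx := norm_nonneg X
  have nz := norm_nonneg (toL2 (zTrans A B K a c X f))
  have nz₁ := norm_nonneg (toL2 (zTrans₁ A B K a c X f f₁))
  have m1 := mul_le_mul_of_nonneg_left nw hν
  have m2 := mul_le_mul_of_nonneg_left nw hν₁
  constructor
  · rw [e]
    refine ((norm_add_le _ _).trans (add_le_add (norm_add_le _ _) le_rfl)).trans ?_
    calc _ ≤ (1 + ν) * (1 + l) * ‖toL2 (zTrans A B K a c X f)‖ + P * ‖X‖ := by linarith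
      _ ≤ ((1 + ν) * (1 + l) + P) * (‖X‖ + ‖toL2 (zTrans A B K a c X f)‖
          + ‖toL2 (zTrans₁ A B K a c X f f₁)‖) := by
        nlinarith [mul_nonneg (by positivity : 0 ≤ (1 + ν) * (1 + l)) nx,
          mul_nonneg (by positivity : 0 ≤ (1 + ν) * (1 + l)) nz₁, mul_nonneg hP0 nz, mul_nonneg hP0 nz₁]
      _ ≤ _ := mul_le_mul_of_nonneg_right (le_add_of_nonneg_right (by positivity)) (by positivity)
  · rw [e₁]
    refine ((norm_add_le _ _).trans (add_le_add ((norm_add_le _ _).trans (add_le_add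
      ((norm_add_le _ _).trans (add_le_add (norm_add_le _ _) le_rfl)) le_rfl)) le_rfl)).trans ?_
    calc _ ≤ ‖toL2 (zTrans₁ A B K a c X f f₁)‖
          + (L + l₁ + ν₁ * (1 + l)) * ‖toL2 (zTrans A B K a c X f)‖ + P₁ * ‖X‖ := by linarith
      _ ≤ (1 + L + l₁ + ν₁ * (1 + l) + P₁) * (‖X‖ + ‖toL2 (zTrans A B K a c X f)‖
          + ‖toL2 (zTrans₁ A B K a c X f f₁)‖) := by
        have q : 0 ≤ L + l₁ + ν₁ * (1 + l) := by positivity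
        nlinarith [mul_nonneg q nx, mul_nonneg q nz₁, mul_nonneg hP₁0 nz, mul_nonneg hP₁0 nz₁]
      _ ≤ _ := mul_le_mul_of_nonneg_right (le_add_of_nonneg_left (by positivity)) (by positivity)

end

/-! ### Positive definite matrices -/

/-- ε is the minimum of the Rayleigh quotient on a compact sphere. The sphere is that of the sup
norm, so the denominator v ⬝ᵥ v has to be kept. -/
theorem exists_pos_le_of_posDef {ι : Type*} [Fintype ι] {M : Matrix ι ι ℝ} (hM : M.PosDef) :
    ∃ ε > 0, ∀ v : ι → ℝ, ε * (v ⬝ᵥ v) ≤ v ⬝ᵥ M.mulVec v := by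
  have hc : Continuous fun v : ι → ℝ => v ⬝ᵥ M.mulVec v := by
    unfold dotProduct Matrix.mulVec dotProduct; fun_prop
  have hd : Continuous fun v : ι → ℝ => v ⬝ᵥ v := by
    unfold dotProduct; fun_prop
  have hpos : ∀ v : ι → ℝ, v ≠ 0 → 0 < v ⬝ᵥ v := fun v hv =>
    lt_of_le_of_ne (Finset.sum_nonneg fun i _ => mul_self_nonneg _)
      fun h => hv (dotProduct_self_eq_zero.1 h.symm)
  rcases isEmpty_or_nonempty ι with hι | hι
  · refine ⟨1, one_pos, fun v => ?_⟩
    simp [dotProduct]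
  have hS : IsCompact (Metric.sphere (0 : ι → ℝ) 1) := isCompact_sphere _ _
  have hne : (Metric.sphere (0 : ι → ℝ) 1).Nonempty := NormedSpace.sphere_nonempty.2 zero_le_one
  have h0 : ∀ v ∈ Metric.sphere (0 : ι → ℝ) 1, v ≠ 0 := fun v hv => ne_zero_of_mem_unit_sphere ⟨v, hv⟩
  obtain ⟨w, hw, hmin⟩ := hS.exists_isMinOn hne
    (f := fun v : ι → ℝ => (v ⬝ᵥ M.mulVec v) / (v ⬝ᵥ v))
    (hc.continuousOn.div hd.continuousOn fun v hv => (hpos v (h0 v hv)).ne')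
  have hMpos : ∀ v : ι → ℝ, v ≠ 0 → 0 < v ⬝ᵥ M.mulVec v := fun v hv => by
    simpa using hM.dotProduct_mulVec_pos hv
  refine ⟨_, div_pos (hMpos w (h0 w hw)) (hpos w (h0 w hw)), fun v => ?_⟩
  rcases eq_or_ne v 0 with rfl | hv
  · simp
  have hvn : ‖v‖ ≠ 0 := norm_ne_zero_iff.2 hv
  have hm : ‖v‖⁻¹ • v ∈ Metric.sphere (0 : ι → ℝ) 1 := by
    simp [norm_smul, hvn]
  have h1 := hmin hm
  simp only [mem_ofPred_eq, Matrix.mulVec_smul, smul_dotProduct, dotProduct_smul, smul_eq_mul] at h1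
  have e : ‖v‖⁻¹ * (‖v‖⁻¹ * (v ⬝ᵥ M.mulVec v)) / (‖v‖⁻¹ * (‖v‖⁻¹ * (v ⬝ᵥ v))) =
      (v ⬝ᵥ M.mulVec v) / (v ⬝ᵥ v) := by
    have := (hpos v hv).ne'
    field_simp
  rw [e] at h1
  exact (le_div_iff₀ (hpos v hv)).1 h1

/-- A positive definite quadratic form is coercive on vectors of a Hilbert space. -/
theorem exists_pos_le_of_posDef_inner {ι H : Type*} [Fintype ι] [DecidableEq ι]
    [NormedAddCommGroup H] [InnerProductSpace ℝ H] {M : Matrix ι ι ℝ} (hM : M.PosDef) :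
    ∃ ε > 0, ∀ v : ι → H, ε * ∑ i, ‖v i‖ ^ 2 ≤ ∑ i, ∑ j, M i j * inner ℝ (v i) (v j) := by
  obtain ⟨ε, hε, h⟩ := exists_pos_le_of_posDef hM
  refine ⟨ε, hε, fun v => ?_⟩
  have hN : (M - ε • (1 : Matrix ι ι ℝ)).PosSemidef := by
    rw [Matrix.posSemidef_iff_dotProduct_mulVec]
    refine ⟨hM.1.sub (by simp [Matrix.IsHermitian]), fun x => ?_⟩
    have := h x
    simp only [Matrix.sub_mulVec, Matrix.smul_mulVec, Matrix.one_mulVec, dotProduct_sub,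
      dotProduct_smul, star_trivial, smul_eq_mul]
    linarith
  -- A sum of rank one matrices turns the form on Hilbert space vectors into a sum of squared norms.
  obtain ⟨m, a, ha⟩ := Matrix.posSemidef_iff_eq_sum_vecMulVec.1 hN
  have e : ∑ i, ∑ j, (M - ε • (1 : Matrix ι ι ℝ)) i j * inner ℝ (v i) (v j) =
      ∑ k, ‖∑ i, a k i • v i‖ ^ 2 := by
    have h1 : ∀ k, ‖∑ i, a k i • v i‖ ^ 2 = ∑ i, ∑ j, a k i * a k j * inner ℝ (v i) (v j) := by
      intro k
      simp only [← real_inner_self_eq_norm_sq, sum_inner, inner_sum, inner_smul_left,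
        inner_smul_right, conj_trivial, Finset.mul_sum]
      exact Finset.sum_congr rfl fun i _ => Finset.sum_congr rfl fun j _ => by
        rw [real_inner_comm]; ring
    have h2 : ∀ i j, (M - ε • (1 : Matrix ι ι ℝ)) i j * inner ℝ (v i) (v j) =
        ∑ k, a k i * a k j * inner ℝ (v i) (v j) := fun i j => by
      rw [ha, Matrix.sum_apply, Finset.sum_mul]
      rfl
    simp_rw [h1, h2]
    exact (Finset.sum_congr rfl fun i _ => Finset.sum_comm).trans Finset.sum_comm
  have e2 : ∑ i, ∑ j, (M - ε • (1 : Matrix ι ι ℝ)) i j * inner ℝ (v i) (v j) =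
      (∑ i, ∑ j, M i j * inner ℝ (v i) (v j)) - ε * ∑ i, ‖v i‖ ^ 2 := by
    simp only [Matrix.sub_apply, Matrix.smul_apply, sub_mul, Finset.sum_sub_distrib, smul_eq_mul,
      Matrix.one_apply, mul_ite, ite_mul, mul_one, mul_zero, zero_mul, Finset.sum_ite_eq,
      Finset.mem_univ, if_true, real_inner_self_eq_norm_sq, Finset.mul_sum]
  have e3 : 0 ≤ ∑ k, ‖∑ i, a k i • v i‖ ^ 2 := Finset.sum_nonneg fun k _ => sq_nonneg _
  linarith

/-! ### A Halanay inequality -/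

/-- A Halanay inequality with one-sided linear minorants, valid only while `V ≤ 9/8`. -/
theorem halanay {V τ : ℝ → ℝ} {h δ ε : ℝ} (hδ : 0 < δ) (hε : 0 < ε)
    (hV : ContinuousOn V (Ici 0)) (hh : 0 < h) (h0 : ∀ t ∈ Icc (-h) 0, V t ≤ 1)
    (hτ : ∀ t ≥ 0, 0 ≤ τ t ∧ τ t ≤ h)
    (H : ∀ t > 0, V t ≤ 9 / 8 → ∃ (L : ℝ → ℝ) (L' : ℝ), HasDerivAt L L' t ∧
      (∀ s > 0, L s - L t ≤ V s - V t) ∧ L' ≤ -(2 * δ + ε) * V t + 2 * δ * V (t - τ t)) :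
    ∃ α > 0, ∀ t ≥ 0, V t ≤ 9 / 8 * Real.exp (-α * t) := by
  -- At α = 0 the inequality reads 2δ < 2δ + ε; continuity provides a positive α.
  obtain ⟨α, hα, hαh⟩ : ∃ α > 0, 2 * δ * Real.exp (α * h) + α < 2 * δ + ε := by
    have hc : ContinuousAt (fun α : ℝ => 2 * δ * Real.exp (α * h) + α) 0 := by fun_prop
    have h1 : ∀ᶠ α in 𝓝 (0 : ℝ), 2 * δ * Real.exp (α * h) + α < 2 * δ + ε :=
      hc.eventually_lt continuousAt_const (by simpa using hε)
    obtain ⟨α, h2, h3⟩ := ((h1.filter_mono nhdsWithin_le_nhds).and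
      (self_mem_nhdsWithin (s := Ioi (0 : ℝ)))).exists
    exact ⟨α, h3, h2⟩
  refine ⟨α, hα, fun t₁ ht₁ => ?_⟩
  by_contra hcon
  push Not at hcon
  set φ : ℝ → ℝ := fun t => 9 / 8 * Real.exp (-α * t) with hφ
  have hφc : Continuous φ := by fun_prop
  have hφpos : ∀ t, 0 < φ t := fun t => by simp only [hφ]; positivity
  have hφd : ∀ t, HasDerivAt φ (-α * φ t) t := fun t => by
    have h1 : HasDerivAt (fun t : ℝ => -α * t) (-α) t := by
      simpa only [mul_one] using (hasDerivAt_id' t).const_mul (-α)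
    exact (h1.exp.const_mul (9 / 8)).congr_deriv (by simp only [hφ]; ring)
  have hφle : ∀ t ≥ 0, φ t ≤ 9 / 8 := fun t ht => by
    have : Real.exp (-α * t) ≤ 1 := Real.exp_le_one_iff.2 (by nlinarith)
    simp only [hφ]; linarith
  set S : Set ℝ := {t ∈ Icc 0 t₁ | φ t ≤ V t} with hS
  have hVI : ContinuousOn V (Icc 0 t₁) := hV.mono Icc_subset_Ici_self
  have hSc : IsClosed S := isClosed_Icc.isClosed_le hφc.continuousOn hVI
  have hSn : S.Nonempty := ⟨t₁, ⟨ht₁, le_rfl⟩, hcon.le⟩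
  have hSb : BddBelow S := ⟨0, fun t ht => ht.1.1⟩
  -- The first contact of V with φ. It is positive because V(0) ≤ 1 < 9/8 = φ(0), and V(t₀) = φ(t₀)
  -- ≤ 9/8 makes `H` applicable.
  set t₀ := sInf S with ht₀
  have hmem : t₀ ∈ S := hSc.csInf_mem hSn hSb
  have hlt : ∀ s, 0 ≤ s → s < t₀ → V s < φ s := by
    intro s hs hst
    by_contra hns
    exact notMem_of_lt_csInf hst hSb ⟨⟨hs, hst.le.trans hmem.1.2⟩, not_lt.1 hns⟩
  have ht₀pos : 0 < t₀ := by
    refine lt_of_le_of_ne hmem.1.1 fun h => ?_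
    have h1 := hmem.2
    rw [← h] at h1
    have h2 := h0 0 ⟨by linarith, le_rfl⟩
    simp only [hφ, mul_zero, Real.exp_zero] at h1
    linarith
  have hleft : Ioo 0 t₀ ∈ 𝓝[<] t₀ := Ioo_mem_nhdsLT ht₀pos
  have hVeq : V t₀ = φ t₀ := by
    refine le_antisymm ?_ hmem.2
    have hVc : Tendsto V (𝓝[<] t₀) (𝓝 (V t₀)) :=
      ((hV t₀ ht₀pos.le).continuousAt (Ici_mem_nhds ht₀pos)).mono_left nhdsWithin_le_nhds
    have hφc' : Tendsto φ (𝓝[<] t₀) (𝓝 (φ t₀)) := hφc.continuousAt.mono_left nhdsWithin_le_nhds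
    refine le_of_tendsto_of_tendsto hVc hφc' ?_
    filter_upwards [hleft] with s hs using (hlt s hs.1.le hs.2).le
  obtain ⟨L, L', hL, hLV, hL'⟩ := H t₀ ht₀pos (hVeq.le.trans (hφle t₀ ht₀pos.le))
  have hg := hL.sub (hφd t₀)
  -- For s < t₀, L(s) - L(t₀) ≤ V(s) - V(t₀) < φ(s) - φ(t₀), so the left difference quotients of L -
  -- φ are positive: the minorant controls the slope from the required side.
  have hslope : 0 ≤ L' - -α * φ t₀ := by
    have ht := (hasDerivAt_iff_tendsto_slope.1 hg).mono_left
      (nhdsWithin_mono t₀ fun s (hs : s ∈ Iio t₀) => ne_of_lt hs)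
    refine ge_of_tendsto ht ?_
    filter_upwards [hleft] with s hs
    rw [slope_def_field]
    refine div_nonneg_of_nonpos ?_ (by linarith [hs.2])
    have h1 := hLV s hs.1
    have h2 := hlt s hs.1.le hs.2
    simp only [Pi.sub_apply]
    linarith
  have hτ₀ := hτ t₀ ht₀pos.le
  have hdel : V (t₀ - τ t₀) ≤ φ t₀ * Real.exp (α * h) := by
    have e : φ t₀ * Real.exp (α * h) = 9 / 8 * Real.exp (-α * t₀ + α * h) := by
      simp only [hφ]; rw [Real.exp_add]; ring
    -- In the history V ≤ 1, and t₀ < h makes the exponential at least 1. After time 0 the bound is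
    -- V ≤ φ, with equality when the delay vanishes.
    rcases lt_or_ge (t₀ - τ t₀) 0 with hneg | hnn
    · have h1 := h0 (t₀ - τ t₀) ⟨by linarith, hneg.le⟩
      have h2 : 1 ≤ Real.exp (-α * t₀ + α * h) := Real.one_le_exp (by nlinarith)
      rw [e]; linarith
    · have h1 : V (t₀ - τ t₀) ≤ φ (t₀ - τ t₀) := by
        rcases hτ₀.1.eq_or_lt with h | h
        · rw [← h, sub_zero]; exact hVeq.le
        · exact (hlt _ hnn (by linarith)).le
      refine h1.trans ?_
      rw [e]
      simp only [hφ]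
      have : Real.exp (-α * (t₀ - τ t₀)) ≤ Real.exp (-α * t₀ + α * h) :=
        Real.exp_le_exp.2 (by nlinarith [hτ₀.2])
      linarith
  have hp := hφpos t₀
  rw [hVeq] at hL'
  have h5 := mul_le_mul_of_nonneg_left hdel (by positivity : 0 ≤ 2 * δ)
  nlinarith

theorem inner_mv_le_of_posSemidef {n : ℕ} {X : EuclideanSpace ℝ (Fin n)} {b : ℝ}
    {P : Matrix (Fin n) (Fin n) ℝ} (h : (b • (1 : Matrix (Fin n) (Fin n) ℝ) - P).PosSemidef) :
    inner ℝ (mv P X) X ≤ b * ‖X‖ ^ 2 := by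
  have := h.dotProduct_mulVec_nonneg X.ofLp
  simp only [star_trivial, Matrix.sub_mulVec, Matrix.smul_mulVec, Matrix.one_mulVec,
    dotProduct_sub, dotProduct_smul, smul_eq_mul] at this
  rw [inner_eq_dotProduct, ofLp_mv, dotProduct_comm, ← real_inner_self_eq_norm_sq,
    inner_eq_dotProduct]
  linarith

/-! ### The matrix inequalities and the derivative of the Lyapunov functional -/

section

variable {n : ℕ} {A A₁ : Matrix (Fin n) (Fin n) ℝ} {B : Matrix (Fin n) (Fin 1) ℝ}
  {K : Matrix (Fin 1) (Fin n) ℝ} {P : Matrix (Fin n) (Fin n) ℝ}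
  {a a₂ c δ₀ δ₁ r r₁ p₁ p₂ lam lam₁ : ℝ}

theorem thetaOne_form (hP : P.IsHermitian) (X Y : EuclideanSpace ℝ (Fin n)) (s : ℝ) :
    Sum.elim X.ofLp (Sum.elim Y.ofLp fun _ : Fin 1 => s) ⬝ᵥ
      (ThetaOne A A₁ B K a a₂ c P δ₀ δ₁ r r₁ p₁ p₂ lam).mulVec
        (Sum.elim X.ofLp (Sum.elim Y.ofLp fun _ : Fin 1 => s)) =
    2 * inner ℝ (mv P X) (mv (A + B * K) X) + 2 * δ₀ * inner ℝ (mv P X) X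
      + 2 * inner ℝ (mv P X) (mv A₁ Y) + 2 * (s * inner ℝ (mv P X) (colVec B))
      - 2 * δ₁ * inner ℝ (mv P Y) Y
      + (p₁ * r⁻¹ + p₂ * r₁⁻¹) * (zeta A K a c * ‖mv (A₁ - a₂ • 1) Y‖ ^ 2) - lam * s ^ 2 := by
  have hPt : P.transpose = P := by simpa [Matrix.IsHermitian] using hP
  have hsym : ∀ v w : Fin n → ℝ, v ⬝ᵥ P.mulVec w = P.mulVec v ⬝ᵥ w := fun v w => by
    rw [Matrix.dotProduct_mulVec, ← Matrix.mulVec_transpose, hPt]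
  have htr : ∀ (M : Matrix (Fin n) (Fin n) ℝ) (v w : Fin n → ℝ),
      v ⬝ᵥ M.transpose.mulVec w = M.mulVec v ⬝ᵥ w := fun M v w => by
    rw [Matrix.dotProduct_mulVec, Matrix.vecMul_transpose]
  have hB : B.mulVec (fun _ => s) = s • (colVec B).ofLp := by
    ext i; simp [Matrix.mulVec, dotProduct, colVec, mul_comm]
  have hB' : ∀ v : Fin n → ℝ, (fun _ : Fin 1 => s) ⬝ᵥ B.transpose.mulVec v =
      s * ((colVec B).ofLp ⬝ᵥ v) := fun v => by
    simp [Matrix.mulVec, dotProduct, colVec]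
  rw [← real_inner_self_eq_norm_sq]
  simp only [inner_eq_dotProduct, ofLp_mv, ThetaOne, Xi, RMat, Matrix.add_mulVec, Matrix.smul_mulVec,
    Matrix.fromBlocks_mulVec, Sum.elim_comp_inl, Sum.elim_comp_inr, Matrix.fromCols_mulVec_sumElim,
    Matrix.fromRows_mulVec, Matrix.zero_mulVec, dotProduct_add, sumElim_dotProduct_sumElim,
    Matrix.transpose_mul, hPt, ← Matrix.mulVec_mulVec, dotProduct_smul,
    Matrix.one_mulVec, htr, hsym, hB, hB', smul_eq_mul, add_zero, zero_add,
    dotProduct_zero, neg_mul]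
  have hflip : ∀ w : Fin n → ℝ, P.mulVec w ⬝ᵥ X.ofLp = P.mulVec X.ofLp ⬝ᵥ w := fun w => by
    rw [← hsym, dotProduct_comm]
  have hs : ((fun _ : Fin 1 => s) ⬝ᵥ fun _ : Fin 1 => s) = s ^ 2 := by
    simp [dotProduct, sq]
  rw [hflip (A.mulVec X.ofLp + _), hflip (A₁.mulVec _), hflip (colVec B).ofLp, dotProduct_add, hs]
  ring

/-- The derivative of the Lyapunov functional along solutions of the target system. -/
theorem exists_lyapunov_bound {β : ℝ} (hr : 0 < r) (hr₁ : 0 < r₁) (hδ : δ₁ = δ₀) (hβ : 0 < β)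
    (hP : P.PosDef) (hp₁ : 0 < p₁) (hp₂ : 0 < p₂) (hlam : 0 < lam) (hlam₁ : 0 ≤ lam₁)
    (hΘ₁ : (-ThetaOne A A₁ B K a a₂ c P δ₀ δ₁ r r₁ p₁ p₂ lam).PosDef)
    (hΘ₂ : (-ThetaTwo a₂ c δ₀ δ₁ r r₁ p₁ p₂ lam lam₁).PosDef)
    (hke : -2 * p₁ - 2 * p₂ * c + lam + 2 * δ₀ * p₂ - Real.pi ^ 2 / 4 * lam₁ ≤ 0)
    (hPβ : (β • (1 : Matrix (Fin n) (Fin n) ℝ) - P).PosSemidef) (hp₁β : p₁ ≤ β) (hp₂β : p₂ ≤ β) :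
    ∃ ε > 0, ∀ (X Y : EuclideanSpace ℝ (Fin n)) (s : ℝ) (Z Z₁ Z₂ Zτ G : L2),
      inner ℝ Z₂ Z = -‖Z₁‖ ^ 2 → s ^ 2 ≤ 2 * ‖Z‖ ^ 2 + ‖Z₁‖ ^ 2 →
      Real.pi ^ 2 / 4 * ‖Z₁‖ ^ 2 ≤ ‖Z₂‖ ^ 2 →
      ‖G‖ ^ 2 ≤ zeta A K a c * ‖mv (A₁ - a₂ • 1) Y‖ ^ 2 →
      2 * inner ℝ (mv P X) (mv (A + B * K) X + mv A₁ Y + s • colVec B)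
        + inner ℝ ((2 * p₁) • Z - (2 * p₂) • Z₂) (Z₂ - c • Z + a₂ • Zτ - G) ≤
      -(2 * δ₀ + ε) * (inner ℝ (mv P X) X + p₁ * ‖Z‖ ^ 2 + p₂ * ‖Z₁‖ ^ 2)
        + 2 * δ₀ * (inner ℝ (mv P Y) Y + p₁ * ‖Zτ‖ ^ 2) := by
  obtain ⟨ε₁, hε₁, h₁⟩ := exists_pos_le_of_posDef hΘ₁
  obtain ⟨ε₂, hε₂, h₂⟩ := exists_pos_le_of_posDef_inner (H := L2) hΘ₂
  -- Coercivity of the two forms leaves ε₁|X|² + ε₂(‖z‖² + ‖z_xx‖²). This dominates (ε₁ ∧ ε₂)V/β,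
  -- since Wirtinger with π²/4 ≥ 1 bounds ‖z_x‖ by ‖z_xx‖.
  refine ⟨min ε₁ ε₂ / β, by positivity, fun X Y s Z Z₁ Z₂ Zτ G hZZ hs hW hG => ?_⟩
  -- The first form is evaluated at (X, X_τ, z(0)).
  have f₁ := h₁ (Sum.elim X.ofLp (Sum.elim Y.ofLp fun _ : Fin 1 => s))
  rw [Matrix.neg_mulVec, dotProduct_neg, thetaOne_form hP.1] at f₁
  simp only [sumElim_dotProduct_sumElim, ← inner_eq_dotProduct, real_inner_self_eq_norm_sq] at f₁
  -- The second form is evaluated at (z, z_τ, z_xx) in L². The terms in ‖z_x‖², from ⟨z, z_xx⟩, the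
  -- bound for z(0)² and Wirtinger, are collected by `hke`.
  have f₂ := h₂ ![Z, Zτ, Z₂]
  simp only [Fin.sum_univ_three, ThetaTwo, Matrix.neg_apply, Matrix.of_apply, Matrix.cons_val_zero,
    Matrix.cons_val_one, Matrix.cons_val, real_inner_self_eq_norm_sq] at f₂
  have hss : 0 ≤ (fun _ : Fin 1 => s) ⬝ᵥ fun _ : Fin 1 => s := by
    simp [dotProduct, mul_self_nonneg]
  have hPX := inner_mv_le_of_posSemidef (X := X) hPβ
  -- Young's inequality with weight r here and r₁ below. The ‖G‖² terms add up to the ζ-block of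
  -- `ThetaOne`, the others to the r and r₁ entries of `ThetaTwo`.
  have y₁ : -2 * inner ℝ Z G ≤ r * ‖Z‖ ^ 2 + r⁻¹ * ‖G‖ ^ 2 := by
    have := (abs_le.1 (abs_real_inner_le_norm Z G)).1
    have h2 : r * ‖Z‖ ^ 2 + r⁻¹ * ‖G‖ ^ 2 - 2 * (‖Z‖ * ‖G‖) = r⁻¹ * (r * ‖Z‖ - ‖G‖) ^ 2 := by
      field_simp; ring
    have h3 : 0 ≤ r⁻¹ * (r * ‖Z‖ - ‖G‖) ^ 2 := by positivity
    linarith only [this, h2, h3]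
  have y₂ : 2 * inner ℝ Z₂ G ≤ r₁ * ‖Z₂‖ ^ 2 + r₁⁻¹ * ‖G‖ ^ 2 := by
    have := (abs_le.1 (abs_real_inner_le_norm Z₂ G)).2
    have h2 : r₁ * ‖Z₂‖ ^ 2 + r₁⁻¹ * ‖G‖ ^ 2 - 2 * (‖Z₂‖ * ‖G‖) = r₁⁻¹ * (r₁ * ‖Z₂‖ - ‖G‖) ^ 2 := by
      field_simp; ring
    have h3 : 0 ≤ r₁⁻¹ * (r₁ * ‖Z₂‖ - ‖G‖) ^ 2 := by positivity
    linarith only [this, h2, h3]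
  have z₁ := mul_le_mul_of_nonneg_left y₁ hp₁.le
  have z₂ := mul_le_mul_of_nonneg_left y₂ hp₂.le
  have z₃ := mul_le_mul_of_nonneg_left hG (by positivity : 0 ≤ p₁ * r⁻¹ + p₂ * r₁⁻¹)
  have z₄ := mul_le_mul_of_nonneg_left hs hlam.le
  have z₅ := mul_le_mul_of_nonneg_left hW hlam₁
  have z₆ := mul_le_mul_of_nonneg_right hke (sq_nonneg ‖Z₁‖)
  have hpi : ‖Z₁‖ ^ 2 ≤ ‖Z₂‖ ^ 2 := by
    have : 1 ≤ Real.pi ^ 2 / 4 := by nlinarith [Real.pi_gt_three]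
    exact (le_mul_of_one_le_left (sq_nonneg _) this).trans hW
  have hm : min ε₁ ε₂ / β * (inner ℝ (mv P X) X + p₁ * ‖Z‖ ^ 2 + p₂ * ‖Z₁‖ ^ 2) ≤
      ε₁ * ‖X‖ ^ 2 + ε₂ * (‖Z‖ ^ 2 + ‖Z₂‖ ^ 2) := by
    have h3 : inner ℝ (mv P X) X + p₁ * ‖Z‖ ^ 2 + p₂ * ‖Z₁‖ ^ 2 ≤
        β * (‖X‖ ^ 2 + (‖Z‖ ^ 2 + ‖Z₂‖ ^ 2)) := by
      have q1 := mul_le_mul_of_nonneg_right hp₁β (sq_nonneg ‖Z‖)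
      have q2 := mul_le_mul_of_nonneg_right hp₂β (sq_nonneg ‖Z₁‖)
      have q3 := mul_le_mul_of_nonneg_left hpi hβ.le
      linarith only [q1, q2, q3, hPX]
    refine (mul_le_mul_of_nonneg_left h3 (by positivity)).trans ?_
    rw [← mul_assoc, div_mul_cancel₀ _ hβ.ne', mul_add]
    exact add_le_add (mul_le_mul_of_nonneg_right (min_le_left _ _) (sq_nonneg _))
      (mul_le_mul_of_nonneg_right (min_le_right _ _) (by positivity))
  have c₁ : inner ℝ Z Z₂ = -‖Z₁‖ ^ 2 := by rw [real_inner_comm]; exact hZZ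
  have c₂ : inner ℝ Zτ Z = inner ℝ Z Zτ := real_inner_comm _ _
  have c₃ : inner ℝ Z₂ Zτ = inner ℝ Zτ Z₂ := real_inner_comm _ _
  have n1 := mul_nonneg hε₁.le (sq_nonneg ‖Y‖)
  have n2 := mul_nonneg hε₁.le hss
  have n3 := mul_nonneg hε₂.le (sq_nonneg ‖Zτ‖)
  have e : inner ℝ ((2 * p₁) • Z - (2 * p₂) • Z₂) (Z₂ - c • Z + a₂ • Zτ - G) =
      2 * p₁ * (-‖Z₁‖ ^ 2 - c * ‖Z‖ ^ 2 + a₂ * inner ℝ Z Zτ - inner ℝ Z G)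
        - 2 * p₂ * (‖Z₂‖ ^ 2 + c * ‖Z₁‖ ^ 2 + a₂ * inner ℝ Zτ Z₂ - inner ℝ Z₂ G) := by
    rw [inner_sub_left, real_inner_smul_left, real_inner_smul_left, inner_sub_right,
      inner_add_right, inner_sub_right, inner_sub_right, inner_add_right, inner_sub_right,
      real_inner_smul_right, real_inner_smul_right, real_inner_smul_right, real_inner_smul_right,
      real_inner_self_eq_norm_sq, real_inner_self_eq_norm_sq, hZZ, c₁, c₃]
    ring
  have e' : inner ℝ (mv P X) (mv (A + B * K) X + mv A₁ Y + s • colVec B) =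
      inner ℝ (mv P X) (mv (A + B * K) X) + inner ℝ (mv P X) (mv A₁ Y)
        + s * inner ℝ (mv P X) (colVec B) := by
    rw [inner_add_right, inner_add_right, real_inner_smul_right]
  rw [e, e']
  rw [c₁, hZZ, c₂, c₃] at f₂
  clear h₁ h₂ hΘ₁ hΘ₂ hPβ hP e e' c₁ c₂ c₃ hZZ hs hW hG hpi hss y₁ y₂ hPX hke
  generalize (inner ℝ (mv P X) (mv (A + B * K) X) : ℝ) = i₁ at *
  generalize (inner ℝ (mv P X) (mv A₁ Y) : ℝ) = i₂ at *
  generalize (inner ℝ (mv P X) (colVec B) : ℝ) = i₃ at *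
  generalize (inner ℝ (mv P X) X : ℝ) = i₄ at *
  generalize (inner ℝ (mv P Y) Y : ℝ) = i₅ at *
  generalize (inner ℝ Z Zτ : ℝ) = i₆ at *
  generalize (inner ℝ Zτ Z₂ : ℝ) = i₇ at *
  generalize (inner ℝ Z G : ℝ) = i₈ at *
  generalize (inner ℝ Z₂ G : ℝ) = i₉ at *
  generalize ‖Z‖ ^ 2 = j₁ at *
  generalize ‖Z₁‖ ^ 2 = j₂ at *
  generalize ‖Z₂‖ ^ 2 = j₃ at *
  generalize ‖Zτ‖ ^ 2 = j₄ at *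
  generalize ‖G‖ ^ 2 = j₅ at *
  generalize ‖X‖ ^ 2 = j₆ at *
  generalize ‖Y‖ ^ 2 = j₇ at *
  generalize ‖mv (A₁ - a₂ • 1) Y‖ ^ 2 = j₈ at *
  generalize min ε₁ ε₂ / β = η at *
  generalize zeta A K a c = z at *
  generalize Real.pi ^ 2 / 4 = w at *
  generalize (fun _ : Fin 1 => s) ⬝ᵥ (fun _ : Fin 1 => s) = j₉ at *
  subst hδ
  linarith

end

/-! ### Regularity, the Lyapunov functional and its tangent -/

theorem MemH2.h2 {f : ℝ → ℝ} (hf : MemH2 f) : H2 f (dx f) (dx (dx f)) where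
  prim := Prim.of_hasDerivWithinAt (fun x hx => (hf.1 x hx).hasDerivWithinAt) (by
    have := hf.2.1.continuousOn
    rwa [uIcc_of_le zero_le_one] at this)
  prim₁ := by
    refine ⟨hf.2.1, ?_⟩
    refine ae_vol01_iff.2 ?_
    filter_upwards [hf.2.1.ae_differentiableAt] with x hx hx01
    have hd := hx (by rw [uIcc_of_le zero_le_one]; exact Ioo_subset_Icc_self hx01)
    have : dx (dx f) x = deriv (dx f) x :=
      derivWithin_of_mem_nhds (Icc_mem_nhds hx01.1 hx01.2)
    rw [this]
    exact hd.hasDerivAt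
  sq := hf.2.2

theorem dx_congr {f g : ℝ → ℝ} (h : EqOn f g (Icc 0 1)) : EqOn (dx f) (dx g) (Icc 0 1) :=
  fun _ hx => derivWithin_congr h (h hx)

theorem MemH2.congr {f g : ℝ → ℝ} (hf : MemH2 f) (h : EqOn f g (Icc 0 1)) : MemH2 g :=
  ⟨hf.1.congr fun _ hx => (h hx).symm, absolutelyContinuous_congr (dx_congr h) hf.2.1,
    hf.2.2.ae_eq (ae_vol01_of_forall fun _ hx => dx_congr (dx_congr h) (Ioo_subset_Icc_self hx))⟩

section

variable {n : ℕ} {A : Matrix (Fin n) (Fin n) ℝ} {B : Matrix (Fin n) (Fin 1) ℝ}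
  {K : Matrix (Fin 1) (Fin n) ℝ} {a c : ℝ} {f f₁ f₂ g g₁ g₂ : ℝ → ℝ}
  (X Y : EuclideanSpace ℝ (Fin n))

theorem wTrans_sub (hf : Sq f) (hg : Sq g) {x : ℝ} (hx : x ∈ Icc (0 : ℝ) 1) :
    wTrans A B K a (X - Y) (fun y => f y - g y) x =
      wTrans A B K a X f x - wTrans A B K a Y g x := by
  rw [wTrans_eq, wTrans_eq, wTrans_eq, volt_sub (continuous_kKer A B K a) hf hg hx,
    inner_sub_right]
  ring

theorem wTrans₁_sub (hf : Sq f) (hg : Sq g) {x : ℝ} (hx : x ∈ Icc (0 : ℝ) 1) :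
    wTrans₁ A B K a (X - Y) (fun y => f y - g y) (fun y => f₁ y - g₁ y) x =
      wTrans₁ A B K a X f f₁ x - wTrans₁ A B K a Y g g₁ x := by
  rw [wTrans₁, wTrans₁, wTrans₁, volt_sub (continuous_kKer₁ A B K a) hf hg hx, inner_sub_right]
  ring

theorem sq_zTrans₁ (hf : Prim f f₁) (hf₁ : Sq f₁) : Sq (zTrans₁ A B K a c X f f₁) := by
  have sf := sq_of_continuousOn hf.continuousOn
  have hq : Continuous fun x => qKer a c x x := by
    rw [qKer_eq_bKer]; exact (continuous_bKer (a + c)).comp (continuous_id.prodMk continuous_id)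
  exact ((hf₁.sub (sq_volt (continuous_kKer₁ A B K a) sf)).sub (sq_of_continuousOn
      ((continuous_gam₁ A K a).inner continuous_const).continuousOn)).sub
    ((sq_of_continuousOn (hq.continuousOn.mul (continuousOn_wTrans X hf.continuousOn))).add
      (sq_volt (continuous_bKer₁ (a + c)) (sq_wTrans X sf)))

theorem zTrans₁_sub (hf : Sq f) (hg : Sq g) {x : ℝ} (hx : x ∈ Icc (0 : ℝ) 1) :
    zTrans₁ A B K a c (X - Y) (fun y => f y - g y) (fun y => f₁ y - g₁ y) x =
      zTrans₁ A B K a c X f f₁ x - zTrans₁ A B K a c Y g g₁ x := by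
  rw [zTrans₁, zTrans₁, zTrans₁, wTrans₁_sub X Y hf hg hx, wTrans_sub X Y hf hg hx,
    volt_congr (fun y hy => wTrans_sub X Y hf hg (Ioo_subset_Icc_self hy)) hx,
    volt_sub (continuous_bKer₁ _) (sq_wTrans X hf) (sq_wTrans Y hg) hx]
  ring

variable {X Y} in
theorem norm_toL2_zTrans₁_sub_sq_le (hf : H2 f f₁ f₂) (hg : H2 g g₁ g₂) :
    ‖toL2 (zTrans₁ A B K a c X f f₁) - toL2 (zTrans₁ A B K a c Y g g₁)‖ ^ 2 ≤
      MOne A K a c * ‖X - Y‖ ^ 2 + MTwo A B K a c * ‖toL2 f - toL2 g‖ ^ 2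
        + 4 * ‖toL2 f₁ - toL2 g₁‖ ^ 2 := by
  have h := norm_zTrans_sq_le (A := A) (B := B) (K := K) (a := a) (c := c) (X - Y)
    (hf.prim.sub hg.prim) (hf.sq_one.sub hg.sq_one)
  rw [toL2_sub hf.sq_zero hg.sq_zero, toL2_sub hf.sq_one hg.sq_one,
    toL2_congr fun x hx => zTrans₁_sub X Y hf.sq_zero hg.sq_zero (Ioo_subset_Icc_self hx),
    toL2_sub (sq_zTrans₁ X hf.prim hf.sq_one)
      (sq_zTrans₁ Y hg.prim hg.sq_one)] at h
  linarith [sq_nonneg ‖X - Y‖, sq_nonneg ‖toL2 (zTrans A B K a c (X - Y) fun y => f y - g y)‖]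

/-- The Lyapunov functional. -/
def lyap (A : Matrix (Fin n) (Fin n) ℝ) (B : Matrix (Fin n) (Fin 1) ℝ)
    (K : Matrix (Fin 1) (Fin n) ℝ) (a c : ℝ) (P : Matrix (Fin n) (Fin n) ℝ) (p₁ p₂ : ℝ)
    (X : EuclideanSpace ℝ (Fin n)) (f f₁ : ℝ → ℝ) : ℝ :=
  inner ℝ (mv P X) X + p₁ * ‖toL2 (zTrans A B K a c X f)‖ ^ 2
    + p₂ * ‖toL2 (zTrans₁ A B K a c X f f₁)‖ ^ 2

variable {P : Matrix (Fin n) (Fin n) ℝ} {p₁ p₂ : ℝ} {X}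

theorem lyap_le {β : ℝ} (hβ : 0 ≤ β) (hPβ : (β • (1 : Matrix (Fin n) (Fin n) ℝ) - P).PosSemidef)
    (hp₁β : p₁ ≤ β) (hp₂β : p₂ ≤ β) (hf : Prim f f₁) (hf₁ : Sq f₁) :
    lyap A B K a c P p₁ p₂ X f f₁ ≤
      β * (MOne A K a c * ‖X‖ ^ 2 + MTwo A B K a c * ‖toL2 f‖ ^ 2 + 4 * ‖toL2 f₁‖ ^ 2) := by
  have h := norm_zTrans_sq_le (A := A) (B := B) (K := K) (a := a) (c := c) X hf hf₁
  refine le_trans ?_ (mul_le_mul_of_nonneg_left h hβ)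
  have h1 := inner_mv_le_of_posSemidef (X := X) hPβ
  have h2 := mul_le_mul_of_nonneg_right hp₁β (sq_nonneg ‖toL2 (zTrans A B K a c X f)‖)
  have h3 := mul_le_mul_of_nonneg_right hp₂β (sq_nonneg ‖toL2 (zTrans₁ A B K a c X f f₁)‖)
  rw [lyap]
  linarith

/-- The feedback does not saturate on a sublevel set of the Lyapunov functional. -/
theorem feedback_sq_le_lyap {ubar : ℝ}
    (hPu : ((ubar ^ 2 / 3) • P - cOne A B K a ^ 2 • (1 : Matrix (Fin n) (Fin n) ℝ)).PosSemidef)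
    (hp₁u : 0 ≤ p₁ * (ubar ^ 2 / 3) - cTwo A B K a c ^ 2)
    (hp₂u : 0 ≤ p₂ * (ubar ^ 2 / 3) - cThree a c ^ 2) (hf : H2 f f₁ f₂) (h0 : f₁ 0 = 0) :
    feedback A B K a c X f ^ 2 ≤ 7 / 9 * ubar ^ 2 * lyap A B K a c P p₁ p₂ X f f₁ := by
  refine (feedback_sq_le X hf h0).trans ?_
  have h1 : cOne A B K a ^ 2 * ‖X‖ ^ 2 ≤ ubar ^ 2 / 3 * inner ℝ (mv P X) X := by
    have := hPu.dotProduct_mulVec_nonneg X.ofLp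
    simp only [star_trivial, Matrix.sub_mulVec, Matrix.smul_mulVec, Matrix.one_mulVec,
      dotProduct_sub, dotProduct_smul, smul_eq_mul] at this
    rw [inner_eq_dotProduct, ofLp_mv, dotProduct_comm, ← real_inner_self_eq_norm_sq,
      inner_eq_dotProduct]
    linarith
  have h2 := mul_nonneg hp₁u (sq_nonneg ‖toL2 (zTrans A B K a c X f)‖)
  have h3 := mul_nonneg hp₂u (sq_nonneg ‖toL2 (zTrans₁ A B K a c X f f₁)‖)
  rw [lyap]
  linarith

/-- z_x depends linearly on (X, u), so the bound with weights M₁, M₂, 4 applies to differences of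
states and gives continuity in time from that of the ℝⁿ × H¹ data. -/
theorem continuousOn_zTrans₁ {X : ℝ → EuclideanSpace ℝ (Fin n)} {u : ℝ → ℝ → ℝ} {s : Set ℝ}
    (hu : ∀ t ∈ s, H2 (u t) (dx (u t)) (dx (dx (u t)))) (cX : ContinuousOn X s)
    (cu : ContinuousOn (fun t => toL2 (u t)) s) (cux : ContinuousOn (fun t => toL2 (dx (u t))) s) :
    ContinuousOn (fun t => toL2 (zTrans₁ A B K a c (X t) (u t) (dx (u t)))) s := by
  intro t ht
  have c1 : ∀ {H : Type} [NormedAddCommGroup H] {F : ℝ → H}, ContinuousOn F s →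
      Tendsto (fun r => ‖F r - F t‖ ^ 2) (𝓝[s] t) (𝓝 0) := fun {H _ F} hF => by
    have := (((hF t ht).sub (continuousWithinAt_const (b := F t))).norm).pow 2
    simpa [ContinuousWithinAt, Function.comp_def, Pi.pow_def] using this
  have h1 := (((c1 cX).const_mul (MOne A K a c)).add ((c1 cu).const_mul (MTwo A B K a c))).add
    ((c1 cux).const_mul 4)
  simp only [mul_zero, add_zero] at h1
  have h2 := h1.sqrt
  rw [Real.sqrt_zero] at h2
  rw [ContinuousWithinAt, tendsto_iff_norm_sub_tendsto_zero]
  refine squeeze_zero' (Eventually.of_forall fun _ => norm_nonneg _) ?_ h2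
  filter_upwards [self_mem_nhdsWithin] with r hr
  exact Real.le_sqrt_of_sq_le (norm_toL2_zTrans₁_sub_sq_le (hu r hr) (hu t ht))

theorem MOne_nonneg (A : Matrix (Fin n) (Fin n) ℝ) (K : Matrix (Fin 1) (Fin n) ℝ) (a c : ℝ) :
    0 ≤ MOne A K a c := by
  have : 0 ≤ segMax fun x => ‖deriv (gam A K a) x‖ ^ 2 := by
    refine Real.sSup_nonneg ?_
    rintro _ ⟨x, _, rfl⟩
    positivity
  rw [MOne]; positivity

theorem MTwo_nonneg (A : Matrix (Fin n) (Fin n) ℝ) (B : Matrix (Fin n) (Fin 1) ℝ)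
    (K : Matrix (Fin 1) (Fin n) ℝ) (a c : ℝ) : 0 ≤ MTwo A B K a c := by
  rw [MTwo]; positivity

theorem sat_eq_self {U ubar : ℝ} (h : |U| ≤ ubar) : sat U ubar = U := by
  rw [sat, min_eq_left h]
  rcases lt_trichotomy U 0 with h | rfl | h
  · rw [Real.sign_of_neg h, abs_of_neg h]; ring
  · simp
  · rw [Real.sign_of_pos h, abs_of_pos h]; ring

/-- The gap between the two sides is ‖w - v‖². -/
theorem norm_sq_sub_ge {H : Type*} [NormedAddCommGroup H] [InnerProductSpace ℝ H] (v w : H) :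
    2 * inner ℝ v (w - v) ≤ ‖w‖ ^ 2 - ‖v‖ ^ 2 := by
  have h := norm_sub_sq_real w v
  have h2 := sq_nonneg ‖w - v‖
  rw [inner_sub_right, real_inner_self_eq_norm_sq, real_inner_comm]
  linarith

theorem inner_mv_nonneg (hP : P.PosSemidef) (X : EuclideanSpace ℝ (Fin n)) :
    0 ≤ inner ℝ (mv P X) X := by
  have := hP.dotProduct_mulVec_nonneg X.ofLp
  rwa [star_trivial, dotProduct_comm, ← ofLp_mv, ← inner_eq_dotProduct] at this

theorem inner_mv_sub_ge (hP : P.PosSemidef) (v w : EuclideanSpace ℝ (Fin n)) :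
    2 * inner ℝ (mv P v) (w - v) ≤ inner ℝ (mv P w) w - inner ℝ (mv P v) v := by
  have hs : inner ℝ (mv P w) v = inner ℝ (mv P v) w := by
    have : P.transpose = P := by simpa [Matrix.IsHermitian] using hP.1
    rw [real_inner_comm, ← inner_mv_transpose, this]
  have h := inner_mv_nonneg hP (w - v)
  rw [map_sub, inner_sub_left, inner_sub_right, inner_sub_right, hs] at h
  rw [inner_sub_right]
  linarith

/-- The Lyapunov functional lies above its tangent, written without second state derivatives of
the varying state. -/
theorem lyap_sub_ge (hP : P.PosSemidef) (hp₁ : 0 ≤ p₁) (hp₂ : 0 ≤ p₂) (hf : H2 f f₁ f₂)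
    (hg : H2 g g₁ g₂) (h0 : f₁ 0 = 0) (h1 : zTrans₁ A B K a c X f f₁ 1 = 0) :
    2 * inner ℝ (mv P X) (Y - X)
      + inner ℝ ((2 * p₁) • toL2 (zTrans A B K a c X f) - (2 * p₂) • toL2 (fun x =>
          zTrans A B K a c (mv (A - a • 1) X + f 0 • colVec B) f₂ x
            + (a + c) * zTrans A B K a c X f x))
        (toL2 (zTrans A B K a c Y g) - toL2 (zTrans A B K a c X f)) ≤
      lyap A B K a c P p₁ p₂ Y g g₁ - lyap A B K a c P p₁ p₂ X f f₁ := by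
  have hz := h2_zTrans (A := A) (B := B) (K := K) (a := a) (c := c) X hf h0
  have pz := prim_zTrans (A := A) (B := B) (K := K) (a := a) (c := c) Y hg.prim
  have hz0 := zTrans₁_zero (A := A) (B := B) (K := K) (a := a) (c := c) (f := f) X h0
  -- The inner product of z_x at the base state with the other z_x becomes one of z_xx with z. The
  -- Neumann conditions are needed at the base state only.
  have e1 := hz.inner_second pz (sq_zTrans₁ Y hg.prim hg.sq_one) hz0 h1
  have e2 := hz.inner_second hz.prim hz.sq_one hz0 h1
  have q0 := inner_mv_sub_ge hP X Y
  have q1 := mul_le_mul_of_nonneg_left (norm_sq_sub_ge (toL2 (zTrans A B K a c X f))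
    (toL2 (zTrans A B K a c Y g))) hp₁
  have q2 := mul_le_mul_of_nonneg_left (norm_sq_sub_ge (toL2 (zTrans₁ A B K a c X f f₁))
    (toL2 (zTrans₁ A B K a c Y g g₁))) hp₂
  rw [inner_sub_right] at q2
  rw [inner_sub_left, real_inner_smul_left, real_inner_smul_left,
    inner_sub_right (toL2 fun x => zTrans A B K a c (mv (A - a • 1) X + f 0 • colVec B) f₂ x
            + (a + c) * zTrans A B K a c X f x), e1, e2, lyap, lyap]
  linarith

-- At x = 0 the Volterra terms vanish and γ(0) = K. Hence B u(0) = BKX + B z(0), which turns A into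
-- A + BK.
variable (A B K a c f X) in
theorem apply_zero_eq :
    f 0 = zTrans A B K a c X f 0 + inner ℝ (rowVec K) X := by
  rw [zTrans, bTrans, volt_zero_right, wTrans_eq, volt_zero_right, gam, rowKernel_zero]
  ring

end

/-! ### The target system -/

section

variable {n : ℕ} {A A₁ : Matrix (Fin n) (Fin n) ℝ} {B : Matrix (Fin n) (Fin 1) ℝ}
  {K : Matrix (Fin 1) (Fin n) ℝ} {a a₂ c : ℝ} {f f₁ f₂ g : ℝ → ℝ}
  (X Y : EuclideanSpace ℝ (Fin n))

theorem mv_sub_smul_one (D : Matrix (Fin n) (Fin n) ℝ) (b : ℝ) :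
    mv (D - b • 1) X = mv D X - b • X := by
  apply WithLp.ofLp_injective
  simp only [ofLp_mv, WithLp.ofLp_sub, WithLp.ofLp_smul, Matrix.sub_mulVec, Matrix.smul_mulVec,
    Matrix.one_mulVec]

theorem mv_add_apply (D E : Matrix (Fin n) (Fin n) ℝ) : mv (D + E) X = mv D X + mv E X := by
  apply WithLp.ofLp_injective
  simp only [ofLp_mv, WithLp.ofLp_add, Matrix.add_mulVec]

theorem sq_zTrans (hf : Sq f) : Sq (zTrans A B K a c X f) := sq_bTrans (sq_wTrans X hf)

/-- The target equation for `z`, in `L²(0,1)`. -/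
theorem zU_generator (hf : H2 f f₁ f₂) (hg : Sq g) :
    zU A B K a c (toL2 fun x => f₂ x + a₂ * g x + a * f x)
      - zX A K a c (mv A X + mv A₁ Y + f 0 • colVec B) =
    toL2 (fun x => zTrans A B K a c (mv (A - a • 1) X + f 0 • colVec B) f₂ x
        + (a + c) * zTrans A B K a c X f x) - c • toL2 (zTrans A B K a c X f)
      + a₂ • toL2 (zTrans A B K a c Y g) - zX A K a c (mv (A₁ - a₂ • 1) Y) := by
  have s1 : Sq fun x => a₂ * g x := hg.const_mul a₂
  have s2 : Sq fun x => a * f x := hf.sq_zero.const_mul a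
  have s4 : Sq fun x => f₂ x + a₂ * g x := hf.sq.add s1
  have s3 : Sq fun x => (a + c) * zTrans A B K a c X f x := (sq_zTrans X hf.sq_zero).const_mul _
  rw [toL2_add s4 s2, toL2_add hf.sq s1, toL2_const_mul _ hg,
    toL2_const_mul _ hf.sq_zero, toL2_add (sq_zTrans _ hf.sq) s3,
    toL2_const_mul _ (sq_zTrans X hf.sq_zero), toL2_zTrans _ hf.sq, toL2_zTrans _ hf.sq_zero,
    toL2_zTrans _ hg, mv_sub_smul_one, mv_sub_smul_one]
  simp only [map_add, map_sub, map_smul]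
  module

end

/-- V dominates positive multiples of |X|², ‖z‖² and ‖z_x‖², and the inverse transformation is
bounded. -/
theorem tendsto_normH1_of_lyap {n : ℕ} {A : Matrix (Fin n) (Fin n) ℝ} {B : Matrix (Fin n) (Fin 1) ℝ}
    {K : Matrix (Fin 1) (Fin n) ℝ} {a c : ℝ} {P : Matrix (Fin n) (Fin n) ℝ} {p₁ p₂ : ℝ}
    (hP : P.PosDef) (hp₁ : 0 < p₁) (hp₂ : 0 < p₂)
    {X : ℝ → EuclideanSpace ℝ (Fin n)} {u : ℝ → ℝ → ℝ}
    (hu : ∀ᶠ t in atTop, H2 (u t) (dx (u t)) (dx (dx (u t))) ∧ dx (u t) 0 = 0)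
    (hV : Tendsto (fun t => lyap A B K a c P p₁ p₂ (X t) (u t) (dx (u t))) atTop (𝓝 0)) :
    Tendsto (fun t => normH1 (X t) (u t)) atTop (𝓝 0) := by
  obtain ⟨ε, hε, hPε⟩ := exists_pos_le_of_posDef hP
  obtain ⟨C, hC, hb⟩ := exists_norm_le_zTrans A B K a c
  have hPX : ∀ v : EuclideanSpace ℝ (Fin n), ε * ‖v‖ ^ 2 ≤ inner ℝ (mv P v) v := fun v => by
    have := hPε v.ofLp
    rwa [dotProduct_comm v.ofLp (P.mulVec _), ← ofLp_mv, ← inner_eq_dotProduct,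
      ← inner_eq_dotProduct, real_inner_self_eq_norm_sq] at this
  have aux : ∀ (q : ℝ) (F : ℝ → ℝ), 0 < q → (∀ t, 0 ≤ F t) →
      (∀ t, q * F t ^ 2 ≤ lyap A B K a c P p₁ p₂ (X t) (u t) (dx (u t))) →
      Tendsto F atTop (𝓝 0) := fun q F hq hF h => by
    have h1 : Tendsto (fun t => Real.sqrt (q⁻¹ * lyap A B K a c P p₁ p₂ (X t) (u t) (dx (u t))))
        atTop (𝓝 0) := by
      have := (hV.const_mul q⁻¹).sqrt
      rwa [mul_zero, Real.sqrt_zero] at this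
    refine squeeze_zero hF (fun t => ?_) h1
    refine Real.le_sqrt_of_sq_le ?_
    rw [← div_eq_inv_mul, le_div_iff₀ hq, mul_comm]
    exact h t
  have hsq : ∀ t, ε * ‖X t‖ ^ 2 + p₁ * ‖toL2 (zTrans A B K a c (X t) (u t))‖ ^ 2
      + p₂ * ‖toL2 (zTrans₁ A B K a c (X t) (u t) (dx (u t)))‖ ^ 2 ≤
      lyap A B K a c P p₁ p₂ (X t) (u t) (dx (u t)) := fun t => by
    rw [lyap]; linarith [hPX (X t)]
  have n1 : ∀ t, 0 ≤ ε * ‖X t‖ ^ 2 := fun t => by positivity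
  have n2 : ∀ t, 0 ≤ p₁ * ‖toL2 (zTrans A B K a c (X t) (u t))‖ ^ 2 := fun t => by positivity
  have n3 : ∀ t, 0 ≤ p₂ * ‖toL2 (zTrans₁ A B K a c (X t) (u t) (dx (u t)))‖ ^ 2 := fun t => by
    positivity
  have t1 := aux ε (fun t => ‖X t‖) hε (fun _ => norm_nonneg _) fun t => by
    linarith [hsq t, n1 t, n2 t, n3 t]
  have t2 := aux p₁ (fun t => ‖toL2 (zTrans A B K a c (X t) (u t))‖) hp₁
    (fun _ => norm_nonneg _) fun t => by linarith [hsq t, n1 t, n2 t, n3 t]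
  have t3 := aux p₂ (fun t => ‖toL2 (zTrans₁ A B K a c (X t) (u t) (dx (u t)))‖) hp₂
    (fun _ => norm_nonneg _) fun t => by linarith [hsq t, n1 t, n2 t, n3 t]
  have t4 := ((t1.add t2).add t3).const_mul C
  rw [add_zero, add_zero, mul_zero] at t4
  have t5 : Tendsto (fun t => ‖toL2 (u t)‖) atTop (𝓝 0) :=
    squeeze_zero' (Eventually.of_forall fun _ => norm_nonneg _)
      (hu.mono fun t ht => (hb _ _ _ _ ht.1 ht.2).1) t4
  have t6 : Tendsto (fun t => ‖toL2 (dx (u t))‖) atTop (𝓝 0) :=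
    squeeze_zero' (Eventually.of_forall fun _ => norm_nonneg _)
      (hu.mono fun t ht => (hb _ _ _ _ ht.1 ht.2).2) t4
  have t7 := (((t1.pow 2).add (t5.pow 2)).add (t6.pow 2)).sqrt
  simpa [normH1] using t7

end HeatODE

end

/-! ### Decay of the closed loop -/

open HeatODE
theorem mainTheorem4 {n : ℕ}
    (A A₁ : Matrix (Fin n) (Fin n) ℝ) (B : Matrix (Fin n) (Fin 1) ℝ)
    (K : Matrix (Fin 1) (Fin n) ℝ) (a a₂ c ubar β : ℝ) (hubar : 0 < ubar) (hβ : 0 < β)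
    (r r₁ δ₀ δ₁ : ℝ) (hr : 0 < r) (hr₁ : 0 < r₁) (hr₁' : r₁ < 2) (hδ₁ : 0 < δ₁) (hδ : δ₁ = δ₀)
    (P : Matrix (Fin n) (Fin n) ℝ) (p₁ p₂ lam lam₁ : ℝ)
    (hP : P.PosDef) (hp₁ : 0 < p₁) (hp₂ : 0 < p₂) (hlam : 0 < lam) (hlam₁ : 0 ≤ lam₁)
    (hΘ₁ : (-ThetaOne A A₁ B K a a₂ c P δ₀ δ₁ r r₁ p₁ p₂ lam).PosDef)
    (hΘ₂ : (-ThetaTwo a₂ c δ₀ δ₁ r r₁ p₁ p₂ lam lam₁).PosDef)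
    (hke : -2 * p₁ - 2 * p₂ * c + lam + 2 * δ₀ * p₂ - Real.pi ^ 2 / 4 * lam₁ ≤ 0)
    (hPβ : (β • (1 : Matrix (Fin n) (Fin n) ℝ) - P).PosSemidef) (hp₁β : p₁ ≤ β) (hp₂β : p₂ ≤ β)
    (hPu : ((ubar ^ 2 / 3) • P - cOne A B K a ^ 2 • (1 : Matrix (Fin n) (Fin n) ℝ)).PosSemidef)
    (hp₁u : 0 ≤ p₁ * (ubar ^ 2 / 3) - cTwo A B K a c ^ 2)
    (hp₂u : 0 ≤ p₂ * (ubar ^ 2 / 3) - cThree a c ^ 2)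
    (h₀ h : ℝ) (hh₀ : 0 < h₀) (hh : 0 < h)
    (τ : ℝ → ℝ) (hτ : ContDiffOn ℝ 1 τ (Ici 0)) (hτ_bd : ∀ t ≥ 0, h₀ ≤ τ t ∧ τ t ≤ h)
    (X₀ : ℝ → EuclideanSpace ℝ (Fin n)) (u₀ : ℝ → ℝ → ℝ) (hX₀ : MemXu A B K a c h β X₀ u₀)
    (X : ℝ → EuclideanSpace ℝ (Fin n)) (u : ℝ → ℝ → ℝ)
    (hsol : IsClassicalSolution A A₁ B K a a₂ c ubar h τ X₀ u₀ X u) :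
    Tendsto (fun t => normH1 (X t) (u t)) atTop (𝓝 0) := by
  obtain ⟨ε, hε, hbound⟩ := exists_lyapunov_bound (A := A) (A₁ := A₁) (B := B) (K := K) (a := a)
    (a₂ := a₂) (c := c) hr hr₁ hδ hβ hP hp₁ hp₂ hlam hlam₁ hΘ₁ hΘ₂ hke hPβ hp₁β hp₂β
  have heq : ∀ θ ∈ Icc (-h) 0, EqOn (u₀ θ) (u θ) (Icc 0 1) := fun θ hθ x hx =>
    (hsol.init_u θ hθ x hx).symm
  -- Delayed arguments reach into the history, so regularity is needed on all of [-h, ∞). At t ≤ 0,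
  -- including t = 0, it comes from the initial functions.
  have hreg : ∀ t ≥ -h, H2 (u t) (dx (u t)) (dx (dx (u t))) ∧ dx (u t) 0 = 0 := fun t ht => by
    rcases lt_or_ge 0 t with h1 | h1
    · exact ⟨(hsol.mem_H2 t h1).h2, hsol.bc_zero t h1⟩
    · obtain ⟨d1, d2, -⟩ := hX₀.1.dom t ⟨ht, h1⟩
      exact ⟨(d1.congr (heq t ⟨ht, h1⟩)).h2,
        (dx_congr (heq t ⟨ht, h1⟩) (left_mem_Icc.2 zero_le_one)).symm.trans d2⟩
  have hreg0 : ∀ t ≥ 0, H2 (u t) (dx (u t)) (dx (dx (u t))) := fun t ht =>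
    (hreg t (by linarith [show (0 : ℝ) ≤ t from ht])).1
  set Z : ℝ → L2 := fun t => toL2 (zTrans A B K a c (X t) (u t)) with hZ
  set Z₁ : ℝ → L2 := fun t => toL2 (zTrans₁ A B K a c (X t) (u t) (dx (u t))) with hZ₁
  set V : ℝ → ℝ := fun t => lyap A B K a c P p₁ p₂ (X t) (u t) (dx (u t)) with hVdef
  have hZeq : ∀ t ≥ -h, Z t = zU A B K a c (toL2 (u t)) - zX A K a c (X t) := fun t ht =>
    toL2_zTrans _ (hreg t ht).1.sq_zero
  have hV1 : ∀ t ∈ Icc (-h) 0, V t ≤ 1 := fun t ht => by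
    obtain ⟨W, hW⟩ := hX₀
    have H := (hreg t ht.1).1
    refine (lyap_le hβ.le hPβ hp₁β hp₂β H.prim H.sq_one).trans ?_
    -- V is at most β times the weighted norm that the initial set bounds by 1/β.
    refine (mul_le_mul_of_nonneg_left (le_trans ?_ hW) hβ.le).trans_eq (mul_inv_cancel₀ hβ.ne')
    rw [hsol.init_X t ht, ← toL2_congr fun x hx => heq t ht (Ioo_subset_Icc_self hx),
      ← toL2_congr fun x hx => dx_congr (heq t ht) (Ioo_subset_Icc_self hx)]
    have b1 := le_histMax (f := fun θ => ‖X₀ θ‖ ^ 2) (W.diff_X.continuousOn.norm.pow 2) ht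
    have b2 := le_histMax (f := fun θ => ‖toL2 (u₀ θ)‖ ^ 2) (W.diff_u.continuousOn.norm.pow 2) ht
    have b3 := le_histMax (f := fun θ => ‖toL2 (dx (u₀ θ))‖ ^ 2)
      (W.diff_ux.continuousOn.norm.pow 2) ht
    have m1 : 0 ≤ MOne A K a c := MOne_nonneg A K a c
    have m2 : 0 ≤ MTwo A B K a c := MTwo_nonneg A B K a c
    have := mul_le_mul_of_nonneg_left b1 m1
    have := mul_le_mul_of_nonneg_left b2 m2
    linarith
  have hZc : ContinuousOn Z (Ici 0) :=
    (((zU A B K a c).continuous.comp_continuousOn hsol.cont_u).sub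
      ((zX A K a c).continuous.comp_continuousOn hsol.cont_X)).congr fun t ht =>
        hZeq t (by linarith [show (0 : ℝ) ≤ t from ht])
  have hZ₁c : ContinuousOn Z₁ (Ici 0) := continuousOn_zTrans₁ hreg0 hsol.cont_X hsol.cont_u
    hsol.cont_ux
  have hVc : ContinuousOn V (Ici 0) :=
    ((((mv P).continuous.comp_continuousOn hsol.cont_X).inner hsol.cont_X).add
      (continuousOn_const.mul (hZc.norm.pow 2))).add (continuousOn_const.mul (hZ₁c.norm.pow 2))
  have hδ₀ : 0 < δ₀ := hδ ▸ hδ₁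
  obtain ⟨α, hα, hdecay⟩ := halanay (V := V) (τ := τ) hδ₀ hε hVc hh hV1
    (fun t ht => ⟨hh₀.le.trans (hτ_bd t ht).1, (hτ_bd t ht).2⟩) fun t ht hVt => by
      have htτ : t - τ t ≥ -h := by linarith [(hτ_bd t ht.le).2]
      have H := hreg0 t ht.le
      have h0 := hsol.bc_zero t ht
      have Hτ := (hreg _ htτ).1
      have hz := h2_zTrans (A := A) (B := B) (K := K) (a := a) (c := c) (X t) H h0
      have hsat : zTrans₁ A B K a c (X t) (u t) (dx (u t)) 1 = 0 := by
        have hU := feedback_sq_le_lyap (X := X t) hPu hp₁u hp₂u H h0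
        -- (7/9)(9/8) = 7/8 < 1.
        have hU2 : feedback A B K a c (X t) (u t) ^ 2 ≤ ubar ^ 2 := by
          have := mul_le_mul_of_nonneg_left hVt (by positivity : 0 ≤ 7 / 9 * ubar ^ 2)
          nlinarith [sq_nonneg ubar]
        have e := hsol.bc_one t ht
        rw [sat_eq_self (abs_le_of_sq_le_sq hU2 hubar.le),
          feedback_eq (X t) (f₁ := dx (u t))] at e
        linarith
      have hz0 := zTrans₁_zero (A := A) (B := B) (K := K) (a := a) (c := c) (f := u t) (X t) h0
      set Z₂ : L2 := toL2 (fun x => zTrans A B K a c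
        (mv (A - a • 1) (X t) + u t 0 • colVec B) (dx (dx (u t))) x
          + (a + c) * zTrans A B K a c (X t) (u t) x) with hZ₂
      have hX' : HasDerivAt X (mv A (X t) + mv A₁ (X (t - τ t)) + u t 0 • colVec B) t := by
        refine (hsol.ode t ht).congr_deriv ?_
        rw [WithLp.toLp_add, ← ofLp_mv, ← ofLp_mv]
      have hX'' : mv A (X t) + mv A₁ (X (t - τ t)) + u t 0 • colVec B =
          mv (A + B * K) (X t) + mv A₁ (X (t - τ t))
            + zTrans A B K a c (X t) (u t) 0 • colVec B := by
        rw [apply_zero_eq A B K a c (u t) (X t), mv_add_apply, mulVec_colVec_row]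
        module
      have hZ' : HasDerivAt Z (Z₂ - c • Z t + a₂ • Z (t - τ t)
          - zX A K a c (mv (A₁ - a₂ • 1) (X (t - τ t)))) t := by
        have e := zU_generator (A := A) (A₁ := A₁) (B := B) (K := K) (a := a) (a₂ := a₂) (c := c)
          (X t) (X (t - τ t)) H Hτ.sq_zero
        have d := ((zU A B K a c).hasFDerivAt.comp_hasDerivAt t (hsol.pde t ht)).sub
          ((zX A K a c).hasFDerivAt.comp_hasDerivAt t hX')
        rw [e] at d
        refine d.congr_of_eventuallyEq ?_
        filter_upwards [Ioi_mem_nhds ht] with s hs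
        exact hZeq s (by linarith [show (0 : ℝ) < s from hs])
      -- The tangent of V with coefficients frozen at time t: a linear functional of X(s) and z(s),
      -- hence differentiable at s = t.
      refine ⟨fun s => 2 * inner ℝ (mv P (X t)) (X s)
        + inner ℝ ((2 * p₁) • Z t - (2 * p₂) • Z₂) (Z s), _,
        (((hasDerivAt_const t (mv P (X t))).inner ℝ hX').const_mul 2).add
          ((hasDerivAt_const t _).inner ℝ hZ'), fun s hs => ?_, ?_⟩
      · have := lyap_sub_ge (X := X t) (X s) hP.posSemidef hp₁.le hp₂.le H (hreg0 s hs.le) h0 hsat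
        refine le_trans (le_of_eq ?_) this
        rw [inner_sub_right, inner_sub_right]
        ring
      · have hb := hbound (X t) (X (t - τ t)) (zTrans A B K a c (X t) (u t) 0) (Z t) (Z₁ t) Z₂
          (Z (t - τ t)) (zX A K a c (mv (A₁ - a₂ • 1) (X (t - τ t))))
          (by rw [hz.inner_second hz.prim hz.sq_one hz0 hsat, real_inner_self_eq_norm_sq])
          (hz.prim.zero_sq_le hz.sq_one) (hz.prim₁.wirtinger hz.sq hz0 hsat)
          (norm_zX_sq_le _)
        rw [inner_zero_left, inner_zero_left, add_zero, add_zero, hX'']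
        -- The bound lacks the nonnegative term p₂‖z_x(t-τ)‖² of V(t-τ).
        refine hb.trans (add_le_add le_rfl (mul_le_mul_of_nonneg_left ?_ (by positivity)))
        exact le_add_of_nonneg_right (by positivity)
  have hlim : Tendsto V atTop (𝓝 0) := by
    refine squeeze_zero' (Eventually.of_forall fun t => ?_) (eventually_atTop.2 ⟨0, hdecay⟩) ?_
    · have := inner_mv_nonneg hP.posSemidef (X t)
      simp only [hVdef, lyap]; positivity
    · have h1 : Tendsto (fun t : ℝ => -α * t) atTop atBot :=
        tendsto_id.const_mul_atTop_of_neg (neg_lt_zero.2 hα)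
      simpa using (Real.tendsto_exp_atBot.comp h1).const_mul (9 / 8)
  exact tendsto_normH1_of_lyap hP hp₁ hp₂ (eventually_atTop.2 ⟨-h, hreg⟩) hlim
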